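/- **Setting.** Let $E\to M$ be a nonzero smooth real vector bundle of finite rank over a smooth (finite-dimensional, Hausdorff, $\sigma$-compact, boundaryless) manifold. - The gauge Lie algebroid $\mathfrak D E$ has as fibre over $m$ the pairs $\mathfrak d=(D,x)$ of an $\mathbb R$-linear map $D:\Gamma(E)\to E_m$ and a vector $x=\alpha(\mathfrak d)\in T_mM$ with $D(fu)=f(m)D(u)+x(f)\,u(m)$ ($D$ determines $x$); we write $\mathfrak d u=D(u)$. Its sections act as derivations of $\Gamma(E)$, its bracket $[\cdot,\cdot]_{\mathfrak D}$ is the commutator, $\alpha:\mathfrak DE\to TM$ is its anchor, and $\mathbb i:\mathfrak{gl}(E)\hookrightarrow\mathfrak DE$ is the kernel of $\alpha$. - The first jet bundle is $\mathfrak JE=\{\nu\in\mathrm{Hom}(\mathfrak DE,E):\nu(\Phi)=\Phi(\nu(1_E))\ \forall\,\Phi\in\mathfrak{gl}(E)\}$, the jet $[u]_m$ being the map $\mathfrak d\mapsto\mathfrak d u$; we write $\langle\nu,\mathfrak d\rangle_E=\nu(\mathfrak d)$. The projection $\mathbb p:\mathfrak JE\to E$ is $\nu\mapsto\nu(1_E)$,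 the embedding $\mathbb e:\mathrm{Hom}(TM,E)\hookrightarrow\mathfrak JE$ is $y\mapsto y\circ\alpha$, and $\mathbb d:\Gamma(E)\to\Gamma(\mathfrak JE)$ is $u\mapsto(m\mapsto[u]_m)$. For $\mathfrak d\in\Gamma(\mathfrak DE)$ and $\mu\in\Gamma(\mathfrak JE)$ the Lie derivative $\mathfrak L_{\mathfrak d}\mu\in\Gamma(\mathfrak JE)$ is given by $\langle\mathfrak L_{\mathfrak d}\mu,\mathfrak r\rangle_E=\mathfrak d\langle\mu,\mathfrak r\rangle_E-\langle\mu,[\mathfrak d,\mathfrak r]_{\mathfrak D}\rangle_E$. - The omni-Lie algebroid is $\mathcal E=\mathfrak DE\oplus\mathfrak JE$ with the $E$-valued pairing $(\mathfrak d+\mu,\mathfrak r+\nu)_+=\tfrac12(\langle\nu,\mathfrak d\rangle_E+\langle\mu,\mathfrak r\rangle_E)$ and the bracket $$\{\mathfrak d+\mu,\mathfrak r+\nu\}=[\mathfrak d,\mathfrak r]_{\mathfrak D}+\mathfrak L_{\mathfrak d}\nu-\mathfrak L_{\mathfrak r}\mu+\mathbb d\langle\mu,\mathfrak r\rangle_E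 .$$ - Put $\mathcal T=TM\oplus E$. The projection $\mathbf b:\mathcal E\to\mathcal T$ is $\mathbf b(\mathfrak d+\mu)=\alpha(\mathfrak d)+\mathbb p(\mu)$, and $\mathbf a:\mathrm{Hom}(\mathcal T,E)\hookrightarrow\mathcal E$ is $\mathbf a(h)=\mathbb i(h|_E)+\mathbb e(h|_{TM})$. We regard $\mathrm{Hom}(\mathcal T,E)$ as a subbundle of $\mathcal E$ through $\mathbf a$. For a subbundle $A\subset\mathcal T$ put $A^0=\{h\in\mathrm{Hom}(\mathcal T,E):h|_A=0\}\subset\mathcal E$. - A *Dirac structure* is a maximal isotropic subbundle $L\subset\mathcal E$ (every fibre $L_m$ is maximal among the isotropic subspaces of $\mathcal E_m$) with $\{\Gamma(L),\Gamma(L)\}\subset\Gamma(L)$. It is *reducible* if $\mathbf b(L)$ is a (regular) subbundle of $\mathcal T$. - A *projective Lie algebroid* is a subbundle $A\subset\mathcal T$ with a Lie algebroid structure $[\cdot,\cdot]_A$ on it whose anchor is $pr_{TM}|_A$. - $A$ *is the quotient Lie algebroid of* $L$ if the bracket of $\mathcal E$ makes $L$ a Lie algebroid whose anchor is the restriction to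 $L$ of $\mathfrak d+\mu\mapsto\alpha(\mathfrak d)$, the sequence $0\to A^0\to L\xrightarrow{\ \mathbf b\ }A\to0$ is exact, $A^0$ is an ideal of $L$, and $[\mathbf bX,\mathbf bY]_A=\mathbf b\{X,Y\}$ for all $X,Y\in\Gamma(L)$. - A *connection* is a smooth bundle map $\gamma:TM\to\mathfrak DE$ with $\alpha\circ\gamma=1_{TM}$. Its back connection $\omega:\mathfrak DE\to\mathfrak{gl}(E)$ is given by $\mathbb i\circ\omega+\gamma\circ\alpha=1_{\mathfrak DE}$, and $\tilde\gamma:E\to\mathfrak JE$ by $\langle\tilde\gamma(e),\mathfrak d\rangle_E=\omega(\mathfrak d)(e)$. The map $\gamma+\tilde\gamma:\mathcal T\to\mathcal E$ is again denoted by $\gamma$. **Theorem.** There is a bijection $L\mapsto A$ from the set of reducible Dirac structures $L\subset\mathcal E$ onto the set of projective Lie algebroids $A\subset\mathcal T$ such that a reducible Dirac structure $L$ and a projective Lie algebroid $A$ correspond to each other if and only if $A$ is the quotient Lie algebroid of $L$ (in particular $A=\mathbf b(L)$). Moreover, let $A$ be a projective Lie algebroid, $\gamma$ any connection on $E$, and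 $C\subset\mathcal T$ any subbundle with $\mathcal T=A\oplus C$. Then there is exactly one $\Omega_\gamma\in\Gamma(\mathrm{Hom}(\wedge^2\mathcal T,E))$ with $$\Omega_\gamma(a,b)=[a,b]_A-\mathbf b\{\gamma(a),\gamma(b)\}\quad(a,b\in\Gamma(A)),\qquad \Omega_\gamma(c,t)=0\quad(c\in C,\ t\in\mathcal T),$$ and the Dirac structure $L^A$ corresponding to $A$ is $$L^A=\gamma(A)+\Omega_\gamma(A)+A^0:=\{\gamma(a)+\Omega_\gamma(a,\cdot)+h : a\in A,\ h\in A^0\}.$$ -/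

import Mathlib

set_option linter.unusedSectionVars false

open Bundle
open scoped Manifold ContDiff Bundle

noncomputable section

namespace OmniLie

section Sections

variable {EM : Type*} [NormedAddCommGroup EM] [NormedSpace ℝ EM]
  {H : Type*} [TopologicalSpace H] (I : ModelWithCorners ℝ EM H)
  {M : Type*} [TopologicalSpace M] [ChartedSpace H M]
  (F : Type*) [NormedAddCommGroup F] [NormedSpace ℝ F]
  {V : M → Type*} [TopologicalSpace (TotalSpace F V)]
  [∀ m, AddCommGroup (V m)] [∀ m, Module ℝ (V m)] [∀ m, TopologicalSpace (V m)]
  [FiberBundle F V]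

/-- Smoothness of a (set-theoretic) section of a vector bundle. -/
def IsSmoothSection (s : Π m, V m) : Prop :=
  ContMDiff I (I.prod 𝓘(ℝ, F)) ∞ fun m => TotalSpace.mk' F m (s m)

variable (V) in
/-- The space `Γ(V)` of smooth sections of a vector bundle `V`. -/
abbrev Sec := Cₛ^∞⟮I; F, V⟯

variable {I F}

/-- The product `f u` of a smooth function and a smooth section. -/
instance [VectorBundle ℝ F V] : SMul C^∞⟮I, M; ℝ⟯ Cₛ^∞⟮I; F, V⟯ where
  smul f u := ⟨fun m => f m • u m, f.contMDiff.smul_section u.contMDiff⟩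

theorem smul_sec_apply [VectorBundle ℝ F V] (f : C^∞⟮I, M; ℝ⟯) (u : Cₛ^∞⟮I; F, V⟯) (m : M) :
    (f • u) m = f m • u m := rfl

theorem exists_cutoff_frame [FiniteDimensional ℝ EM] [T2Space M] [IsManifold I ∞ M]
    [FiniteDimensional ℝ F] [VectorBundle ℝ F V] [ContMDiffVectorBundle ∞ F V I] (m₀ : M) :
    ∃ (n : ℕ) (s : Fin n → Cₛ^∞⟮I; F, V⟯) (c : Fin n → Π m, V m →ₗ[ℝ] ℝ)
      (ψ : C^∞⟮I, M; ℝ⟯), ψ m₀ = 1 ∧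
      (∀ i (u : Cₛ^∞⟮I; F, V⟯), ContMDiff I 𝓘(ℝ) ∞ fun m => c i m (u m)) ∧
      ∀ m (v : V m), ψ m • v = ∑ i, c i m v • s i m := by
  classical
  set e := trivializationAt F V m₀
  have hm : m₀ ∈ e.baseSet := FiberBundle.mem_baseSet_trivializationAt F V m₀
  set b := Module.finBasis ℝ F
  obtain ⟨χ, -, hχ⟩ := (SmoothBumpFunction.nhds_basis_tsupport (I := I) m₀).mem_iff.1
    (e.open_baseSet.mem_nhds hm)
  have hχs : ContMDiff I 𝓘(ℝ) ∞ χ := χ.contMDiff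
  refine ⟨_, fun i => ⟨fun m => χ m • e.localFrame b i m,
      ContMDiffOn.smul_section_of_tsupport hχs.contMDiffOn e.open_baseSet hχ
        (e.contMDiffOn_localFrame_baseSet ∞ b i)⟩,
    fun i m => χ m • e.localFrameCoeff I b i m, ⟨fun m => χ m * χ m, hχs.mul hχs⟩, ?_, ?_, ?_⟩
  · show χ m₀ * χ m₀ = 1
    simp
  · intro i u
    apply contMDiff_of_tsupport
    intro x hx
    have hx' : x ∈ e.baseSet := by
      apply hχ
      refine closure_mono ?_ hx
      intro y hy
      simp only [Function.mem_support, LinearMap.smul_apply, smul_eq_mul] at hy ⊢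
      exact left_ne_zero_of_mul hy
    exact (hχs x).mul (contMDiffAt_localFrameCoeff b hx' (u.contMDiff x) i)
  · intro m v
    by_cases hmb : m ∈ e.baseSet
    · have := e.eq_sum_localFrameCoeff_smul (I := I) (b := b) (s := FiberBundle.extend F v) hmb
      simp only [FiberBundle.extend_apply_self] at this
      simp only [LinearMap.smul_apply, ContMDiffSection.coeFn_mk, ContMDiffMap.coeFn_mk]
      conv_lhs => rw [this]
      rw [Finset.smul_sum]
      refine Finset.sum_congr rfl fun i _ => ?_
      simp only [smul_smul, smul_eq_mul]
      congr 1; ring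
    · have : χ m = 0 := by
        by_contra h
        exact hmb (hχ (subset_closure h))
      simp [this]

theorem exists_sec_eq [FiniteDimensional ℝ EM] [T2Space M] [IsManifold I ∞ M]
    [FiniteDimensional ℝ F] [VectorBundle ℝ F V] [ContMDiffVectorBundle ∞ F V I] {m : M} (v : V m) :
    ∃ u : Cₛ^∞⟮I; F, V⟯, u m = v := by
  obtain ⟨n, s, c, ψ, h1, -, h3⟩ := exists_cutoff_frame (I := I) (F := F) (V := V) m
  refine ⟨⟨fun x => ∑ i, c i m v • s i x, ContMDiff.sum_section fun i _ =>
    (s i).contMDiff.const_smul_section⟩, ?_⟩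
  simpa [h1] using (h3 m v).symm

theorem sec_sum_apply [VectorBundle ℝ F V] {n : ℕ} (s : Fin n → Cₛ^∞⟮I; F, V⟯) (m : M) :
    (∑ i, s i) m = ∑ i, s i m := by
  let φ : Cₛ^∞⟮I; F, V⟯ →+ V m := { toFun := fun s => s m, map_zero' := rfl, map_add' := fun _ _ => rfl }
  exact map_sum φ s Finset.univ

theorem exists_frame [FiniteDimensional ℝ EM] [T2Space M] [IsManifold I ∞ M]
    [FiniteDimensional ℝ F] [VectorBundle ℝ F V] [ContMDiffVectorBundle ∞ F V I] (m₀ : M) :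
    ∃ (n : ℕ) (s : Fin n → Cₛ^∞⟮I; F, V⟯) (c : Fin n → Cₛ^∞⟮I; F, V⟯ → C^∞⟮I, M; ℝ⟯)
      (ψ : C^∞⟮I, M; ℝ⟯), ψ m₀ = 1 ∧
      (∀ i u v, c i (u + v) = c i u + c i v) ∧
      (∀ i (r : ℝ) u, c i (r • u) = r • c i u) ∧
      (∀ i (f : C^∞⟮I, M; ℝ⟯) u, c i (f • u) = f * c i u) ∧
      (∀ i u, u m₀ = 0 → c i u m₀ = 0) ∧
      ∀ u, ψ • u = ∑ i, c i u • s i := by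
  obtain ⟨n, s, c, ψ, h1, h2, h3⟩ := exists_cutoff_frame (I := I) (F := F) (V := V) m₀
  refine ⟨n, s, fun i u => ⟨fun m => c i m (u m), h2 i u⟩, ψ, h1, ?_, ?_, ?_, ?_, ?_⟩
  · intro i u v; ext m; exact map_add (c i m) (u m) (v m)
  · intro i r u; ext m; exact map_smul (c i m) r (u m)
  · intro i f u; ext m; exact map_smul (c i m) (f m) (u m)
  · intro i u hu
    show c i m₀ (u m₀) = 0
    rw [hu, map_zero]
  · intro u
    ext m
    rw [sec_sum_apply]
    exact h3 m (u m)

end Sections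

section VectorFields

variable {EM : Type*} [NormedAddCommGroup EM] [NormedSpace ℝ EM] [FiniteDimensional ℝ EM]
  {H : Type*} [TopologicalSpace H] {I : ModelWithCorners ℝ EM H}
  {M : Type*} [TopologicalSpace M] [ChartedSpace H M] [T2Space M] [IsManifold I ∞ M]

variable (I M) in
/-- The space `𝔛(M)` of smooth vector fields. -/
abbrev Vec := Cₛ^∞⟮I; EM, (TangentSpace I : M → Type _)⟯

/-- The derivative `X(f)` of a smooth function along a smooth vector field. -/
def Vec.deriv (X : Vec I M) (f : C^∞⟮I, M; ℝ⟯) : C^∞⟮I, M; ℝ⟯ where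
  val m := mvfderiv I f m (X m)
  property := by
    have h1 := f.contMDiff.contMDiff_tangentMap (m := ∞) (by simp)
    have h2 := h1.comp X.contMDiff
    exact (contMDiff_snd_tangentBundle_modelSpace ℝ 𝓘(ℝ)).comp h2

/-- The Lie bracket of smooth vector fields. -/
def Vec.lie (X Y : Vec I M) : Vec I M where
  toFun := VectorField.mlieBracket I X Y
  contMDiff_toFun := by
    have h2 : IsManifold I (minSmoothness ℝ 2) M := by simpa using (inferInstance : IsManifold I 2 M)
    have h3 : IsManifold I (((⊤ : ℕ∞) : ℕ∞ω) + 1) M := (inferInstance : IsManifold I ∞ M)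
    exact ContDiff.mlieBracket_vectorField (n := ⊤) (m := ⊤) X.contMDiff Y.contMDiff (by simp)

theorem Vec.lie_smul (X Y : Vec I M) (f : C^∞⟮I, M; ℝ⟯) :
    X.lie (f • Y) = X.deriv f • Y + f • X.lie Y := by
  ext m
  exact VectorField.mlieBracket_smul_right (f.contMDiff.mdifferentiable (by simp) m)
    (Y.mdifferentiableAt)

theorem Vec.lie_add (X Y Z : Vec I M) : X.lie (Y + Z) = X.lie Y + X.lie Z := by
  ext m
  exact VectorField.mlieBracket_add_right Y.mdifferentiableAt Z.mdifferentiableAt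

theorem Vec.jacobi (X Y Z : Vec I M) :
    X.lie (Y.lie Z) = (X.lie Y).lie Z + Y.lie (X.lie Z) := by
  ext m
  have : IsManifold I (minSmoothness ℝ 3) M := by simpa using (inferInstance : IsManifold I 3 M)
  have h : ∀ Z : Vec I M, ContMDiffAt I (I.prod 𝓘(ℝ, EM)) (minSmoothness ℝ 2)
      (fun m => TotalSpace.mk' EM m (Z m)) m := fun Z =>
    (Z.contMDiff m).of_le (by simpa using (ENat.LEInfty.out : (2 : ℕ∞ω) ≤ ∞))
  exact VectorField.leibniz_identity_mlieBracket_apply (h X) (h Y) (h Z)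

theorem Vec.exists_eq {m : M} (v : TangentSpace I m) : ∃ X : Vec I M, X m = v :=
  exists_sec_eq v

theorem Vec.deriv_lie (X Y : Vec I M) (f : C^∞⟮I, M; ℝ⟯) :
    (X.lie Y).deriv f = X.deriv (Y.deriv f) - Y.deriv (X.deriv f) := by
  ext m
  by_cases h : ∃ Z : Vec I M, Z m ≠ 0
  · obtain ⟨Z, hZ⟩ := h
    have h1 := congrArg (fun W : Vec I M => W m) (Vec.jacobi X Y (f • Z))
    have h2 := congrArg (fun W : Vec I M => W m) (Vec.jacobi X Y Z)
    simp only [Vec.lie_smul, Vec.lie_add, ContMDiffSection.coe_add, Pi.add_apply,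
      smul_sec_apply] at h1 h2
    rw [h2] at h1
    have h3 : ((X.lie Y).deriv f m - (X.deriv (Y.deriv f) m - Y.deriv (X.deriv f) m)) • Z m = 0 := by
      rw [← sub_eq_zero] at h1
      rw [← neg_eq_zero, ← h1]
      module
    exact sub_eq_zero.1 ((smul_eq_zero.1 h3).resolve_right hZ)
  · push Not at h
    have key : ∀ (W : Vec I M) (g : C^∞⟮I, M; ℝ⟯), W.deriv g m = 0 := by
      intro W g
      show mvfderiv I g m (W m) = 0
      rw [h W, map_zero]
    show (X.lie Y).deriv f m = X.deriv (Y.deriv f) m - Y.deriv (X.deriv f) m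
    simp [key]

theorem Vec.deriv_mul (X : Vec I M) (f g : C^∞⟮I, M; ℝ⟯) (m : M) :
    X.deriv (f * g) m = f m * X.deriv g m + X.deriv f m * g m := by
  have := mvfderiv_mul (f.contMDiff.mdifferentiable (by simp) m)
    (g.contMDiff.mdifferentiable (by simp) m)
  have := congrArg (fun L => L (X m)) this
  simp at this
  refine Eq.trans this ?_
  show _ = f m * mvfderiv I g m (X m) + mvfderiv I f m (X m) * g m
  ring

theorem Vec.deriv_add (X : Vec I M) (f g : C^∞⟮I, M; ℝ⟯) :
    X.deriv (f + g) = X.deriv f + X.deriv g := by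
  ext m
  have := mvfderiv_add (f.contMDiff.mdifferentiable (by simp) m)
    (g.contMDiff.mdifferentiable (by simp) m)
  exact congrArg (fun L => L (X m)) this

theorem Vec.zero_deriv (f : C^∞⟮I, M; ℝ⟯) (m : M) : (0 : Vec I M).deriv f m = 0 :=
  map_zero (mvfderiv I f m)

theorem Vec.deriv_const_smul (X : Vec I M) (r : ℝ) (f : C^∞⟮I, M; ℝ⟯) :
    X.deriv (r • f) = r • X.deriv f := by
  ext m
  have := Vec.deriv_mul X (ContMDiffMap.const r) f m
  have h0 : X.deriv (ContMDiffMap.const r) m = 0 := by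
    show mvfderiv I (fun _ : M => r) m (X m) = 0
    rw [mvfderiv_const]; rfl
  rw [h0, zero_mul, add_zero] at this
  exact this

end VectorFields

section Gauge

variable {EM : Type*} [NormedAddCommGroup EM] [NormedSpace ℝ EM] [FiniteDimensional ℝ EM]
  {H : Type*} [TopologicalSpace H] (I : ModelWithCorners ℝ EM H)
  {M : Type*} [TopologicalSpace M] [ChartedSpace H M] [T2Space M] [IsManifold I ∞ M]
  (F : Type*) [NormedAddCommGroup F] [NormedSpace ℝ F] [FiniteDimensional ℝ F]
  (E : M → Type*) [TopologicalSpace (TotalSpace F E)]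
  [∀ m, AddCommGroup (E m)] [∀ m, Module ℝ (E m)] [∀ m, TopologicalSpace (E m)]
  [FiberBundle F E] [VectorBundle ℝ F E] [ContMDiffVectorBundle ∞ F E I]

/-- The fibre `(𝔇E)_m` of the gauge Lie algebroid: pairs `(D, x)` of an `ℝ`-linear map
`D : Γ(E) → E_m` and a tangent vector `x` at `m` with `D(f u) = f(m) D(u) + x(f) u(m)`.
(For nonzero `E` the vector `x` is determined by `D`.) -/
def derSubmodule (m : M) : Submodule ℝ ((Cₛ^∞⟮I; F, E⟯ →ₗ[ℝ] E m) × TangentSpace I m) where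
  carrier := {δ | ∀ (f : C^∞⟮I, M; ℝ⟯) (u : Cₛ^∞⟮I; F, E⟯),
    δ.1 (f • u) = f m • δ.1 u + mvfderiv I f m δ.2 • u m}
  zero_mem' := by intro f u; simp
  add_mem' := by
    intro a b ha hb f u
    simp only [Prod.fst_add, Prod.snd_add, LinearMap.add_apply, ha f u, hb f u, map_add]
    module
  smul_mem' := by
    intro r a ha f u
    simp only [Prod.smul_fst, Prod.smul_snd, LinearMap.smul_apply, ha f u, map_smul, smul_eq_mul]
    module


/-- The fibre `(𝔇E)_m` of the gauge Lie algebroid, see `derSubmodule`. -/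
abbrev DerFiber (m : M) := ↥(derSubmodule I F E m)

/-- The embedding `𝕚 : gl(E_m) → (𝔇E)_m`. -/
def glEmb (m : M) : (E m →ₗ[ℝ] E m) →ₗ[ℝ] DerFiber I F E m where
  toFun Φ := ⟨({ toFun := fun u => Φ (u m), map_add' := by simp, map_smul' := by simp }, 0), by
    intro f u; simp [smul_sec_apply]⟩
  map_add' Φ Ψ := by
    apply Subtype.ext
    refine Prod.ext rfl ?_
    exact (add_zero 0).symm
  map_smul' r Φ := by
    apply Subtype.ext
    refine Prod.ext rfl ?_
    exact (smul_zero r).symm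

/-- The anchor `α : (𝔇E)_m → T_mM`. -/
def anchor (m : M) : DerFiber I F E m →ₗ[ℝ] TangentSpace I m :=
  LinearMap.snd ℝ _ _ ∘ₗ (derSubmodule I F E m).subtype

/-- The fibre `(𝔍E)_m` of the jet bundle, realised in `Hom((𝔇E)_m, E_m)` through the `E`-valued
pairing: the maps `ν` with `ν(Φ) = Φ(ν(1_E))` for all `Φ ∈ gl(E_m)`.  The jet `[u]_m` of a section
`u` is the map `𝔡 ↦ 𝔡 u`. -/
def jetSubmodule (m : M) : Submodule ℝ (DerFiber I F E m →ₗ[ℝ] E m) where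
  carrier := {ν | ∀ Φ : E m →ₗ[ℝ] E m, ν (glEmb I F E m Φ) = Φ (ν (glEmb I F E m LinearMap.id))}
  zero_mem' := by intro Φ; simp
  add_mem' := by intro a b ha hb Φ; simp [ha Φ, hb Φ]
  smul_mem' := by intro r a ha Φ; simp [ha Φ]


/-- The fibre `(𝔍E)_m` of the jet bundle, see `jetSubmodule`. -/
abbrev JetFiber (m : M) := ↥(jetSubmodule I F E m)

/-- The projection `𝕡 : (𝔍E)_m → E_m`, `[u]_m ↦ u(m)`. -/
def jetProj (m : M) : JetFiber I F E m →ₗ[ℝ] E m :=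
  LinearMap.applyₗ (glEmb I F E m LinearMap.id) ∘ₗ (jetSubmodule I F E m).subtype

/-- The embedding `𝕖 : Hom(T_mM, E_m) → (𝔍E)_m`. -/
def homEmb (m : M) : (TangentSpace I m →ₗ[ℝ] E m) →ₗ[ℝ] JetFiber I F E m where
  toFun y := ⟨y ∘ₗ anchor I F E m, by
    intro Φ
    have h : ∀ Ψ, anchor I F E m (glEmb I F E m Ψ) = 0 := fun Ψ => rfl
    simp [h]⟩
  map_add' y z := rfl
  map_smul' r y := rfl

/-- The space `Γ(𝔇E)` of smooth sections of the gauge Lie algebroid. -/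
def derSections : Submodule ℝ (Π m, DerFiber I F E m) where
  carrier := {d | (∀ u : Cₛ^∞⟮I; F, E⟯, IsSmoothSection I F (V := E) fun m => (d m).1.1 u) ∧
    IsSmoothSection I EM (V := (TangentSpace I : M → Type _)) fun m => anchor I F E m (d m)}
  zero_mem' := ⟨fun _ => (0 : Cₛ^∞⟮I; F, E⟯).contMDiff, (0 : Vec I M).contMDiff⟩
  add_mem' := fun ha hb => ⟨fun u => (ha.1 u).add_section (hb.1 u), ha.2.add_section hb.2⟩
  smul_mem' := fun _ _ ha => ⟨fun u => (ha.1 u).const_smul_section, ha.2.const_smul_section⟩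


/-- The space `Γ(𝔇E)`, as a type. -/
abbrev DerSec := ↥(derSections I F E)

/-- The space `Γ(𝔍E)` of smooth sections of the jet bundle: a section is smooth if its pairing
with every smooth section of `𝔇E` is smooth. -/
def jetSections : Submodule ℝ (Π m, JetFiber I F E m) where
  carrier := {μ | ∀ d ∈ derSections I F E, IsSmoothSection I F (V := E) fun m => (μ m).1 (d m)}
  zero_mem' := fun _ _ => (0 : Cₛ^∞⟮I; F, E⟯).contMDiff
  add_mem' := fun ha hb d hd => (ha d hd).add_section (hb d hd)
  smul_mem' := fun _ _ ha d hd => (ha d hd).const_smul_section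


/-- The space `Γ(𝔍E)`, as a type. -/
abbrev JetSec := ↥(jetSections I F E)

variable {I F E}

/-- The action of a section of `𝔇E` on sections of `E`. -/
def derAct (d : DerSec I F E) (u : Cₛ^∞⟮I; F, E⟯) : Cₛ^∞⟮I; F, E⟯ :=
  ⟨fun m => (d.1 m).1.1 u, d.2.1 u⟩

/-- The vector field `α(𝔡)`. -/
def derSymbol (d : DerSec I F E) : Vec I M :=
  ⟨fun m => anchor I F E m (d.1 m), d.2.2⟩

theorem derAct_smul (d : DerSec I F E) (f : C^∞⟮I, M; ℝ⟯) (u : Cₛ^∞⟮I; F, E⟯) :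
    derAct d (f • u) = f • derAct d u + (derSymbol d).deriv f • u := by
  ext m; exact (d.1 m).2 f u

theorem derAct_add (d : DerSec I F E) (u v : Cₛ^∞⟮I; F, E⟯) :
    derAct d (u + v) = derAct d u + derAct d v := by
  ext m; exact map_add (d.1 m).1.1 u v

theorem derAct_const_smul (d : DerSec I F E) (r : ℝ) (u : Cₛ^∞⟮I; F, E⟯) :
    derAct d (r • u) = r • derAct d u := by
  ext m; exact map_smul (d.1 m).1.1 r u

theorem derSec_ext {d r : DerSec I F E} (h1 : ∀ u, derAct d u = derAct r u)
    (h2 : derSymbol d = derSymbol r) : d = r := by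
  apply Subtype.ext
  funext m
  apply Subtype.ext
  refine Prod.ext (LinearMap.ext fun u => ?_) ?_
  · exact congrArg (fun w : Cₛ^∞⟮I; F, E⟯ => w m) (h1 u)
  · exact congrArg (fun w : Vec I M => w m) h2

/-- A section of `𝔇E` from an `ℝ`-linear operator on `Γ(E)` with a Leibniz rule. -/
def derMk (D : Cₛ^∞⟮I; F, E⟯ → Cₛ^∞⟮I; F, E⟯) (X : Vec I M)
    (hadd : ∀ u v, D (u + v) = D u + D v) (hsmul : ∀ (r : ℝ) u, D (r • u) = r • D u)
    (hleib : ∀ (f : C^∞⟮I, M; ℝ⟯) u, D (f • u) = f • D u + X.deriv f • u) : DerSec I F E :=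
  ⟨fun m => ⟨({ toFun := fun u => D u m
                map_add' := fun u v => by rw [hadd]; rfl
                map_smul' := fun r u => by rw [hsmul]; rfl }, X m),
    fun f u => by
      show D (f • u) m = _
      rw [hleib]; rfl⟩,
    fun u => (D u).contMDiff, X.contMDiff⟩

/-- The commutator bracket `[𝔡, 𝔯]_𝔇 = 𝔡 ∘ 𝔯 - 𝔯 ∘ 𝔡` on `Γ(𝔇E)`. -/
def derLie (d r : DerSec I F E) : DerSec I F E :=
  derMk (fun u => derAct d (derAct r u) - derAct r (derAct d u))
    ((derSymbol d).lie (derSymbol r))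
    (fun u v => by simp only [derAct_add]; abel)
    (fun c u => by simp only [derAct_const_smul, smul_sub])
    (fun f u => by
      simp only [derAct_add, derAct_smul, Vec.deriv_lie]
      ext m
      simp only [ContMDiffSection.coe_add, ContMDiffSection.coe_sub, Pi.add_apply, Pi.sub_apply,
        smul_sec_apply, ContMDiffMap.coe_sub]
      module)

theorem derAct_derLie (d r : DerSec I F E) (u : Cₛ^∞⟮I; F, E⟯) :
    derAct (derLie d r) u = derAct d (derAct r u) - derAct r (derAct d u) := rfl

theorem derSymbol_derLie (d r : DerSec I F E) :
    derSymbol (derLie d r) = (derSymbol d).lie (derSymbol r) := rfl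

theorem der_eq_zero {m : M} (δ : DerFiber I F E m) (hα : anchor I F E m δ = 0)
    (u : Cₛ^∞⟮I; F, E⟯) (hu : u m = 0) : δ.1.1 u = 0 := by
  obtain ⟨n, s, c, ψ, h1, -, -, -, h5, h6⟩ := exists_frame (I := I) (F := F) (V := E) m
  have hα' : δ.1.2 = 0 := hα
  have := congrArg δ.1.1 (h6 u)
  rw [map_sum, δ.2 ψ u, h1, hu] at this
  have h0 : ∀ i, δ.1.1 (c i u • s i) = 0 := fun i => by
    rw [δ.2, hα', h5 _ u hu, map_zero, zero_smul, zero_smul, add_zero]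
  simpa [h0] using this

/-- An element of `(𝔇E)_m` with vanishing anchor lies in `gl(E_m)`. -/
theorem exists_glEmb_eq {m : M} (δ : DerFiber I F E m) (hα : anchor I F E m δ = 0) :
    ∃ Φ, glEmb I F E m Φ = δ := by
  choose e he using fun v : E m => exists_sec_eq (I := I) (F := F) v
  have key : ∀ u w : Cₛ^∞⟮I; F, E⟯, u m = w m → δ.1.1 u = δ.1.1 w := fun u w h => by
    rw [← sub_eq_zero, ← map_sub]
    exact der_eq_zero δ hα _ (by simp [h])
  refine ⟨{ toFun := fun v => δ.1.1 (e v), map_add' := fun v w => ?_, map_smul' := fun r v => ?_ },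
    ?_⟩
  · rw [← map_add]; exact key _ _ (by simp [he])
  · rw [RingHom.id_apply, ← map_smul]; exact key _ _ (by simp [he])
  · apply Subtype.ext
    refine Prod.ext (LinearMap.ext fun u => ?_) hα.symm
    exact key _ _ (he _)

theorem glEmb_injective (m : M) : Function.Injective (glEmb I F E m) := by
  intro Φ Ψ h
  ext v
  obtain ⟨u, rfl⟩ := exists_sec_eq (I := I) (F := F) v
  exact congrArg (fun δ : DerFiber I F E m => δ.1.1 u) h

theorem exists_gl_sec {m : M} (Φ : E m →ₗ[ℝ] E m) :
    ∃ d : DerSec I F E, d.1 m = glEmb I F E m Φ ∧ derSymbol d = 0 := by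
  obtain ⟨n, s, c, ψ, h1, h2, h3, h4, -, h6⟩ := exists_frame (I := I) (F := F) (V := E) m
  choose w hw using fun i => exists_sec_eq (I := I) (F := F) (Φ (s i m))
  refine ⟨derMk (fun u => ∑ i, c i u • w i) 0 ?_ ?_ ?_, ?_, rfl⟩
  · intro u v
    ext x
    simp [sec_sum_apply, smul_sec_apply, h2, add_smul, Finset.sum_add_distrib]
  · intro r u
    ext x
    simp [sec_sum_apply, smul_sec_apply, h3, mul_smul, Finset.smul_sum]
  · intro f u
    ext x
    simp [sec_sum_apply, smul_sec_apply, h4, mul_smul, Finset.smul_sum, Vec.zero_deriv]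
  · apply Subtype.ext
    refine Prod.ext (LinearMap.ext fun u => ?_) rfl
    show (∑ i, c i u • w i : Cₛ^∞⟮I; F, E⟯) m = Φ (u m)
    have := congrArg (fun w : Cₛ^∞⟮I; F, E⟯ => w m) (h6 u)
    simp only [sec_sum_apply, smul_sec_apply, h1, one_smul] at this
    rw [this, map_sum]
    simp [sec_sum_apply, smul_sec_apply, hw]

/-- A section of `𝔇E` whose symbol is a prescribed vector field near `m`. -/
theorem exists_local_lift (m : M) : ∃ (ψ : C^∞⟮I, M; ℝ⟯), ψ m = 1 ∧
    ∀ X : Vec I M, ∃ d : DerSec I F E, derSymbol d = ψ • X := by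
  obtain ⟨n, s, c, ψ, h1, h2, h3, h4, -, h6⟩ := exists_frame (I := I) (F := F) (V := E) m
  refine ⟨ψ, h1, fun X => ⟨derMk (fun u => ∑ i, X.deriv (c i u) • s i) (ψ • X) ?_ ?_ ?_, rfl⟩⟩
  · intro u v
    ext x
    simp [sec_sum_apply, smul_sec_apply, h2, Vec.deriv_add, add_smul, Finset.sum_add_distrib]
  · intro r u
    ext x
    simp [sec_sum_apply, smul_sec_apply, h3, Vec.deriv_const_smul, mul_smul, Finset.smul_sum]
  · intro f u
    have h6x : ∀ x, ψ x • u x = ∑ i, c i u x • s i x := fun x => by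
      have := congrArg (fun w : Cₛ^∞⟮I; F, E⟯ => w x) (h6 u)
      simpa only [sec_sum_apply, smul_sec_apply] using this
    have hX : ∀ x, (ψ • X).deriv f x = ψ x * X.deriv f x := fun x => by
      show mvfderiv I f x (ψ x • X x) = _
      rw [map_smul]; rfl
    ext x
    simp only [sec_sum_apply, smul_sec_apply, h4, Vec.deriv_mul, ContMDiffSection.coe_add,
      Pi.add_apply, add_smul, Finset.sum_add_distrib, mul_smul, Finset.smul_sum, hX]
    congr 1
    rw [smul_comm, h6x, Finset.smul_sum]

/-- Every element of `(𝔇E)_m` is the value of a smooth section. -/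
theorem exists_derSec_eq {m : M} (δ : DerFiber I F E m) : ∃ d : DerSec I F E, d.1 m = δ := by
  obtain ⟨ψ, hψ, h⟩ := exists_local_lift (I := I) (F := F) (E := E) m
  obtain ⟨X, hX⟩ := Vec.exists_eq (anchor I F E m δ)
  obtain ⟨d, hd⟩ := h X
  have hd' : anchor I F E m (d.1 m) = anchor I F E m δ := by
    have := congrArg (fun w : Vec I M => w m) hd
    refine Eq.trans this ?_
    show ψ m • X m = _
    rw [hψ, one_smul, hX]
  obtain ⟨Φ, hΦ⟩ := exists_glEmb_eq (δ - d.1 m) (by rw [map_sub, hd', sub_self])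
  obtain ⟨r, hr, -⟩ := exists_gl_sec (I := I) (F := F) Φ
  refine ⟨d + r, ?_⟩
  show d.1 m + r.1 m = δ
  rw [hr, hΦ]; abel

/-- The product of a smooth function and a section of `𝔇E`. -/
def derSmul (f : C^∞⟮I, M; ℝ⟯) (d : DerSec I F E) : DerSec I F E :=
  ⟨fun m => f m • d.1 m, fun u => f.contMDiff.smul_section (d.2.1 u),
    f.contMDiff.smul_section d.2.2⟩

/-- An operation on `Γ(𝔇E)` that is `C^∞`-linear at `m` depends only on the value at `m`. -/
theorem tensorial_derSec {m : M} {W : Type*} [AddCommGroup W] [Module ℝ W]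
    (T : DerSec I F E →ₗ[ℝ] W) (hT : ∀ f d, T (derSmul f d) = f m • T d)
    (d : DerSec I F E) (hd : d.1 m = 0) : T d = 0 := by
  obtain ⟨χ, hχ, hlift⟩ := exists_local_lift (I := I) (F := F) (E := E) m
  obtain ⟨k, Y, a, φ, a1, -, -, -, a5, a6⟩ :=
    exists_frame (I := I) (F := EM) (V := (TangentSpace I : M → Type _)) m
  choose D hD using fun i => hlift (Y i)
  have hsym : derSymbol d m = 0 := by
    show anchor I F E m (d.1 m) = 0
    rw [hd, map_zero]
  -- reduce to a section with vanishing symbol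
  set r : DerSec I F E := derSmul χ (derSmul φ d) - ∑ i, derSmul (a i (derSymbol d)) (D i) with hr
  have hr0 : derSymbol r = 0 := by
    ext x
    have h1 := congrArg (fun w : Vec I M => w x) (a6 (derSymbol d))
    have h2 : ∀ i, anchor I F E x ((D i).1 x) = χ x • Y i x := fun i =>
      congrArg (fun w : Vec I M => w x) (hD i)
    simp only [sec_sum_apply, smul_sec_apply] at h1
    show anchor I F E x (r.1 x) = 0
    have h3 : r.1 x = χ x • φ x • d.1 x - ∑ i, a i (derSymbol d) x • (D i).1 x := by
      simp [hr, derSmul]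
    have h4 : φ x • anchor I F E x (d.1 x) = ∑ i, (a i (derSymbol d)) x • Y i x := h1
    rw [h3, map_sub, map_smul, map_smul, map_sum, h4, Finset.smul_sum, sub_eq_zero]
    refine Finset.sum_congr rfl fun i _ => ?_
    rw [map_smul, h2, smul_comm]
  have hrm : r.1 m = 0 := by
    have h3 : r.1 m = χ m • φ m • d.1 m - ∑ i, a i (derSymbol d) m • (D i).1 m := by
      simp [hr, derSmul]
    rw [h3, hd]
    simp [a5 _ _ hsym]
  have hTr : T r = T d := by
    have e1 := T.map_sub (derSmul χ (derSmul φ d)) (∑ i, derSmul (a i (derSymbol d)) (D i))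
    refine (hr ▸ e1).trans ?_
    rw [map_sum]
    simp [hT, hχ, a1, a5 _ _ hsym]
  rw [← hTr]
  -- a section with vanishing symbol is an endomorphism
  obtain ⟨n, s, c, ψ, h1, h2, h3, h4, h5, h6⟩ := exists_frame (I := I) (F := F) (V := E) m
  have hB : ∀ i j, ∃ B : DerSec I F E, derSymbol B = 0 ∧ ∀ u, derAct B u = c i u • s j := by
    intro i j
    refine ⟨derMk (fun u => c i u • s j) 0 ?_ ?_ ?_, rfl, fun u => rfl⟩
    · intro u v
      ext x
      simp [smul_sec_apply, h2, add_smul]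
    · intro r u
      ext x
      simp [smul_sec_apply, h3, mul_smul]
    · intro f u
      ext x
      simp [smul_sec_apply, h4, mul_smul, Vec.zero_deriv]
  choose B hB0 hB using hB
  have hdec : derSmul ψ (derSmul ψ r) = ∑ i, ∑ j, derSmul (c j (derAct r (s i))) (B i j) := by
    apply derSec_ext
    · intro u
      have e1 : derAct r (ψ • u) = ∑ i, c i u • derAct r (s i) := by
        ext x
        have hx : anchor I F E x (r.1 x) = 0 := congrArg (fun w : Vec I M => w x) hr0
        have hx' : (r.1 x).1.2 = 0 := hx
        show (r.1 x).1.1 (ψ • u) = _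
        rw [h6, map_sum, sec_sum_apply]
        refine Finset.sum_congr rfl fun i _ => ?_
        rw [(r.1 x).2, hx', map_zero, zero_smul, add_zero]
        rfl
      ext x
      have e2 := congrArg (fun w : Cₛ^∞⟮I; F, E⟯ => ψ x • w x) e1
      have hx : anchor I F E x (r.1 x) = 0 := congrArg (fun w : Vec I M => w x) hr0
      have hx' : (r.1 x).1.2 = 0 := hx
      have e3 : derAct r (ψ • u) x = ψ x • derAct r u x := by
        show (r.1 x).1.1 (ψ • u) = _
        rw [(r.1 x).2, hx', map_zero, zero_smul, add_zero]; rfl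
      have e4 : ∀ i, ψ x • derAct r (s i) x = ∑ j, c j (derAct r (s i)) x • s j x := fun i => by
        have := congrArg (fun w : Cₛ^∞⟮I; F, E⟯ => w x) (h6 (derAct r (s i)))
        simpa only [sec_sum_apply, smul_sec_apply] using this
      have e5 : derAct (derSmul ψ (derSmul ψ r)) u x = ψ x • ψ x • derAct r u x := rfl
      have e6 : derAct (∑ i, ∑ j, derSmul (c j (derAct r (s i))) (B i j)) u x =
          ∑ i, ∑ j, c j (derAct r (s i)) x • c i u x • s j x := by
        have : ∀ i j, ((B i j).1 x).1.1 u = c i u x • s j x := fun i j =>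
          congrArg (fun w : Cₛ^∞⟮I; F, E⟯ => w x) (hB i j u)
        let ev : DerSec I F E →ₗ[ℝ] E x :=
          LinearMap.applyₗ u ∘ₗ LinearMap.fst ℝ _ _ ∘ₗ (derSubmodule I F E x).subtype ∘ₗ
            LinearMap.proj x ∘ₗ (derSections I F E).subtype
        have hev : ∀ f i j, ev (derSmul f (B i j)) = f x • c i u x • s j x := fun f i j => by
          rw [← this]; rfl
        show ev _ = _
        simp only [map_sum, hev]
      simp only [e3, sec_sum_apply, smul_sec_apply] at e2
      rw [e5, e6, e2, Finset.smul_sum]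
      refine Finset.sum_congr rfl fun i _ => ?_
      rw [smul_comm, e4, Finset.smul_sum]
      exact Finset.sum_congr rfl fun j _ => smul_comm _ _ _
    · ext x
      have hx : anchor I F E x (r.1 x) = 0 := congrArg (fun w : Vec I M => w x) hr0
      have hB' : ∀ i j, anchor I F E x ((B i j).1 x) = 0 := fun i j =>
        congrArg (fun w : Vec I M => w x) (hB0 i j)
      simp [derSymbol, derSmul, hx, hB']
  have hfin := congrArg T hdec
  have hc0 : ∀ i j, c j (derAct r (s i)) m = 0 := fun i j => h5 j _ (by
    show (r.1 m).1.1 (s i) = 0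
    rw [hrm]; rfl)
  simpa [hT, h1, hc0] using hfin

theorem tensorial_derSec_eq {m : M} (T : DerSec I F E →ₗ[ℝ] E m)
    (hT : ∀ f d, T (derSmul f d) = f m • T d) {d r : DerSec I F E} (h : d.1 m = r.1 m) :
    T d = T r := by
  have h0 : (d - r).1 m = 0 := by
    show d.1 m - r.1 m = 0
    rw [h, sub_self]
  exact sub_eq_zero.1 ((T.map_sub d r).symm.trans (tensorial_derSec T hT (d - r) h0))

/-- The fibrewise map induced by an operation on `Γ(𝔇E)` which is `C^∞`-linear at `m`: the value at
`δ ∈ (𝔇E)_m` is `T d` for any section `d` through `δ` (see `fiberwise_apply`). -/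
def fiberwise {m : M} (T : DerSec I F E →ₗ[ℝ] E m) (hT : ∀ f d, T (derSmul f d) = f m • T d) :
    DerFiber I F E m →ₗ[ℝ] E m where
  toFun δ := T (exists_derSec_eq δ).choose
  map_add' δ ε := by
    rw [← T.map_add]
    refine tensorial_derSec_eq T hT ((exists_derSec_eq (δ + ε)).choose_spec.trans ?_)
    exact (congrArg₂ (· + ·) (exists_derSec_eq δ).choose_spec
      (exists_derSec_eq ε).choose_spec).symm
  map_smul' c δ := by
    rw [RingHom.id_apply, ← T.map_smul]
    refine tensorial_derSec_eq T hT ((exists_derSec_eq (c • δ)).choose_spec.trans ?_)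
    exact (congrArg (c • ·) (exists_derSec_eq δ).choose_spec).symm

theorem fiberwise_apply {m : M} (T : DerSec I F E →ₗ[ℝ] E m)
    (hT : ∀ f d, T (derSmul f d) = f m • T d) (d : DerSec I F E) :
    fiberwise T hT (d.1 m) = T d :=
  tensorial_derSec_eq T hT (exists_derSec_eq (d.1 m)).choose_spec

/-- The `E`-valued pairing of sections of `𝔍E` and `𝔇E`. -/
def jetPair (μ : JetSec I F E) (d : DerSec I F E) : Cₛ^∞⟮I; F, E⟯ :=
  ⟨fun m => (μ.1 m).1 (d.1 m), μ.2 d.1 d.2⟩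

theorem derLie_smul (f : C^∞⟮I, M; ℝ⟯) (d r : DerSec I F E) :
    derLie d (derSmul f r) = derSmul f (derLie d r) + derSmul ((derSymbol d).deriv f) r := by
  apply derSec_ext
  · intro u
    have h : ∀ v, derAct (derSmul f r) v = f • derAct r v := fun v => rfl
    rw [derAct_derLie, h, h, derAct_smul]
    ext m
    show f m • derAct d (derAct r u) m + (derSymbol d).deriv f m • derAct r u m -
      f m • derAct r (derAct d u) m = f m • (derAct d (derAct r u) m - derAct r (derAct d u) m) +
      (derSymbol d).deriv f m • derAct r u m
    module
  · have h : derSymbol (derSmul f r) = f • derSymbol r := by ext m; rfl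
    rw [derSymbol_derLie, h, Vec.lie_smul, add_comm]
    ext m; rfl

theorem derLie_add (d r r' : DerSec I F E) : derLie d (r + r') = derLie d r + derLie d r' := by
  apply derSec_ext
  · intro u
    have h : ∀ (a b : DerSec I F E) v, derAct (a + b) v = derAct a v + derAct b v :=
      fun a b v => rfl
    rw [h, derAct_derLie, derAct_derLie, derAct_derLie, h, h, derAct_add]
    abel
  · exact Vec.lie_add (derSymbol d) (derSymbol r) (derSymbol r')

theorem derLie_const_smul (c : ℝ) (d r : DerSec I F E) :
    derLie d (c • r) = c • derLie d r := by
  apply derSec_ext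
  · intro u
    have h : ∀ (a : DerSec I F E) v, derAct (c • a) v = c • derAct a v := fun a v => rfl
    rw [h, derAct_derLie, derAct_derLie, h, h, derAct_const_smul, smul_sub]
  · ext m
    exact VectorField.mlieBracket_const_smul_right (derSymbol r).mdifferentiableAt

variable (I F E) in
/-- The identity `1_E`, as a section of `gl(E) ⊆ 𝔇E`. -/
def derId : DerSec I F E :=
  ⟨fun m => glEmb I F E m LinearMap.id, fun u => u.contMDiff, (0 : Vec I M).contMDiff⟩

theorem jetPair_of_symbol (μ : JetSec I F E) (r : DerSec I F E) (hr : derSymbol r = 0) :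
    jetPair μ r = derAct r (jetPair μ (derId I F E)) := by
  ext x
  obtain ⟨Φ, hΦ⟩ := exists_glEmb_eq (r.1 x) (congrArg (fun w : Vec I M => w x) hr)
  show (μ.1 x).1 (r.1 x) = (r.1 x).1.1 (jetPair μ (derId I F E))
  rw [← hΦ, (μ.1 x).2 Φ]
  rfl

/-- The operation `𝔯 ↦ (𝔡⟨μ, 𝔯⟩ - ⟨μ, [𝔡, 𝔯]⟩)(m)`. -/
def lieDerivAux (d : DerSec I F E) (μ : JetSec I F E) (m : M) : DerSec I F E →ₗ[ℝ] E m where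
  toFun r := derAct d (jetPair μ r) m - jetPair μ (derLie d r) m
  map_add' r r' := by
    have h1 : ∀ a b, jetPair μ (a + b) = jetPair μ a + jetPair μ b := fun a b => by
      ext x; exact map_add (μ.1 x).1 (a.1 x) (b.1 x)
    rw [derLie_add, h1, h1, derAct_add]
    simp only [ContMDiffSection.coe_add, Pi.add_apply]
    abel
  map_smul' c r := by
    have h1 : ∀ a, jetPair μ (c • a) = c • jetPair μ a := fun a => by
      ext x; exact map_smul (μ.1 x).1 c (a.1 x)
    rw [derLie_const_smul, h1, h1, derAct_const_smul]
    simp only [ContMDiffSection.coe_smul, Pi.smul_apply, RingHom.id_apply, smul_sub]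

theorem jetPair_derSmul (μ : JetSec I F E) (f : C^∞⟮I, M; ℝ⟯) (r : DerSec I F E) :
    jetPair μ (derSmul f r) = f • jetPair μ r := by
  ext x; exact map_smul (μ.1 x).1 (f x) (r.1 x)

theorem lieDerivAux_smul (d : DerSec I F E) (μ : JetSec I F E) (m : M) (f : C^∞⟮I, M; ℝ⟯)
    (r : DerSec I F E) :
    lieDerivAux d μ m (derSmul f r) = f m • lieDerivAux d μ m r := by
  have h1 : jetPair μ (derLie d (derSmul f r)) m = f m • jetPair μ (derLie d r) m +
      (derSymbol d).deriv f m • jetPair μ r m := by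
    rw [derLie_smul]
    refine (map_add (μ.1 m).1 _ _).trans ?_
    exact congrArg₂ (· + ·) (map_smul (μ.1 m).1 (f m) _) (map_smul (μ.1 m).1 _ _)
  show derAct d (jetPair μ (derSmul f r)) m - jetPair μ (derLie d (derSmul f r)) m = f m •
    (derAct d (jetPair μ r) m - jetPair μ (derLie d r) m)
  rw [h1, jetPair_derSmul, derAct_smul]
  simp only [ContMDiffSection.coe_add, Pi.add_apply, smul_sec_apply]
  module

/-- The Lie derivative `𝔏_𝔡 μ ∈ Γ(𝔍E)`, given by
`⟨𝔏_𝔡 μ, 𝔯⟩ = 𝔡⟨μ, 𝔯⟩ - ⟨μ, [𝔡, 𝔯]⟩` for all `𝔯 ∈ Γ(𝔇E)` (see `jetPair_lieDeriv`). -/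
def lieDeriv (d : DerSec I F E) (μ : JetSec I F E) : JetSec I F E :=
  ⟨fun m => ⟨fiberwise (lieDerivAux d μ m) (lieDerivAux_smul d μ m), by
    intro Φ
    obtain ⟨r, hr, hr0⟩ := exists_gl_sec (I := I) (F := F) Φ
    have e1 := fiberwise_apply _ (lieDerivAux_smul d μ m) r
    have e2 := fiberwise_apply _ (lieDerivAux_smul d μ m) (derId I F E)
    have e3 : derSymbol (derLie d r) = 0 := by
      rw [derSymbol_derLie, hr0]
      ext x
      exact congrFun VectorField.mlieBracket_zero_right x
    have e4 : derLie d (derId I F E) = 0 := by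
      apply derSec_ext
      · intro u
        exact sub_self (derAct d u)
      · ext x
        exact congrFun VectorField.mlieBracket_zero_right x
    have e5 : lieDerivAux d μ m (derId I F E) = derAct d (jetPair μ (derId I F E)) m := by
      show derAct d (jetPair μ (derId I F E)) m - (μ.1 m).1 ((derLie d (derId I F E)).1 m) = _
      rw [e4]
      refine (congrArg _ (map_zero (μ.1 m).1)).trans (sub_zero _)
    have e6 : lieDerivAux d μ m r = derAct r (derAct d (jetPair μ (derId I F E))) m := by
      show derAct d (jetPair μ r) m - jetPair μ (derLie d r) m = _
      rw [jetPair_of_symbol μ _ e3, jetPair_of_symbol μ r hr0, derAct_derLie]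
      exact sub_sub_cancel _ _
    rw [← hr, e1, e6]
    refine Eq.trans ?_ (congrArg Φ (e2.trans e5)).symm
    show (r.1 m).1.1 _ = _
    rw [hr]
    rfl⟩, by
    intro r hr
    have : (fun m => fiberwise (lieDerivAux d μ m) (lieDerivAux_smul d μ m) (r m)) =
        fun m => (derAct d (jetPair μ ⟨r, hr⟩) - jetPair μ (derLie d ⟨r, hr⟩)) m := by
      funext m
      exact fiberwise_apply (lieDerivAux d μ m) (lieDerivAux_smul d μ m) ⟨r, hr⟩
    show IsSmoothSection I F (V := E) fun m =>
      fiberwise (lieDerivAux d μ m) (lieDerivAux_smul d μ m) (r m)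
    rw [this]
    exact ContMDiffSection.contMDiff _⟩

theorem jetPair_lieDeriv (d r : DerSec I F E) (μ : JetSec I F E) :
    jetPair (lieDeriv d μ) r = derAct d (jetPair μ r) - jetPair μ (derLie d r) := by
  ext m
  exact fiberwise_apply (lieDerivAux d μ m) (lieDerivAux_smul d μ m) r

/-- The section `𝕕u : m ↦ [u]_m` of the jet bundle, `⟨𝕕u, 𝔡⟩ = 𝔡 u`. -/
def jetD (u : Cₛ^∞⟮I; F, E⟯) : JetSec I F E :=
  ⟨fun m => ⟨LinearMap.applyₗ u ∘ₗ LinearMap.fst ℝ _ _ ∘ₗ (derSubmodule I F E m).subtype,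
    fun _ => rfl⟩, fun _ hd => hd.1 u⟩

end Gauge

section Omni

variable {EM : Type*} [NormedAddCommGroup EM] [NormedSpace ℝ EM] [FiniteDimensional ℝ EM]
  {H : Type*} [TopologicalSpace H] (I : ModelWithCorners ℝ EM H)
  {M : Type*} [TopologicalSpace M] [ChartedSpace H M] [T2Space M] [IsManifold I ∞ M]
  (F : Type*) [NormedAddCommGroup F] [NormedSpace ℝ F] [FiniteDimensional ℝ F]
  (E : M → Type*) [TopologicalSpace (TotalSpace F E)]
  [∀ m, AddCommGroup (E m)] [∀ m, Module ℝ (E m)] [∀ m, TopologicalSpace (E m)]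
  [FiberBundle F E] [VectorBundle ℝ F E] [ContMDiffVectorBundle ∞ F E I]

/-- The fibre of `𝓔 = 𝔇E ⊕ 𝔍E`. -/
abbrev OmniFiber (m : M) := DerFiber I F E m × JetFiber I F E m

/-- The fibre of `𝓣 = TM ⊕ E`. -/
abbrev TFiber (m : M) := TangentSpace I m × E m

/-- The space `Γ(𝓔)`. -/
def omniSections : Submodule ℝ (Π m, OmniFiber I F E m) where
  carrier := {X | (fun m => (X m).1) ∈ derSections I F E ∧ (fun m => (X m).2) ∈ jetSections I F E}
  zero_mem' := ⟨(derSections I F E).zero_mem, (jetSections I F E).zero_mem⟩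
  add_mem' := fun ha hb =>
    ⟨(derSections I F E).add_mem ha.1 hb.1, (jetSections I F E).add_mem ha.2 hb.2⟩
  smul_mem' := fun c _ ha =>
    ⟨(derSections I F E).smul_mem c ha.1, (jetSections I F E).smul_mem c ha.2⟩


/-- The space `Γ(𝓔)`, as a type. -/
abbrev OmniSec := ↥(omniSections I F E)

/-- The space `Γ(𝓣)`. -/
def tSections : Submodule ℝ (Π m, TFiber I E m) where
  carrier := {t | IsSmoothSection I EM (V := (TangentSpace I : M → Type _)) (fun m => (t m).1) ∧
    IsSmoothSection I F (V := E) fun m => (t m).2}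
  zero_mem' := ⟨(0 : Vec I M).contMDiff, (0 : Cₛ^∞⟮I; F, E⟯).contMDiff⟩
  add_mem' := fun ha hb => ⟨ha.1.add_section hb.1, ha.2.add_section hb.2⟩
  smul_mem' := fun _ _ ha => ⟨ha.1.const_smul_section, ha.2.const_smul_section⟩


/-- The space `Γ(𝓣)`, as a type. -/
abbrev TSec := ↥(tSections I F E)

/-- The symmetric `E`-valued pairing `(𝔡 + μ, 𝔯 + ν)₊ = ½ (⟨𝔡, ν⟩ + ⟨𝔯, μ⟩)` on `𝓔_m`. -/
def omniPairing (m : M) (X Y : OmniFiber I F E m) : E m :=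
  (1 / 2 : ℝ) • (Y.2.1 X.1 + X.2.1 Y.1)

/-- The projection `𝕓 : 𝓔_m → 𝓣_m`, `𝔡 + μ ↦ α(𝔡) + 𝕡(μ)`. -/
def bMap (m : M) : OmniFiber I F E m →ₗ[ℝ] TFiber I E m :=
  (anchor I F E m).prodMap (jetProj I F E m)

/-- The embedding `𝕒 : Hom(𝓣_m, E_m) → 𝓔_m`, `Φ + y ↦ 𝕚(Φ) + 𝕖(y)`, where `Φ` and `y` are the
restrictions to `E_m` and `T_mM`. -/
def aMap (m : M) : (TFiber I E m →ₗ[ℝ] E m) →ₗ[ℝ] OmniFiber I F E m where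
  toFun h := (glEmb I F E m (h ∘ₗ LinearMap.inr ℝ _ _), homEmb I F E m (h ∘ₗ LinearMap.inl ℝ _ _))
  map_add' h k := by rw [LinearMap.add_comp, LinearMap.add_comp, map_add, map_add]; rfl
  map_smul' r h := by rw [LinearMap.smul_comp, LinearMap.smul_comp, map_smul, map_smul]; rfl

variable {E} in
/-- The space `Q⁰ = {h ∈ Hom(𝓣_m, E_m) | h(Q) = 0}`. -/
def annihilator {m : M} (Q : Submodule ℝ (TFiber I E m)) : Submodule ℝ (TFiber I E m →ₗ[ℝ] E m) where
  carrier := {h | ∀ t ∈ Q, h t = 0}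
  zero_mem' := fun _ _ => rfl
  add_mem' := fun ha hb t ht => by rw [LinearMap.add_apply, ha t ht, hb t ht, add_zero]
  smul_mem' := fun r _ ha t ht => by rw [LinearMap.smul_apply, ha t ht, smul_zero]

/-- A subspace of `𝓔_m` is isotropic if the pairing vanishes on it. -/
def IsIsotropic (m : M) (W : Submodule ℝ (OmniFiber I F E m)) : Prop :=
  ∀ X ∈ W, ∀ Y ∈ W, omniPairing I F E m X Y = 0

variable {I F E}

/-- The component in `Γ(𝔇E)`. -/
def omniDer (X : OmniSec I F E) : DerSec I F E := ⟨fun m => (X.1 m).1, X.2.1⟩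

/-- The component in `Γ(𝔍E)`. -/
def omniJet (X : OmniSec I F E) : JetSec I F E := ⟨fun m => (X.1 m).2, X.2.2⟩

/-- The sum `𝔡 + μ ∈ Γ(𝓔)`. -/
def omniMk (d : DerSec I F E) (μ : JetSec I F E) : OmniSec I F E :=
  ⟨fun m => (d.1 m, μ.1 m), d.2, μ.2⟩

/-- The bracket of the omni-Lie algebroid:
`{𝔡 + μ, 𝔯 + ν} = [𝔡, 𝔯]_𝔇 + 𝔏_𝔡 ν - 𝔏_𝔯 μ + 𝕕⟨μ, 𝔯⟩`. -/
def dorfman (X Y : OmniSec I F E) : OmniSec I F E :=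
  omniMk (derLie (omniDer X) (omniDer Y))
    (lieDeriv (omniDer X) (omniJet Y) - lieDeriv (omniDer Y) (omniJet X) +
      jetD (jetPair (omniJet X) (omniDer Y)))

end Omni

section Subbundles

variable {M : Type*} {V : M → Type*} [∀ m, AddCommGroup (V m)] [∀ m, Module ℝ (V m)]

/-- The sections of a bundle `V`, with space of smooth sections `Γ`, that take values in a family
`S` of subspaces of the fibres. -/
def sectionsIn (Γ : Submodule ℝ (Π m, V m)) (S : Π m, Submodule ℝ (V m)) :
    Submodule ℝ (Π m, V m) where
  carrier := {s | s ∈ Γ ∧ ∀ m, s m ∈ S m}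
  zero_mem' := ⟨Γ.zero_mem, fun m => (S m).zero_mem⟩
  add_mem' := fun ha hb => ⟨Γ.add_mem ha.1 hb.1, fun m => (S m).add_mem (ha.2 m) (hb.2 m)⟩
  smul_mem' := fun c _ ha => ⟨Γ.smul_mem c ha.1, fun m => (S m).smul_mem c (ha.2 m)⟩

/-- A family `S` of subspaces of the fibres of a bundle `V`, with space of smooth sections `Γ`, is a
(regular, smooth) subbundle if near every point it has a smooth frame.  (By a cut-off, smooth local
sections agree near a given point with smooth global ones.) -/
def IsSubbundle [TopologicalSpace M] (Γ : Submodule ℝ (Π m, V m))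
    (S : Π m, Submodule ℝ (V m)) : Prop :=
  ∀ m₀ : M, ∃ (n : ℕ) (s : Fin n → Γ), ∀ᶠ m in nhds m₀,
    LinearIndependent ℝ (fun i => (s i).1 m) ∧ Submodule.span ℝ (Set.range fun i => (s i).1 m) = S m

end Subbundles

section LieAlgebroids

variable {EM : Type*} [NormedAddCommGroup EM] [NormedSpace ℝ EM]
  {H : Type*} [TopologicalSpace H] (I : ModelWithCorners ℝ EM H)
  {M : Type*} [TopologicalSpace M] [ChartedSpace H M]
  {V : M → Type*} [∀ m, AddCommGroup (V m)] [∀ m, Module ℝ (V m)]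

/-- A Lie algebroid structure with anchor `ρ` on a bundle over `M` whose space of smooth sections
is `Γ`. -/
@[ext]
structure LieAlgebroidStructure (Γ : Submodule ℝ (Π m, V m))
    (ρ : Π m, V m →ₗ[ℝ] TangentSpace I m) where
  /-- the bracket on sections -/
  bracket : Γ →ₗ[ℝ] Γ →ₗ[ℝ] Γ
  bracket_self : ∀ a, bracket a a = 0
  jacobi : ∀ a b c,
    bracket a (bracket b c) = bracket (bracket a b) c + bracket b (bracket a c)
  leibniz : ∀ (f : C^∞⟮I, M; ℝ⟯) (a b : Γ) (hfb : (fun m => f m • b.1 m) ∈ Γ) (m : M),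
    (bracket a ⟨fun m => f m • b.1 m, hfb⟩).1 m =
      f m • (bracket a b).1 m + mvfderiv I f m (ρ m (a.1 m)) • b.1 m
  anchor_bracket : ∀ (a b : Γ) (m : M), ρ m ((bracket a b).1 m) =
    VectorField.mlieBracket I (fun x => ρ x (a.1 x)) (fun x => ρ x (b.1 x)) m

end LieAlgebroids

section Main

variable {EM : Type*} [NormedAddCommGroup EM] [NormedSpace ℝ EM] [FiniteDimensional ℝ EM]
  {H : Type*} [TopologicalSpace H] (I : ModelWithCorners ℝ EM H)
  {M : Type*} [TopologicalSpace M] [ChartedSpace H M] [T2Space M] [IsManifold I ∞ M]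
  (F : Type*) [NormedAddCommGroup F] [NormedSpace ℝ F] [FiniteDimensional ℝ F]
  (E : M → Type*) [TopologicalSpace (TotalSpace F E)]
  [∀ m, AddCommGroup (E m)] [∀ m, Module ℝ (E m)] [∀ m, TopologicalSpace (E m)]
  [FiberBundle F E] [VectorBundle ℝ F E] [ContMDiffVectorBundle ∞ F E I]

/-- A Dirac structure in `𝓔`: a maximal isotropic subbundle whose sections are closed under the
bracket. -/
structure IsDirac (L : Π m, Submodule ℝ (OmniFiber I F E m)) : Prop where
  isSubbundle : IsSubbundle (omniSections I F E) L
  maximal : ∀ m, Maximal (IsIsotropic I F E m) (L m)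
  closed : ∀ X Y : OmniSec I F E, (∀ m, X.1 m ∈ L m) → (∀ m, Y.1 m ∈ L m) →
    ∀ m, (dorfman X Y).1 m ∈ L m

/-- A Dirac structure `L ⊆ 𝓔` such that `𝕓(L)` is a subbundle of `𝓣`. -/
@[ext]
structure ReducibleDirac where
  /-- the fibres of `L` -/
  fiber : Π m, Submodule ℝ (OmniFiber I F E m)
  isDirac : IsDirac I F E fiber
  reducible : IsSubbundle (tSections I F E) fun m => (fiber m).map (bMap I F E m)

/-- A projective Lie algebroid: a subbundle `A ⊆ 𝓣 = TM ⊕ E` with a Lie algebroid structure whose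
anchor is the projection to `TM`. -/
structure ProjectiveLieAlgebroid where
  /-- the fibres of `A` -/
  fiber : Π m, Submodule ℝ (TFiber I E m)
  isSubbundle : IsSubbundle (tSections I F E) fiber
  /-- the Lie algebroid structure on `A` -/
  lieAlgebroid : LieAlgebroidStructure I (sectionsIn (tSections I F E) fiber)
    fun m => LinearMap.fst ℝ (TangentSpace I m) (E m)

variable {I F E}

/-- The subspace `A⁰_m ⊆ Hom(𝓣_m, E_m) ⊆ 𝓔_m`. -/
def ProjectiveLieAlgebroid.ann (A : ProjectiveLieAlgebroid I F E) (m : M) :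
    Submodule ℝ (OmniFiber I F E m) :=
  (annihilator I (A.fiber m)).map (aMap I F E m)

/-- `A` is the quotient Lie algebroid of `L` by `A⁰`, through the projection `𝕓`: the bracket of
`𝓔` makes `L` a Lie algebroid with anchor `α ∘ ρ`, the sequence `0 → A⁰ → L → A → 0` is exact,
`A⁰` is an ideal of `L`, and `𝕓` maps the bracket of `L` to that of `A`. -/
structure IsQuotientLieAlgebroid (L : Π m, Submodule ℝ (OmniFiber I F E m))
    (A : ProjectiveLieAlgebroid I F E) : Prop where
  isLieAlgebroid : ∃ S : LieAlgebroidStructure I (sectionsIn (omniSections I F E) L)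
      (fun m => anchor I F E m ∘ₗ LinearMap.fst ℝ (DerFiber I F E m) (JetFiber I F E m)),
    ∀ X Y, (S.bracket X Y).1 = (dorfman ⟨X.1, X.2.1⟩ ⟨Y.1, Y.2.1⟩).1
  map_eq : ∀ m, (L m).map (bMap I F E m) = A.fiber m
  ker_eq : ∀ m, L m ⊓ LinearMap.ker (bMap I F E m) = A.ann m
  ideal : ∀ X h : OmniSec I F E, (∀ m, X.1 m ∈ L m) → (∀ m, h.1 m ∈ A.ann m) →
    ∀ m, (dorfman X h).1 m ∈ A.ann m ∧ (dorfman h X).1 m ∈ A.ann m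
  map_bracket : ∀ (X Y : OmniSec I F E) (a b : sectionsIn (tSections I F E) A.fiber),
    (∀ m, X.1 m ∈ L m) → (∀ m, Y.1 m ∈ L m) →
    (∀ m, a.1 m = bMap I F E m (X.1 m)) → (∀ m, b.1 m = bMap I F E m (Y.1 m)) →
    ∀ m, (A.lieAlgebroid.bracket a b).1 m = bMap I F E m ((dorfman X Y).1 m)

variable (I F E)

/-- A connection in `E`: a smooth bundle map `γ : TM → 𝔇E` with `α ∘ γ = 1`. -/
structure Connection where
  /-- the underlying fibrewise linear map -/
  toFun : Π m, TangentSpace I m →ₗ[ℝ] DerFiber I F E m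
  anchor_toFun : ∀ m x, anchor I F E m (toFun m x) = x
  smooth : ∀ X : Vec I M, (fun m => toFun m (X m)) ∈ derSections I F E

/-- A smooth section of `Hom(⋀²𝓣, E)`. -/
structure TwoForm where
  /-- the underlying fibrewise bilinear map -/
  toFun : Π m, TFiber I E m →ₗ[ℝ] TFiber I E m →ₗ[ℝ] E m
  alternating : ∀ m t, toFun m t t = 0
  smooth : ∀ s t : TSec I F E, IsSmoothSection I F (V := E) fun m => toFun m (s.1 m) (t.1 m)

variable {I F E}

/-- The back connection `ω : 𝔇E → gl(E)`, determined by `𝕚 ∘ ω + γ ∘ α = 1`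
(see `Connection.back_spec`). -/
def Connection.back (γ : Connection I F E) (m : M) :
    DerFiber I F E m →ₗ[ℝ] (E m →ₗ[ℝ] E m) :=
  (LinearEquiv.ofInjective (glEmb I F E m) (glEmb_injective m)).symm.toLinearMap ∘ₗ
    LinearMap.codRestrict (LinearMap.range (glEmb I F E m))
      (LinearMap.id - γ.toFun m ∘ₗ anchor I F E m)
      (fun δ => exists_glEmb_eq _ (by simp [γ.anchor_toFun]))

theorem Connection.back_spec (γ : Connection I F E) (m : M) (δ : DerFiber I F E m) :
    glEmb I F E m (γ.back m δ) + γ.toFun m (anchor I F E m δ) = δ := by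
  have h : glEmb I F E m (γ.back m δ) = δ - γ.toFun m (anchor I F E m δ) :=
    LinearEquiv.ofInjective_symm_apply (f := glEmb I F E m) (h := glEmb_injective m) _
  rw [h]; abel

theorem Connection.back_glEmb (γ : Connection I F E) (m : M) (Φ : E m →ₗ[ℝ] E m) :
    γ.back m (glEmb I F E m Φ) = Φ := by
  apply glEmb_injective (I := I) (F := F) (E := E) m
  have h := γ.back_spec m (glEmb I F E m Φ)
  have h0 : anchor I F E m (glEmb I F E m Φ) = 0 := rfl
  rwa [h0, map_zero, add_zero] at h

/-- The map `γ̃ : E → 𝔍E`, `⟨γ̃(e), 𝔡⟩ = ω(𝔡)(e)`. -/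
def Connection.tilde (γ : Connection I F E) (m : M) : E m →ₗ[ℝ] JetFiber I F E m where
  toFun e := ⟨LinearMap.applyₗ e ∘ₗ γ.back m, by
    intro Φ
    simp [γ.back_glEmb]⟩
  map_add' e e' := by apply Subtype.ext; ext δ; simp
  map_smul' r e := by apply Subtype.ext; ext δ; simp

/-- The splitting `γ + γ̃ : 𝓣 → 𝓔` of `𝕓`. -/
def Connection.split (γ : Connection I F E) (m : M) : TFiber I E m →ₗ[ℝ] OmniFiber I F E m :=
  (γ.toFun m).prodMap (γ.tilde m)

/-- The splitting `γ + γ̃`, on sections. -/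
def Connection.splitSec (γ : Connection I F E) (t : TSec I F E) : OmniSec I F E :=
  ⟨fun m => γ.split m (t.1 m), γ.smooth ⟨_, t.2.1⟩, by
    intro d hd
    let u : Cₛ^∞⟮I; F, E⟯ := ⟨_, t.2.2⟩
    let d' : DerSec I F E := ⟨d, hd⟩
    let r : DerSec I F E := ⟨_, γ.smooth (derSymbol d')⟩
    have : (fun m => (γ.split m (t.1 m)).2.1 (d m)) =
        fun m => (derAct d' u - derAct r u) m := by
      funext m
      have h := congrArg (fun δ : DerFiber I F E m => δ.1.1 u) (γ.back_spec m (d m))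
      exact eq_sub_of_add_eq h
    show IsSmoothSection I F (V := E) fun m => (γ.split m (t.1 m)).2.1 (d m)
    rw [this]
    exact (derAct d' u - derAct r u).contMDiff⟩

/-- `Ω` is the form `Ω_γ` of the projective Lie algebroid `A`, a connection `γ` and a complement
`C` of `A` in `𝓣`: `Ω_γ(a, b) = [a, b]_A - 𝕓{γ(a), γ(b)}` for sections `a`, `b` of `A`, and
`Ω_γ(c, t) = 0` for `c ∈ C`. -/
def IsOmegaForm (A : ProjectiveLieAlgebroid I F E) (γ : Connection I F E)
    (C : Π m, Submodule ℝ (TFiber I E m)) (Ω : TwoForm I F E) : Prop :=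
  (∀ (a b : sectionsIn (tSections I F E) A.fiber) (m : M),
    ((0, Ω.toFun m (a.1 m) (b.1 m)) : TFiber I E m) = (A.lieAlgebroid.bracket a b).1 m -
      bMap I F E m ((dorfman (γ.splitSec ⟨a.1, a.2.1⟩) (γ.splitSec ⟨b.1, b.2.1⟩)).1 m)) ∧
  ∀ m, ∀ c ∈ C m, ∀ t, Ω.toFun m c t = 0

/-- The fibre `γ(A)_m + Ω_γ(A)_m + A⁰_m`, that is, the set of all `γ(a) + Ω_γ(a, ·) + h` with
`a ∈ A_m` and `h ∈ A⁰_m`. -/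
def liftFiber (A : ProjectiveLieAlgebroid I F E) (γ : Connection I F E) (Ω : TwoForm I F E)
    (m : M) : Submodule ℝ (OmniFiber I F E m) :=
  (A.fiber m).map (γ.split m + aMap I F E m ∘ₗ Ω.toFun m) ⊔ A.ann m

end Main

end OmniLie

end

open Bundle
open scoped Manifold ContDiff Bundle

noncomputable section

/-! Two facts about the projection 𝕓 carry the theorem. First, its kernel is the image of 𝕒, and
2(𝕒(h), Y)₊ = h(𝕓Y) (`exists_aMap_eq`, `omniForm_aMap`). Hence a maximal isotropic subspace W of a
fibre meets ker 𝕓 exactly in 𝕓(W)⁰, and since E ≠ 0, an isotropic W that contains 𝕓(W)⁰ is maximal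
(`inf_ker_bMap_of_maximal`, `maximal_isIsotropic`). Second, for a section Z of ker 𝕓 and any Y one
has 𝕓{Z,Y} = 2(Z,Y)₊ and 𝕓{Y,Z} = 0 (`bMap_dorfman_of_ker`, `bMap_dorfman_of_ker_right`).

From L to A: the pairing vanishes on a Dirac structure L, so 𝕓{X,Y} depends only on 𝕓X and 𝕓Y. If
𝕓(L) is a subbundle, its sections lift to L (`exists_lift_bMap`), and the bracket of L descends to a
Lie algebroid bracket on A = 𝕓(L), the only one for which A is the quotient of L.

From A to L: a connection γ gives an isotropic splitting of 𝕓. The defect [a,b]_A − 𝕓{γa,γb} is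
E-valued because both anchors preserve brackets, skew because γ(𝓣) is isotropic, and C^∞-bilinear
because both brackets obey the same Leibniz rule; a projection of 𝓣 onto A extends it to a form Ω on
𝓣. Decomposing X and Y into horizontal and vertical parts yields, for sections lying over A, 𝕓{X,Y}
= [𝕓X,𝕓Y]_A + 2(X − γ𝕓X, Y)₊ − Ω(𝕓X,𝕓Y) (`bracket_sub`). The lift γ(A) + Ω(A) + A⁰ thus consists of
the X over A with 𝕓{X,Y} = [𝕓X,𝕓Y]_A for every Y over A (`forall_mem_liftFiber_iff`). The Jacobi
identities of the two brackets show that this condition is stable under { , }, so the lift is a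
Dirac structure with quotient A. The same formula puts every Dirac structure with quotient A inside
the lift, and maximality forces equality (`liftFiber_eq`). Hence L is determined by A, and the lift
does not depend on γ or on the extension of Ω. -/

namespace OmniLie

/-! ### Cut-off, gluing and dual coframes for spaces of smooth sections. -/

section Local

open Filter Topology

variable {EM : Type*} [NormedAddCommGroup EM] [NormedSpace ℝ EM]
  {H : Type*} [TopologicalSpace H] (I : ModelWithCorners ℝ EM H)
  {M : Type*} [TopologicalSpace M] [ChartedSpace H M]

section Abstract

variable {V V' : M → Type*} [∀ m, AddCommGroup (V m)] [∀ m, Module ℝ (V m)]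
  [∀ m, AddCommGroup (V' m)] [∀ m, Module ℝ (V' m)]

/-- A space of sections that is stable under multiplication by smooth functions and is determined
by a local condition. -/
structure IsLocalModule (Γ : Submodule ℝ (Π m, V m)) : Prop where
  smul_mem : ∀ (f : C^∞⟮I, M; ℝ⟯) (s : Π m, V m), s ∈ Γ → (fun m => f m • s m) ∈ Γ
  mem_of_local : ∀ s : Π m, V m, (∀ m₀, ∃ t ∈ Γ, ∀ᶠ m in 𝓝 m₀, t m = s m) → s ∈ Γ

/-- The smooth families of linear maps between two bundles, given by their spaces of smooth
sections. -/
def homSections (Γ : Submodule ℝ (Π m, V m)) (Γ' : Submodule ℝ (Π m, V' m)) :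
    Submodule ℝ (Π m, V m →ₗ[ℝ] V' m) where
  carrier := {φ | ∀ s ∈ Γ, (fun m => φ m (s m)) ∈ Γ'}
  zero_mem' := fun _ _ => Γ'.zero_mem
  add_mem' := fun ha hb s hs => Γ'.add_mem (ha s hs) (hb s hs)
  smul_mem' := fun c _ ha s hs => Γ'.smul_mem c (ha s hs)

variable (M) in
/-- The smooth functions, as a space of sections. -/
def smoothFunctions : Submodule ℝ (M → ℝ) where
  carrier := {f | ContMDiff I 𝓘(ℝ) ∞ f}
  zero_mem' := contMDiff_const
  add_mem' := fun ha hb => ha.add hb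
  smul_mem' := fun _ _ ha => contMDiff_const.mul ha

variable {I}

theorem isLocalModule_smoothFunctions : IsLocalModule I (V := fun _ => ℝ) (smoothFunctions I M) where
  smul_mem f _ hs := f.contMDiff.mul hs
  mem_of_local s h m₀ := by
    obtain ⟨t, ht, hts⟩ := h m₀
    exact (ht m₀).congr_of_eventuallyEq (hts.mono fun _ h => h.symm)

variable {Γ : Submodule ℝ (Π m, V m)} {Γ' : Submodule ℝ (Π m, V' m)}

theorem IsLocalModule.homSections (hΓ' : IsLocalModule I Γ') :
    IsLocalModule I (homSections Γ Γ') where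
  smul_mem f _ hφ s hs := hΓ'.smul_mem f _ (hφ s hs)
  mem_of_local φ h s hs := hΓ'.mem_of_local _ fun m₀ => by
    obtain ⟨t, ht, hts⟩ := h m₀
    exact ⟨_, ht s hs, hts.mono fun m hm => by rw [hm]⟩

theorem IsLocalModule.sectionsIn (hΓ : IsLocalModule I Γ) (S : Π m, Submodule ℝ (V m)) :
    IsLocalModule I (sectionsIn Γ S) where
  smul_mem f s hs := ⟨hΓ.smul_mem f s hs.1, fun m => (S m).smul_mem _ (hs.2 m)⟩
  mem_of_local s h := ⟨hΓ.mem_of_local s fun m₀ => by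
      obtain ⟨t, ht, hts⟩ := h m₀
      exact ⟨t, ht.1, hts⟩, fun m => by
      obtain ⟨t, ht, hts⟩ := h m
      rw [← hts.self_of_nhds]
      exact ht.2 m⟩

variable [FiniteDimensional ℝ EM] [T2Space M] [IsManifold I ∞ M]

variable (I) in
theorem exists_bump {m₀ : M} {U : Set M} (hU : U ∈ 𝓝 m₀) :
    ∃ ψ : C^∞⟮I, M; ℝ⟯, (∀ᶠ m in 𝓝 m₀, ψ m = 1) ∧ tsupport ψ ⊆ U := by
  obtain ⟨χ, -, hχ⟩ := (SmoothBumpFunction.nhds_basis_tsupport (I := I) m₀).mem_iff.1 hU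
  exact ⟨⟨χ, χ.contMDiff⟩, χ.eventuallyEq_one, hχ⟩

/-- A smooth section that takes values in `S` near a point agrees near this point with a section
taking values in `S` everywhere. -/
theorem IsLocalModule.exists_sectionsIn (hΓ : IsLocalModule I Γ) {S : Π m, Submodule ℝ (V m)}
    {s : Π m, V m} (hs : s ∈ Γ) {m₀ : M} (h : ∀ᶠ m in 𝓝 m₀, s m ∈ S m) :
    ∃ t : OmniLie.sectionsIn Γ S, ∀ᶠ m in 𝓝 m₀, t.1 m = s m := by
  obtain ⟨ψ, h1, h2⟩ := exists_bump I h
  refine ⟨⟨fun m => ψ m • s m, hΓ.smul_mem ψ s hs, fun m => ?_⟩, h1.mono fun m hm => by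
    simp [hm]⟩
  by_cases hm : ψ m = 0
  · simp [hm]
  · exact (S m).smul_mem _ (h2 (subset_closure hm))

/-- Local solutions are averaged with a partition of unity; convexity of the fibrewise condition
keeps the average a solution. Lifts to L, connections and projections onto A are all made global in
this way. -/
theorem IsLocalModule.glue [SigmaCompactSpace M] (hΓ : IsLocalModule I Γ) (S : Π m, Set (V m))
    (hS : ∀ m, Convex ℝ (S m)) (h : ∀ m₀, ∃ t ∈ Γ, ∀ᶠ m in 𝓝 m₀, t m ∈ S m) :
    ∃ t ∈ Γ, ∀ m, t m ∈ S m := by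
  choose t ht htS using h
  let U (x : M) : Set M := interior {m | t x m ∈ S m}
  obtain ⟨ρ, hρU⟩ : ∃ ρ : SmoothPartitionOfUnity M I M Set.univ, ρ.IsSubordinate U :=
    SmoothPartitionOfUnity.exists_isSubordinate
      I isClosed_univ U (fun x ↦ isOpen_interior) fun x _ =>
        Set.mem_iUnion.2 ⟨x, mem_interior_iff_mem_nhds.mpr (htS x)⟩
  refine ⟨fun m => ∑ᶠ x, ρ x m • t x m, hΓ.mem_of_local _ fun m₀ => ?_, fun m => ?_⟩
  · refine ⟨∑ x ∈ ρ.fintsupport m₀, fun m => ρ x m • t x m,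
      Γ.sum_mem fun x _ => hΓ.smul_mem (ρ x) _ (ht x), ?_⟩
    filter_upwards [ρ.eventually_finsupport_subset m₀] with m hm
    rw [Finset.sum_apply]
    refine (finsum_eq_sum_of_support_subset _ fun x hx => hm ?_).symm
    rw [SmoothPartitionOfUnity.mem_finsupport]
    exact left_ne_zero_of_smul hx
  · refine (hS m).finsum_mem (ρ.nonneg · m) (ρ.sum_eq_one (Set.mem_univ m)) fun x hx => ?_
    exact interior_subset (s := {m | t x m ∈ S m}) (hρU x (subset_closure hx))

/-- The inverse is multiplied by a bump function supported where f does not vanish, so it is a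
smooth function on all of M. -/
theorem exists_smooth_inv {f : C^∞⟮I, M; ℝ⟯} {m₀ : M} (h : f m₀ ≠ 0) :
    ∃ g : C^∞⟮I, M; ℝ⟯, ∀ᶠ m in 𝓝 m₀, g m * f m = 1 := by
  have hU : {m | f m ≠ 0} ∈ 𝓝 m₀ := f.contMDiff.continuous.continuousAt.eventually_ne h
  obtain ⟨ψ, h1, h2⟩ := exists_bump I hU
  refine ⟨⟨fun m => ψ m * (f m)⁻¹, contMDiff_of_tsupport fun x hx => ?_⟩, ?_⟩
  · have hx : x ∈ tsupport ψ := closure_mono (fun y hy => left_ne_zero_of_mul hy) hx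
    exact (ψ.contMDiff x).mul ((f.contMDiff x).inv₀ (h2 hx))
  · filter_upwards [h1, hU] with m hm hm'
    show ψ m * (f m)⁻¹ * f m = 1
    rw [hm, one_mul, inv_mul_cancel₀ hm']

/-- Smooth sections that are independent at a point have a smooth dual coframe near this point,
provided every covector is the value of a smooth one. -/
theorem exists_dual_coframe
    (hcov : ∀ (m₀ : M) (l : V m₀ →ₗ[ℝ] ℝ), ∃ θ ∈ homSections Γ (smoothFunctions I M), θ m₀ = l)
    {ι : Type*} [Fintype ι] [DecidableEq ι] {t : ι → Π m, V m} (ht : ∀ i, t i ∈ Γ) {m₀ : M}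
    (hli : LinearIndependent ℝ fun i => t i m₀) :
    ∃ θ : ι → Π m, V m →ₗ[ℝ] ℝ, (∀ i, θ i ∈ homSections Γ (smoothFunctions I M)) ∧
      ∀ᶠ m in 𝓝 m₀, ∀ i j, θ i m (t j m) = if i = j then 1 else 0 := by
  -- Dual functionals at the single point m₀: coordinates on the span of the t j, extended linearly
  -- to the whole fibre.
  have hl : ∀ i, ∃ l : V m₀ →ₗ[ℝ] ℝ, ∀ j, l (t j m₀) = if j = i then 1 else 0 := by
    intro i
    obtain ⟨l, hl⟩ := LinearMap.exists_extend ((Finsupp.lapply (R := ℝ) i) ∘ₗ hli.repr)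
    refine ⟨l, fun j => ?_⟩
    have := LinearMap.congr_fun hl ⟨t j m₀, Submodule.subset_span ⟨j, rfl⟩⟩
    refine this.trans ?_
    have h2 := hli.repr_eq_single j ⟨t j m₀, Submodule.subset_span ⟨j, rfl⟩⟩ rfl
    show hli.repr _ i = _
    rw [h2, Finsupp.single_apply]
  choose l hl using hl
  choose θ hθ hθl using fun i => hcov m₀ (l i)
  -- The pairing matrix is taken over the ring of smooth functions. It is the identity at m₀, so its
  -- determinant is invertible nearby.
  let G : Matrix ι ι C^∞⟮I, M; ℝ⟯ := fun i j => ⟨fun m => θ i m (t j m), hθ i _ (ht j)⟩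
  let ev (m : M) : C^∞⟮I, M; ℝ⟯ →+* ℝ :=
    { toFun := fun f => f m, map_one' := rfl, map_mul' := fun _ _ => rfl, map_zero' := rfl,
      map_add' := fun _ _ => rfl }
  have hdet : G.det m₀ ≠ 0 := by
    have h1 : G.det m₀ = ((ev m₀).mapMatrix G).det := RingHom.map_det (ev m₀) G
    have h2 : (ev m₀).mapMatrix G = 1 := by
      ext i j
      show θ i m₀ (t j m₀) = _
      rw [hθl, hl, Matrix.one_apply]
      simp only [eq_comm]
    rw [h1, h2, Matrix.det_one]
    exact one_ne_zero
  obtain ⟨g, hg⟩ := exists_smooth_inv hdet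
  -- The corrected coframe is G⁻¹θ, with G⁻¹ written as adjugate over determinant; the cut-off
  -- inverse g keeps it globally smooth.
  refine ⟨fun i => fun m => g m • ∑ k, G.adjugate i k m • θ k m, fun i => ?_, ?_⟩
  · refine isLocalModule_smoothFunctions.homSections.smul_mem g _ ?_
    have := (homSections Γ (V' := fun _ => ℝ) (smoothFunctions I M)).sum_mem
      (t := Finset.univ) (f := fun k => fun m => G.adjugate i k m • θ k m)
      fun k _ => isLocalModule_smoothFunctions.homSections.smul_mem (G.adjugate i k) _ (hθ k)
    convert this using 1
    ext m : 1
    rw [Finset.sum_apply]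
  · filter_upwards [hg] with m hm i j
    have key : ∀ i j, ∑ k, G.adjugate i k m * θ k m (t j m) = if i = j then G.det m else 0 := by
      intro i j
      have h1 : ev m ((G.adjugate * G) i j) = ev m ((G.det • (1 : Matrix ι ι C^∞⟮I, M; ℝ⟯)) i j) := by
        rw [Matrix.adjugate_mul]
      rw [Matrix.mul_apply, map_sum, Matrix.smul_apply, Matrix.one_apply] at h1
      refine h1.trans ?_
      split_ifs
      · rw [smul_eq_mul, mul_one]; rfl
      · rw [smul_zero]; rfl
    show (g m • ∑ k, G.adjugate i k m • θ k m) (t j m) = _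
    rw [LinearMap.smul_apply, LinearMap.sum_apply]
    simp only [LinearMap.smul_apply, smul_eq_mul]
    rw [key]
    split_ifs
    · exact hm
    · exact mul_zero _

end Abstract

end Local

/-! ### Sections of 𝔇E, 𝔍E, 𝓔, 𝓣 and E as local modules; frames of 𝓣. -/

section Modules

open Filter Topology

variable {EM : Type*} [NormedAddCommGroup EM] [NormedSpace ℝ EM] [FiniteDimensional ℝ EM]
  {H : Type*} [TopologicalSpace H] {I : ModelWithCorners ℝ EM H}
  {M : Type*} [TopologicalSpace M] [ChartedSpace H M] [T2Space M] [IsManifold I ∞ M]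
  {F : Type*} [NormedAddCommGroup F] [NormedSpace ℝ F] [FiniteDimensional ℝ F]
  {E : M → Type*} [TopologicalSpace (TotalSpace F E)]
  [∀ m, AddCommGroup (E m)] [∀ m, Module ℝ (E m)] [∀ m, TopologicalSpace (E m)]
  [FiberBundle F E] [VectorBundle ℝ F E] [ContMDiffVectorBundle ∞ F E I]

section

variable {F' : Type*} [NormedAddCommGroup F'] [NormedSpace ℝ F']
  {V : M → Type*} [TopologicalSpace (TotalSpace F' V)]
  [∀ m, AddCommGroup (V m)] [∀ m, Module ℝ (V m)] [∀ m, TopologicalSpace (V m)]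
  [FiberBundle F' V]

theorem IsSmoothSection.of_local {s : Π m, V m}
    (h : ∀ m₀, ∃ t : Π m, V m, IsSmoothSection I F' t ∧ ∀ᶠ m in 𝓝 m₀, t m = s m) :
    IsSmoothSection I F' s := by
  intro m₀
  obtain ⟨t, ht, hts⟩ := h m₀
  exact (ht m₀).congr_of_eventuallyEq (hts.mono fun m hm => by simp only [hm])

end

theorem isLocalModule_derSections : IsLocalModule I (derSections I F E) where
  smul_mem f s hs := (derSmul f ⟨s, hs⟩).2
  mem_of_local s h := by
    refine ⟨fun u => IsSmoothSection.of_local fun m₀ => ?_, IsSmoothSection.of_local fun m₀ => ?_⟩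
    all_goals obtain ⟨t, ht, hts⟩ := h m₀
    · exact ⟨_, ht.1 u, hts.mono fun m hm => by rw [hm]⟩
    · exact ⟨_, ht.2, hts.mono fun m hm => by rw [hm]⟩

theorem isLocalModule_jetSections : IsLocalModule I (jetSections I F E) where
  smul_mem f _ hs d hd := f.contMDiff.smul_section (hs d hd)
  mem_of_local s h d hd := by
    refine IsSmoothSection.of_local fun m₀ => ?_
    obtain ⟨t, ht, hts⟩ := h m₀
    exact ⟨_, ht d hd, hts.mono fun m hm => by rw [hm]⟩

theorem isLocalModule_omniSections : IsLocalModule I (omniSections I F E) where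
  smul_mem f _ hs := ⟨isLocalModule_derSections.smul_mem f _ hs.1,
    isLocalModule_jetSections.smul_mem f _ hs.2⟩
  mem_of_local s h := by
    refine ⟨isLocalModule_derSections.mem_of_local _ fun m₀ => ?_,
      isLocalModule_jetSections.mem_of_local _ fun m₀ => ?_⟩
    all_goals obtain ⟨t, ht, hts⟩ := h m₀
    · exact ⟨_, ht.1, hts.mono fun m hm => by rw [hm]⟩
    · exact ⟨_, ht.2, hts.mono fun m hm => by rw [hm]⟩

theorem isLocalModule_tSections : IsLocalModule I (tSections I F E) where
  smul_mem f _ hs := ⟨f.contMDiff.smul_section hs.1, f.contMDiff.smul_section hs.2⟩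
  mem_of_local s h := by
    refine ⟨IsSmoothSection.of_local fun m₀ => ?_, IsSmoothSection.of_local fun m₀ => ?_⟩
    all_goals obtain ⟨t, ht, hts⟩ := h m₀
    · exact ⟨_, ht.1, hts.mono fun m hm => by rw [hm]⟩
    · exact ⟨_, ht.2, hts.mono fun m hm => by rw [hm]⟩

variable (I F E)

/-- The smooth sections of a vector bundle, as a subspace of all its sections. -/
def secSubmodule : Submodule ℝ (Π m, E m) where
  carrier := {s | IsSmoothSection I F s}
  zero_mem' := (0 : Cₛ^∞⟮I; F, E⟯).contMDiff
  add_mem' := fun ha hb => ha.add_section hb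
  smul_mem' := fun _ _ ha => ha.const_smul_section

variable {I F E}

theorem isLocalModule_secSubmodule : IsLocalModule I (secSubmodule I F E) where
  smul_mem f _ hs := f.contMDiff.smul_section hs
  mem_of_local _ h := IsSmoothSection.of_local h

theorem exists_sec_covector (m₀ : M) (l : E m₀ →ₗ[ℝ] ℝ) :
    ∃ θ ∈ homSections (secSubmodule I F E) (smoothFunctions I M), θ m₀ = l := by
  obtain ⟨n, s, c, ψ, h1, h2, h3⟩ := exists_cutoff_frame (I := I) (F := F) (V := E) m₀
  -- The coefficients l(s i m₀) are constants; only the cut-off coordinates c i vary with m.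
  refine ⟨∑ i, fun m => l (s i m₀) • c i m, Submodule.sum_mem _ fun i _ u hu => ?_, ?_⟩
  · exact contMDiff_const.mul (h2 i ⟨u, hu⟩)
  · ext v
    have := congrArg l (h3 m₀ v)
    rw [h1, one_smul, map_sum] at this
    rw [this, Finset.sum_apply, LinearMap.sum_apply]
    refine Finset.sum_congr rfl fun i _ => ?_
    rw [map_smul, LinearMap.smul_apply, smul_eq_mul, smul_eq_mul, mul_comm]

theorem exists_covector (m₀ : M) (l : TFiber I E m₀ →ₗ[ℝ] ℝ) :
    ∃ θ ∈ homSections (tSections I F E) (smoothFunctions I M), θ m₀ = l := by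
  obtain ⟨θ₁, h1, h1'⟩ := exists_sec_covector (I := I) (F := EM)
    (E := (TangentSpace I : M → Type _)) m₀ (l ∘ₗ LinearMap.inl ℝ _ _)
  obtain ⟨θ₂, h2, h2'⟩ := exists_sec_covector (I := I) (F := F) (E := E) m₀
    (l ∘ₗ LinearMap.inr ℝ _ _)
  refine ⟨fun m => (θ₁ m).coprod (θ₂ m), fun s hs => (h1 _ hs.1).add (h2 _ hs.2), ?_⟩
  show (θ₁ m₀).coprod (θ₂ m₀) = l
  rw [h1', h2']
  exact LinearMap.coprod_comp_inl_inr l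

variable (I F E)

/-- The linear isomorphism of a fibre with the model fibre. -/
def fiberEquiv (m : M) : E m ≃ₗ[ℝ] F :=
  (trivializationAt F E m).linearEquivAt ℝ m (FiberBundle.mem_baseSet_trivializationAt F E m)

variable {F E} in
theorem finiteDimensional_TFiber {m : M} (e : E m ≃ₗ[ℝ] F) :
    FiniteDimensional ℝ (TFiber I E m) := by
  have : FiniteDimensional ℝ (E m) := e.symm.finiteDimensional
  have : FiniteDimensional ℝ (TangentSpace I m) := inferInstanceAs (FiniteDimensional ℝ EM)
  infer_instance

theorem finrank_TFiber (m : M) :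
    Module.finrank ℝ (TFiber I E m) = Module.finrank ℝ EM + Module.finrank ℝ F := by
  have : FiniteDimensional ℝ (E m) := (fiberEquiv F E m).symm.finiteDimensional
  have : FiniteDimensional ℝ (TangentSpace I m) := inferInstanceAs (FiniteDimensional ℝ EM)
  rw [Module.finrank_prod, (fiberEquiv F E m).finrank_eq]
  rfl

variable {I F E}

theorem exists_tSec_eq {m : M} (v : TFiber I E m) : ∃ t : TSec I F E, t.1 m = v := by
  obtain ⟨X, hX⟩ := Vec.exists_eq v.1
  obtain ⟨u, hu⟩ := exists_sec_eq (I := I) (F := F) v.2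
  exact ⟨⟨fun m => (X m, u m), X.contMDiff, u.contMDiff⟩, Prod.ext hX hu⟩

/-- A basis of `𝓣` at a point that consists of values of smooth sections is a frame near this
point, with a smooth dual frame. -/
theorem exists_dual_frame {ι : Type*} [Fintype ι] [DecidableEq ι] (t : ι → TSec I F E) {m₀ : M}
    (hli : LinearIndependent ℝ fun i => (t i).1 m₀)
    (hcard : Fintype.card ι = Module.finrank ℝ (TFiber I E m₀)) :
    ∃ θ : ι → Π m, TFiber I E m →ₗ[ℝ] ℝ,
      (∀ i, θ i ∈ homSections (tSections I F E) (smoothFunctions I M)) ∧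
      ∀ᶠ m in 𝓝 m₀, (∀ i j, θ i m ((t j).1 m) = if i = j then 1 else 0) ∧
        ∀ v, v = ∑ i, θ i m v • (t i).1 m := by
  obtain ⟨θ, hθ, h⟩ := exists_dual_coframe exists_covector (fun i => (t i).2) hli
  refine ⟨θ, hθ, h.mono fun m hm => ⟨hm, ?_⟩⟩
  have hsum : ∀ (c : ι → ℝ) i, θ i m (∑ j, c j • (t j).1 m) = c i := by
    intro c i
    simp [map_sum, hm]
  have := finiteDimensional_TFiber I (fiberEquiv F E m)
  have hli' : LinearIndependent ℝ fun i => (t i).1 m := by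
    rw [Fintype.linearIndependent_iff]
    intro c hc i
    rw [← hsum c i, hc, map_zero]
  -- The dual coframe gives independence near m₀; the constant rank of 𝓣 turns it into spanning.
  have hspan := hli'.span_eq_top_of_card_eq_finrank'
    (hcard.trans ((finrank_TFiber I F E m₀).trans (finrank_TFiber I F E m).symm))
  intro v
  obtain ⟨c, rfl⟩ := (Submodule.mem_span_range_iff_exists_fun ℝ).1 (hspan ▸ Submodule.mem_top (x := v))
  exact Finset.sum_congr rfl fun i _ => by rw [hsum]

/-- Frames of complementary subspaces of `𝓣` at a point form a frame of `𝓣` near this point. -/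
theorem exists_dual_frame_of_isCompl {ι κ : Type*} [Fintype ι] [DecidableEq ι] [Fintype κ]
    [DecidableEq κ] {a : ι → TSec I F E} {c : κ → TSec I F E} {m₀ : M}
    (ha : LinearIndependent ℝ fun i => (a i).1 m₀) (hc : LinearIndependent ℝ fun i => (c i).1 m₀)
    (h : IsCompl (Submodule.span ℝ (Set.range fun i => (a i).1 m₀))
      (Submodule.span ℝ (Set.range fun i => (c i).1 m₀))) :
    ∃ θ : ι ⊕ κ → Π m, TFiber I E m →ₗ[ℝ] ℝ,
      (∀ i, θ i ∈ homSections (tSections I F E) (smoothFunctions I M)) ∧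
      ∀ᶠ m in 𝓝 m₀, (∀ i j, θ i m ((Sum.elim a c j).1 m) = if i = j then 1 else 0) ∧
        ∀ v, v = ∑ i, θ i m v • (Sum.elim a c i).1 m := by
  have := finiteDimensional_TFiber I (fiberEquiv F E m₀)
  refine exists_dual_frame _ ?_ ?_
  · have he : (fun i => (Sum.elim a c i).1 m₀) =
        Sum.elim (fun i => (a i).1 m₀) fun i => (c i).1 m₀ := by
      funext i
      cases i <;> rfl
    rw [he]
    exact ha.sum_type hc h.disjoint
  · rw [Fintype.card_sum, ← Submodule.finrank_add_eq_of_isCompl h, finrank_span_eq_card ha,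
      finrank_span_eq_card hc]

/-- Near every point `𝓣` has a frame, with a smooth dual frame, that extends a frame of a given
subbundle. -/
theorem IsSubbundle.exists_adapted_frame {A : Π m, Submodule ℝ (TFiber I E m)}
    (hA : IsSubbundle (tSections I F E) A) (m₀ : M) :
    ∃ (k l : ℕ) (a : Fin k → TSec I F E) (c : Fin l → TSec I F E)
      (θ : Fin k ⊕ Fin l → Π m, TFiber I E m →ₗ[ℝ] ℝ),
      (∀ i, θ i ∈ homSections (tSections I F E) (smoothFunctions I M)) ∧
      ∀ᶠ m in 𝓝 m₀, (∀ i j, θ i m ((Sum.elim a c j).1 m) = if i = j then 1 else 0) ∧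
        (∀ v, v = ∑ i, θ i m v • (Sum.elim a c i).1 m) ∧
        (Submodule.span ℝ (Set.range fun i => (a i).1 m) = A m) := by
  obtain ⟨k, a, ha⟩ := hA m₀
  obtain ⟨D, hD⟩ := Submodule.exists_isCompl (A m₀)
  have := finiteDimensional_TFiber I (fiberEquiv F E m₀)
  -- A complement is needed at m₀ only: sections through a basis of it complete the frame in a
  -- neighbourhood.
  choose c hc using fun i => exists_tSec_eq (F := F) ((Module.finBasis ℝ D i).1)
  have hc1 : (fun i => (c i).1 m₀) = D.subtype ∘ (Module.finBasis ℝ D) := funext hc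
  obtain ⟨θ, hθ, h⟩ := exists_dual_frame_of_isCompl (a := a) (c := c) (m₀ := m₀) ha.self_of_nhds.1
    (by
      rw [hc1]
      exact (Module.finBasis ℝ D).linearIndependent.map' _ D.ker_subtype)
    (by
      rw [hc1, Set.range_comp, ← Submodule.map_span, (Module.finBasis ℝ D).span_eq,
        Submodule.map_top, Submodule.range_subtype, ha.self_of_nhds.2]
      exact hD)
  refine ⟨k, _, a, c, θ, hθ, ?_⟩
  filter_upwards [h, ha] with m hm ham
  exact ⟨hm.1, hm.2, ham.2⟩

end Modules

/-! ### Linear algebra of the pairing on one fibre of 𝓔. -/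

section Pointwise

variable {EM : Type*} [NormedAddCommGroup EM] [NormedSpace ℝ EM] [FiniteDimensional ℝ EM]
  {H : Type*} [TopologicalSpace H] {I : ModelWithCorners ℝ EM H}
  {M : Type*} [TopologicalSpace M] [ChartedSpace H M] [T2Space M] [IsManifold I ∞ M]
  {F : Type*} [NormedAddCommGroup F] [NormedSpace ℝ F] [FiniteDimensional ℝ F]
  {E : M → Type*} [TopologicalSpace (TotalSpace F E)]
  [∀ m, AddCommGroup (E m)] [∀ m, Module ℝ (E m)] [∀ m, TopologicalSpace (E m)]
  [FiberBundle F E] [VectorBundle ℝ F E] [ContMDiffVectorBundle ∞ F E I]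

variable (I F E) in
/-- Twice the symmetric pairing on `𝓔_m`, as a bilinear map. -/
def omniForm (m : M) : OmniFiber I F E m →ₗ[ℝ] OmniFiber I F E m →ₗ[ℝ] E m :=
  LinearMap.mk₂ ℝ (fun X Y => Y.2.1 X.1 + X.2.1 Y.1)
    (fun X X' Y => by simp; abel) (fun c X Y => by simp)
    (fun X Y Y' => by simp; abel) (fun c X Y => by simp)

theorem omniForm_apply {m : M} (X Y : OmniFiber I F E m) :
    omniForm I F E m X Y = Y.2.1 X.1 + X.2.1 Y.1 := rfl

theorem omniForm_comm {m : M} (X Y : OmniFiber I F E m) :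
    omniForm I F E m X Y = omniForm I F E m Y X := by
  rw [omniForm_apply, omniForm_apply, add_comm]

theorem isIsotropic_iff {m : M} {W : Submodule ℝ (OmniFiber I F E m)} :
    IsIsotropic I F E m W ↔ ∀ X ∈ W, ∀ Y ∈ W, omniForm I F E m X Y = 0 := by
  refine forall₄_congr fun X _ Y _ => ?_
  rw [omniPairing, omniForm_apply, smul_eq_zero, or_iff_right (by norm_num)]

theorem bMap_apply {m : M} (X : OmniFiber I F E m) :
    bMap I F E m X = (anchor I F E m X.1, jetProj I F E m X.2) := rfl

theorem anchor_glEmb {m : M} (Φ : E m →ₗ[ℝ] E m) : anchor I F E m (glEmb I F E m Φ) = 0 := rfl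

theorem bMap_aMap {m : M} (h : TFiber I E m →ₗ[ℝ] E m) : bMap I F E m (aMap I F E m h) = 0 := by
  refine Prod.ext rfl ?_
  show (h ∘ₗ LinearMap.inl ℝ _ _) (anchor I F E m (glEmb I F E m LinearMap.id)) = 0
  rw [anchor_glEmb, map_zero]

/-- The jet condition ν(Φ) = Φ(ν(1_E)) turns the pairing of ν with h|_E into h(𝕡ν), and 𝕖(h|_TM)
contributes h(α(𝔯)). Thus Hom(𝓣,E) sees Y only through 𝕓Y. -/
theorem omniForm_aMap {m : M} (h : TFiber I E m →ₗ[ℝ] E m) (Y : OmniFiber I F E m) :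
    omniForm I F E m (aMap I F E m h) Y = h (bMap I F E m Y) := by
  rw [omniForm_apply]
  show Y.2.1 (glEmb I F E m (h ∘ₗ LinearMap.inr ℝ _ _)) + h (anchor I F E m Y.1, 0) = _
  rw [Y.2.2]
  show h (0, jetProj I F E m Y.2) + h (anchor I F E m Y.1, 0) = _
  rw [← map_add, bMap_apply]
  simp

theorem anchor_surjective (m : M) : Function.Surjective (anchor I F E m) := by
  intro x
  obtain ⟨ψ, hψ, h⟩ := exists_local_lift (I := I) (F := F) (E := E) m
  obtain ⟨X, rfl⟩ := Vec.exists_eq x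
  obtain ⟨d, hd⟩ := h X
  refine ⟨d.1 m, (congrArg (fun w : Vec I M => w m) hd).trans ?_⟩
  show ψ m • X m = _
  rw [hψ, one_smul]

/-- Exactness at 𝓔. The 𝔇E-component has zero anchor, so it is an endomorphism. The jet ν has 𝕡ν =
0, so it kills gl(E) by the jet condition and factors through α; a linear section σ of α extracts
the factor. -/
theorem exists_aMap_eq {m : M} {X : OmniFiber I F E m} (hX : bMap I F E m X = 0) :
    ∃ h, aMap I F E m h = X := by
  obtain ⟨Φ, hΦ⟩ := exists_glEmb_eq X.1 (congrArg Prod.fst hX)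
  obtain ⟨σ, hσ⟩ := (anchor I F E m).exists_rightInverse_of_surjective
    (LinearMap.range_eq_top.2 (anchor_surjective m))
  have hp : X.2.1 (glEmb I F E m LinearMap.id) = 0 := congrArg Prod.snd hX
  refine ⟨(X.2.1 ∘ₗ σ).coprod Φ, Prod.ext ?_ ?_⟩
  · show glEmb I F E m ((X.2.1 ∘ₗ σ).coprod Φ ∘ₗ LinearMap.inr ℝ _ _) = _
    rw [LinearMap.coprod_inr, hΦ]
  · show homEmb I F E m ((X.2.1 ∘ₗ σ).coprod Φ ∘ₗ LinearMap.inl ℝ _ _) = _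
    rw [LinearMap.coprod_inl]
    apply Subtype.ext
    ext δ
    show X.2.1 (σ (anchor I F E m δ)) = X.2.1 δ
    rw [← sub_eq_zero, ← map_sub]
    obtain ⟨Ψ, hΨ⟩ := exists_glEmb_eq (σ (anchor I F E m δ) - δ) (by
      rw [map_sub, ← LinearMap.comp_apply (anchor I F E m) σ, hσ]
      exact sub_self _)
    rw [← hΨ, X.2.2, hp, map_zero]

/-- Describes Q⁰ inside 𝓔 by orthogonality alone. The converse direction rests on the surjectivity
of 𝕓. -/
theorem mem_map_annihilator {m : M} {Q : Submodule ℝ (TFiber I E m)} {X : OmniFiber I F E m} :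
    X ∈ (annihilator I Q).map (aMap I F E m) ↔
      bMap I F E m X = 0 ∧ ∀ Y, bMap I F E m Y ∈ Q → omniForm I F E m X Y = 0 := by
  constructor
  · rintro ⟨h, hh, rfl⟩
    exact ⟨bMap_aMap h, fun Y hY => by rw [omniForm_aMap]; exact hh _ hY⟩
  · rintro ⟨h1, h2⟩
    obtain ⟨h, rfl⟩ := exists_aMap_eq h1
    refine ⟨h, fun t ht => ?_, rfl⟩
    have hsurj : ∃ Y, bMap I F E m Y = t := by
      obtain ⟨δ, hδ⟩ := anchor_surjective (I := I) (F := F) (E := E) m t.1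
      obtain ⟨u, hu⟩ := exists_sec_eq (I := I) (F := F) t.2
      exact ⟨(δ, (jetD u).1 m), Prod.ext hδ hu⟩
    obtain ⟨Y, rfl⟩ := hsurj
    rw [← omniForm_aMap]
    exact h2 Y ht

/-- The sum W + 𝕓(W)⁰ is again isotropic, because 𝕓(W)⁰ is orthogonal both to W and to ker 𝕓, so
maximality absorbs it. -/
theorem map_annihilator_le_of_maximal {m : M} {W : Submodule ℝ (OmniFiber I F E m)}
    (hW : Maximal (IsIsotropic I F E m) W) :
    (annihilator I (W.map (bMap I F E m))).map (aMap I F E m) ≤ W := by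
  have hiso := isIsotropic_iff.1 hW.prop
  refine le_trans le_sup_right (hW.le_of_ge (y := W ⊔ _) ?_ le_sup_left)
  rw [isIsotropic_iff]
  intro X hX Y hY
  rw [Submodule.mem_sup] at hX hY
  obtain ⟨X, hX, X', hX', rfl⟩ := hX
  obtain ⟨Y, hY, Y', hY', rfl⟩ := hY
  rw [mem_map_annihilator] at hX' hY'
  rw [map_add, map_add, LinearMap.add_apply, LinearMap.add_apply, hiso X hX Y hY,
    hX'.2 Y ⟨Y, hY, rfl⟩, hX'.2 Y' (by rw [hY'.1]; exact Submodule.zero_mem _), omniForm_comm,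
    hY'.2 X ⟨X, hX, rfl⟩]
  simp

/-- This is the exactness of 0 → A⁰ → L → A → 0 on a fibre: an element 𝕒(h) of W is orthogonal to W,
which says that h kills 𝕓(W). -/
theorem inf_ker_bMap_of_maximal {m : M} {W : Submodule ℝ (OmniFiber I F E m)}
    (hW : Maximal (IsIsotropic I F E m) W) :
    W ⊓ LinearMap.ker (bMap I F E m) =
      (annihilator I (W.map (bMap I F E m))).map (aMap I F E m) := by
  apply le_antisymm
  · rintro X ⟨hX, hX0⟩
    obtain ⟨h, rfl⟩ := exists_aMap_eq hX0
    refine ⟨h, ?_, rfl⟩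
    rintro _ ⟨Y, hY, rfl⟩
    rw [← omniForm_aMap]
    exact isIsotropic_iff.1 hW.prop _ hX _ hY
  · refine le_inf (map_annihilator_le_of_maximal hW) ?_
    rintro _ ⟨h, -, rfl⟩
    exact bMap_aMap h

/-- An isotropic W' ⊇ W cannot have a larger projection: a functional vanishing on 𝕓(W) times a
nonzero e ∈ E_m lies in 𝕓(W)⁰ ⊆ W and would pair nontrivially with W'. Elements of W' therefore
differ from elements of W by vertical vectors orthogonal to W, which belong to 𝕓(W)⁰. -/
theorem maximal_isIsotropic {m : M} [Nontrivial (E m)] {W : Submodule ℝ (OmniFiber I F E m)}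
    (hW : IsIsotropic I F E m W)
    (h : (annihilator I (W.map (bMap I F E m))).map (aMap I F E m) ≤ W) :
    Maximal (IsIsotropic I F E m) W := by
  refine ⟨hW, fun W' hW' hle => ?_⟩
  rw [isIsotropic_iff] at hW'
  have hann : ∀ f ∈ annihilator I (W.map (bMap I F E m)), ∀ Y ∈ W', f (bMap I F E m Y) = 0 := by
    intro f hf Y hY
    rw [← omniForm_aMap]
    exact hW' _ (hle (h ⟨f, hf, rfl⟩)) _ hY
  intro Y hY
  have hb : bMap I F E m Y ∈ W.map (bMap I F E m) := by
    by_contra hn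
    obtain ⟨l, hl, hl0⟩ := Submodule.exists_le_ker_of_notMem hn
    obtain ⟨e, he⟩ := exists_ne (0 : E m)
    have := hann (l.smulRight e) (fun t ht => by
      rw [LinearMap.smulRight_apply, hl0 ht, zero_smul]) Y hY
    rw [LinearMap.smulRight_apply] at this
    exact (smul_eq_zero.1 this).elim hl he
  obtain ⟨X, hX, hXY⟩ := hb
  have h0 : bMap I F E m (Y - X) = 0 := by rw [map_sub, hXY, sub_self]
  obtain ⟨f, hf⟩ := exists_aMap_eq h0
  have hmem : Y - X ∈ W := by
    rw [← hf]
    refine h ⟨f, ?_, rfl⟩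
    rintro _ ⟨Z, hZ, rfl⟩
    rw [← omniForm_aMap, hf]
    exact hW' _ (sub_mem hY (hle hX)) _ (hle hZ)
  simpa using add_mem hmem hX

end Pointwise

/-! ### Calculus of the bracket of 𝓔. -/

section Sections

variable {EM : Type*} [NormedAddCommGroup EM] [NormedSpace ℝ EM] [FiniteDimensional ℝ EM]
  {H : Type*} [TopologicalSpace H] {I : ModelWithCorners ℝ EM H}
  {M : Type*} [TopologicalSpace M] [ChartedSpace H M] [T2Space M] [IsManifold I ∞ M]
  {F : Type*} [NormedAddCommGroup F] [NormedSpace ℝ F] [FiniteDimensional ℝ F]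
  {E : M → Type*} [TopologicalSpace (TotalSpace F E)]
  [∀ m, AddCommGroup (E m)] [∀ m, Module ℝ (E m)] [∀ m, TopologicalSpace (E m)]
  [FiberBundle F E] [VectorBundle ℝ F E] [ContMDiffVectorBundle ∞ F E I]

theorem derAct_sub (d : DerSec I F E) (u v : Cₛ^∞⟮I; F, E⟯) :
    derAct d (u - v) = derAct d u - derAct d v := by
  ext m; exact map_sub (d.1 m).1.1 u v

theorem add_derAct (d r : DerSec I F E) (u : Cₛ^∞⟮I; F, E⟯) :
    derAct (d + r) u = derAct d u + derAct r u := rfl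

theorem smul_derAct (c : ℝ) (d : DerSec I F E) (u : Cₛ^∞⟮I; F, E⟯) :
    derAct (c • d) u = c • derAct d u := rfl

theorem neg_derAct (d : DerSec I F E) (u : Cₛ^∞⟮I; F, E⟯) :
    derAct (-d) u = -derAct d u := rfl

theorem derLie_skew (d r : DerSec I F E) : derLie d r = -derLie r d := by
  apply derSec_ext
  · intro u
    rw [neg_derAct, derAct_derLie, derAct_derLie]
    abel
  · ext m
    exact congrFun VectorField.mlieBracket_swap m

theorem derLie_self (d : DerSec I F E) : derLie d d = 0 := by
  apply derSec_ext
  · intro u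
    exact sub_self _
  · ext m
    exact congrFun VectorField.mlieBracket_self m

theorem add_derLie (d d' r : DerSec I F E) : derLie (d + d') r = derLie d r + derLie d' r := by
  rw [derLie_skew, derLie_add, derLie_skew d, derLie_skew d']
  abel

theorem smul_derLie (c : ℝ) (d r : DerSec I F E) : derLie (c • d) r = c • derLie d r := by
  rw [derLie_skew, derLie_const_smul, derLie_skew d]
  module

theorem derLie_jacobi (d r s : DerSec I F E) :
    derLie d (derLie r s) = derLie (derLie d r) s + derLie r (derLie d s) := by
  apply derSec_ext
  · intro u
    simp only [add_derAct, derAct_derLie, derAct_sub]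
    abel
  · exact Vec.jacobi (derSymbol d) (derSymbol r) (derSymbol s)

theorem derLie_derId (d : DerSec I F E) : derLie d (derId I F E) = 0 := by
  apply derSec_ext
  · intro u
    exact sub_self (derAct d u)
  · ext x
    exact congrFun VectorField.mlieBracket_zero_right x

theorem jetSec_ext {μ ν : JetSec I F E} (h : ∀ r, jetPair μ r = jetPair ν r) : μ = ν := by
  apply Subtype.ext
  funext m
  apply Subtype.ext
  ext δ
  obtain ⟨r, rfl⟩ := exists_derSec_eq δ
  exact congrArg (fun w : Cₛ^∞⟮I; F, E⟯ => w m) (h r)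

theorem jetPair_add (μ : JetSec I F E) (d r : DerSec I F E) :
    jetPair μ (d + r) = jetPair μ d + jetPair μ r := by
  ext x; exact map_add (μ.1 x).1 _ _

theorem jetPair_sub (μ : JetSec I F E) (d r : DerSec I F E) :
    jetPair μ (d - r) = jetPair μ d - jetPair μ r := by
  ext x; exact map_sub (μ.1 x).1 _ _

theorem jetPair_const_smul (c : ℝ) (μ : JetSec I F E) (d : DerSec I F E) :
    jetPair μ (c • d) = c • jetPair μ d := by
  ext x; exact map_smul (μ.1 x).1 _ _

theorem add_jetPair (μ ν : JetSec I F E) (d : DerSec I F E) :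
    jetPair (μ + ν) d = jetPair μ d + jetPair ν d := rfl

theorem sub_jetPair (μ ν : JetSec I F E) (d : DerSec I F E) :
    jetPair (μ - ν) d = jetPair μ d - jetPair ν d := rfl

theorem smul_jetPair (c : ℝ) (μ : JetSec I F E) (d : DerSec I F E) :
    jetPair (c • μ) d = c • jetPair μ d := rfl

theorem jetPair_jetD (u : Cₛ^∞⟮I; F, E⟯) (d : DerSec I F E) :
    jetPair (jetD u) d = derAct d u := rfl

theorem jetD_add (u v : Cₛ^∞⟮I; F, E⟯) :
    (jetD (u + v) : JetSec I F E) = jetD u + jetD v :=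
  jetSec_ext fun r => derAct_add r u v

theorem jetD_sub (u v : Cₛ^∞⟮I; F, E⟯) :
    (jetD (u - v) : JetSec I F E) = jetD u - jetD v :=
  jetSec_ext fun r => derAct_sub r u v

theorem jetD_smul (c : ℝ) (u : Cₛ^∞⟮I; F, E⟯) :
    (jetD (c • u) : JetSec I F E) = c • jetD u :=
  jetSec_ext fun r => derAct_const_smul r c u

theorem jetD_zero : (jetD (0 : Cₛ^∞⟮I; F, E⟯) : JetSec I F E) = 0 := by
  simpa using jetD_smul (I := I) (F := F) (E := E) 0 0

theorem lieDeriv_add (d : DerSec I F E) (μ ν : JetSec I F E) :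
    lieDeriv d (μ + ν) = lieDeriv d μ + lieDeriv d ν := by
  apply jetSec_ext
  intro r
  simp only [jetPair_lieDeriv, add_jetPair, derAct_add]
  abel

theorem lieDeriv_sub (d : DerSec I F E) (μ ν : JetSec I F E) :
    lieDeriv d (μ - ν) = lieDeriv d μ - lieDeriv d ν := by
  apply jetSec_ext
  intro r
  simp only [jetPair_lieDeriv, sub_jetPair, derAct_sub]
  abel

theorem lieDeriv_const_smul (c : ℝ) (d : DerSec I F E) (μ : JetSec I F E) :
    lieDeriv d (c • μ) = c • lieDeriv d μ := by
  apply jetSec_ext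
  intro r
  simp only [jetPair_lieDeriv, smul_jetPair, derAct_const_smul, smul_sub]

theorem add_lieDeriv (d r : DerSec I F E) (μ : JetSec I F E) :
    lieDeriv (d + r) μ = lieDeriv d μ + lieDeriv r μ := by
  apply jetSec_ext
  intro s
  simp only [jetPair_lieDeriv, add_jetPair, add_derAct, add_derLie, jetPair_add]
  abel

theorem smul_lieDeriv (c : ℝ) (d : DerSec I F E) (μ : JetSec I F E) :
    lieDeriv (c • d) μ = c • lieDeriv d μ := by
  apply jetSec_ext
  intro s
  simp only [jetPair_lieDeriv, smul_jetPair, smul_derAct, smul_derLie, jetPair_const_smul, smul_sub]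

theorem lieDeriv_jetD (d : DerSec I F E) (u : Cₛ^∞⟮I; F, E⟯) :
    lieDeriv d (jetD u) = jetD (derAct d u) := by
  apply jetSec_ext
  intro r
  simp only [jetPair_lieDeriv, jetPair_jetD, derAct_derLie]
  abel

theorem lieDeriv_derLie (d r : DerSec I F E) (μ : JetSec I F E) :
    lieDeriv (derLie d r) μ = lieDeriv d (lieDeriv r μ) - lieDeriv r (lieDeriv d μ) := by
  apply jetSec_ext
  intro s
  simp only [jetPair_lieDeriv, sub_jetPair, derAct_derLie, derAct_sub]
  rw [derLie_jacobi d r s, jetPair_add]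
  abel

theorem omniSec_ext {X Y : OmniSec I F E} (h1 : omniDer X = omniDer Y) (h2 : omniJet X = omniJet Y) :
    X = Y := by
  apply Subtype.ext
  funext m
  exact Prod.ext (congrFun (congrArg Subtype.val h1) m) (congrFun (congrArg Subtype.val h2) m)

theorem omniDer_dorfman (X Y : OmniSec I F E) :
    omniDer (dorfman X Y) = derLie (omniDer X) (omniDer Y) := rfl

theorem omniJet_dorfman (X Y : OmniSec I F E) :
    omniJet (dorfman X Y) = lieDeriv (omniDer X) (omniJet Y) - lieDeriv (omniDer Y) (omniJet X) +
      jetD (jetPair (omniJet X) (omniDer Y)) := rfl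

theorem omniDer_add (X Y : OmniSec I F E) : omniDer (X + Y) = omniDer X + omniDer Y := rfl

theorem omniJet_add (X Y : OmniSec I F E) : omniJet (X + Y) = omniJet X + omniJet Y := rfl

theorem omniDer_smul (c : ℝ) (X : OmniSec I F E) : omniDer (c • X) = c • omniDer X := rfl

theorem omniJet_smul (c : ℝ) (X : OmniSec I F E) : omniJet (c • X) = c • omniJet X := rfl

variable (I F E) in
/-- The bracket of the omni-Lie algebroid, as a bilinear map. -/
def dorfmanₗ : OmniSec I F E →ₗ[ℝ] OmniSec I F E →ₗ[ℝ] OmniSec I F E :=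
  LinearMap.mk₂ ℝ dorfman
    (fun X X' Y => omniSec_ext
      (by simp only [omniDer_dorfman, omniDer_add, add_derLie])
      (by
        simp only [omniJet_dorfman, omniDer_add, omniJet_add, add_lieDeriv, lieDeriv_add,
          add_jetPair, jetD_add]
        abel))
    (fun c X Y => omniSec_ext
      (by simp only [omniDer_dorfman, omniDer_smul, smul_derLie])
      (by
        simp only [omniJet_dorfman, omniDer_smul, omniJet_smul, smul_lieDeriv, lieDeriv_const_smul,
          smul_jetPair, jetD_smul]
        module))
    (fun X Y Y' => omniSec_ext
      (by simp only [omniDer_dorfman, omniDer_add, derLie_add])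
      (by
        simp only [omniJet_dorfman, omniDer_add, omniJet_add, add_lieDeriv, lieDeriv_add,
          jetPair_add, jetD_add]
        abel))
    (fun c X Y => omniSec_ext
      (by simp only [omniDer_dorfman, omniDer_smul, derLie_const_smul])
      (by
        simp only [omniJet_dorfman, omniDer_smul, omniJet_smul, smul_lieDeriv, lieDeriv_const_smul,
          jetPair_const_smul, jetD_smul]
        module))

/-- The Jacobi identity in Leibniz form holds on all of Γ(𝓔), without isotropy. It reduces to
𝔏_[𝔡,𝔯] = [𝔏_𝔡, 𝔏_𝔯] and 𝔏_𝔡 ∘ 𝕕 = 𝕕 ∘ 𝔡. -/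
theorem dorfman_jacobi (X Y Z : OmniSec I F E) :
    dorfman X (dorfman Y Z) = dorfman (dorfman X Y) Z + dorfman Y (dorfman X Z) := by
  apply omniSec_ext
  · simp only [omniDer_dorfman, omniDer_add]
    exact derLie_jacobi _ _ _
  · simp only [omniDer_dorfman, omniJet_dorfman, omniJet_add, lieDeriv_add, lieDeriv_sub,
      lieDeriv_derLie, lieDeriv_jetD, add_jetPair, sub_jetPair, jetPair_lieDeriv, jetPair_jetD,
      jetD_add, jetD_sub]
    abel

/-- Twice the symmetric pairing, on sections. -/
def omniFormSec (X Y : OmniSec I F E) : Cₛ^∞⟮I; F, E⟯ :=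
  jetPair (omniJet Y) (omniDer X) + jetPair (omniJet X) (omniDer Y)

theorem omniFormSec_eq_zero {X Y : OmniSec I F E}
    (h : ∀ m, omniForm I F E m (X.1 m) (Y.1 m) = 0) : omniFormSec X Y = 0 := by
  ext m
  exact h m

/-- The Lie derivative terms cancel in pairs, so the failure of skewness is the jet of the pairing.
-/
theorem dorfman_add_swap (X Y : OmniSec I F E) :
    dorfman X Y + dorfman Y X = omniMk 0 (jetD (omniFormSec X Y)) := by
  apply omniSec_ext
  · show derLie _ _ + derLie _ _ = 0
    rw [derLie_skew]
    abel
  · show omniJet (dorfman X Y) + omniJet (dorfman Y X) = jetD (omniFormSec X Y)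
    rw [omniJet_dorfman, omniJet_dorfman, omniFormSec, jetD_add]
    abel

theorem dorfman_swap {X Y : OmniSec I F E} (h : omniFormSec X Y = 0) :
    dorfman X Y = -dorfman Y X := by
  have h1 := dorfman_add_swap X Y
  rw [h, jetD_zero] at h1
  have h2 : dorfman X Y = omniMk 0 0 - dorfman Y X := by
    rw [← h1]
    abel
  have h3 : (omniMk 0 0 : OmniSec I F E) = 0 := omniSec_ext rfl rfl
  rw [h2, h3]
  abel

theorem dorfman_self {X : OmniSec I F E} (h : omniFormSec X X = 0) : dorfman X X = 0 := by
  apply omniSec_ext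
  · exact derLie_self _
  · rw [omniFormSec] at h
    have h2 : jetPair (omniJet X) (omniDer X) = 0 := by
      have : (2 : ℝ) • jetPair (omniJet X) (omniDer X) = 0 := by rw [two_smul]; exact h
      simpa using this
    rw [omniJet_dorfman, h2, jetD_zero]
    show _ = (0 : JetSec I F E)
    abel

variable (I F E) in
/-- The projection `𝕓`, on sections. -/
def bSec : OmniSec I F E →ₗ[ℝ] TSec I F E where
  toFun X := ⟨fun m => bMap I F E m (X.1 m), (derSymbol (omniDer X)).contMDiff,
    (jetPair (omniJet X) (derId I F E)).contMDiff⟩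
  map_add' _ _ := Subtype.ext (funext fun m => map_add (bMap I F E m) _ _)
  map_smul' _ _ := Subtype.ext (funext fun m => map_smul (bMap I F E m) _ _)

/-- The E-component is read off by pairing with 1_E; no bracket term survives because 1_E commutes
with every derivation. -/
theorem bMap_dorfman (X Y : OmniSec I F E) (m : M) :
    bMap I F E m ((dorfman X Y).1 m) =
      ((derSymbol (omniDer X)).lie (derSymbol (omniDer Y)) m,
        (derAct (omniDer X) (jetPair (omniJet Y) (derId I F E)) -
          derAct (omniDer Y) (jetPair (omniJet X) (derId I F E)) +
          jetPair (omniJet X) (omniDer Y)) m) := by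
  refine Prod.ext rfl ?_
  have : jetPair (omniJet (dorfman X Y)) (derId I F E) =
      derAct (omniDer X) (jetPair (omniJet Y) (derId I F E)) -
          derAct (omniDer Y) (jetPair (omniJet X) (derId I F E)) +
          jetPair (omniJet X) (omniDer Y) := by
    have h0 : ∀ μ : JetSec I F E, jetPair μ 0 = 0 := fun μ => by
      simpa using jetPair_const_smul 0 μ (0 : DerSec I F E)
    rw [omniJet_dorfman, add_jetPair, sub_jetPair, jetPair_lieDeriv, jetPair_lieDeriv,
      derLie_derId, derLie_derId, h0, h0, sub_zero, sub_zero]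
    rfl
  exact congrArg (fun w : Cₛ^∞⟮I; F, E⟯ => w m) this

/-- The projection of the bracket with a section of the kernel of `𝕓`. -/
theorem bMap_dorfman_of_ker {Z : OmniSec I F E} (hZ : ∀ m, bMap I F E m (Z.1 m) = 0)
    (Y : OmniSec I F E) (m : M) :
    bMap I F E m ((dorfman Z Y).1 m) = (0, omniForm I F E m (Z.1 m) (Y.1 m)) := by
  have h1 : derSymbol (omniDer Z) = 0 := by
    ext m; exact congrArg Prod.fst (hZ m)
  have h2 : jetPair (omniJet Z) (derId I F E) = 0 := by
    ext m; exact congrArg Prod.snd (hZ m)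
  have h3 : derAct (omniDer Y) 0 = 0 := by
    simpa using derAct_const_smul (omniDer Y) 0 0
  -- The 𝔇E-component of Z is an endomorphism, so its action on 𝕡(ν) is ⟨ν, ·⟩ by the jet condition;
  -- this supplies the missing half of the symmetric pairing.
  rw [bMap_dorfman, h1, h2, h3, sub_zero, ← jetPair_of_symbol _ _ h1]
  refine Prod.ext ?_ rfl
  exact congrFun VectorField.mlieBracket_zero_left m

/-- The sum {Z,Y} + {Y,Z} is the jet of the pairing and projects to the pairing itself; {Z,Y}
already accounts for all of it. -/
theorem bMap_dorfman_of_ker_right {Z : OmniSec I F E} (hZ : ∀ m, bMap I F E m (Z.1 m) = 0)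
    (Y : OmniSec I F E) (m : M) : bMap I F E m ((dorfman Y Z).1 m) = 0 := by
  have h := congrArg (fun W : OmniSec I F E => bMap I F E m (W.1 m)) (dorfman_add_swap Z Y)
  have h' : bMap I F E m ((dorfman Z Y).1 m) + bMap I F E m ((dorfman Y Z).1 m) =
      (0, omniForm I F E m (Z.1 m) (Y.1 m)) := by
    rw [← map_add]
    exact h
  rwa [bMap_dorfman_of_ker hZ, add_eq_left] at h'

theorem dorfman_smul (f : C^∞⟮I, M; ℝ⟯) (X Y : OmniSec I F E)
    (h : (fun m => f m • Y.1 m) ∈ omniSections I F E) (m : M) :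
    (dorfman X ⟨_, h⟩).1 m = f m • (dorfman X Y).1 m +
      mvfderiv I f m (anchor I F E m (X.1 m).1) • Y.1 m := by
  refine Prod.ext ?_ ?_
  · exact congrArg (fun d : DerSec I F E => d.1 m) (derLie_smul f (omniDer X) (omniDer Y))
  -- `fμ` is the jet component of fY, kept opaque. With μ the jet component of X and 𝔯 the
  -- 𝔇E-component of Y, the derivatives of f along the test section in −𝔏_{f𝔯}μ and in 𝕕⟨μ, f𝔯⟩
  -- cancel, leaving only α(X)(f).
  · obtain ⟨fμ, hfμ⟩ : ∃ fμ : JetSec I F E, fμ = omniJet ⟨_, h⟩ := ⟨_, rfl⟩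
    have hp : ∀ r, jetPair fμ r = f • jetPair (omniJet Y) r := by
      intro r; rw [hfμ]; rfl
    have key : ∀ r : DerSec I F E, jetPair (omniJet (dorfman X ⟨_, h⟩)) r =
        f • jetPair (omniJet (dorfman X Y)) r +
          (derSymbol (omniDer X)).deriv f • jetPair (omniJet Y) r := by
      intro r
      have hd : omniDer ⟨_, h⟩ = derSmul f (omniDer Y) := rfl
      have hs : derLie (derSmul f (omniDer Y)) r =
          derSmul f (derLie (omniDer Y) r) - derSmul ((derSymbol r).deriv f) (omniDer Y) := by
        rw [derLie_skew, derLie_smul, derLie_skew r]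
        apply Subtype.ext
        funext m
        show -(f m • -(derLie (omniDer Y) r).1 m + _) = _
        rw [smul_neg, neg_add, neg_neg, ← sub_eq_add_neg]
        rfl
      have ha : ∀ u, derAct (derSmul f (omniDer Y)) u = f • derAct (omniDer Y) u := fun u => rfl
      rw [omniJet_dorfman, omniJet_dorfman, ← hfμ, hd]
      simp only [add_jetPair, sub_jetPair, jetPair_lieDeriv, jetPair_jetD, hp, hs, jetPair_sub,
        jetPair_derSmul, derAct_smul, ha]
      ext x
      simp only [ContMDiffSection.coe_add, ContMDiffSection.coe_sub, Pi.add_apply, Pi.sub_apply,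
        smul_sec_apply]
      module
    apply Subtype.ext
    ext δ
    obtain ⟨r, rfl⟩ := exists_derSec_eq δ
    exact congrArg (fun w : Cₛ^∞⟮I; F, E⟯ => w m) (key r)

end Sections

/-! ### Lifting sections along 𝕓, and the Lie algebroid structure of a Dirac structure. -/

section Quotient

open Filter Topology

variable {EM : Type*} [NormedAddCommGroup EM] [NormedSpace ℝ EM] [FiniteDimensional ℝ EM]
  {H : Type*} [TopologicalSpace H] {I : ModelWithCorners ℝ EM H}
  {M : Type*} [TopologicalSpace M] [ChartedSpace H M] [T2Space M] [IsManifold I ∞ M]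
  {F : Type*} [NormedAddCommGroup F] [NormedSpace ℝ F] [FiniteDimensional ℝ F]
  {E : M → Type*} [TopologicalSpace (TotalSpace F E)]
  [∀ m, AddCommGroup (E m)] [∀ m, Module ℝ (E m)] [∀ m, TopologicalSpace (E m)]
  [FiberBundle F E] [VectorBundle ℝ F E] [ContMDiffVectorBundle ∞ F E I]

/-- A combination of a local frame with constant coefficients takes values in S near m only; a
cut-off makes this hold everywhere. -/
theorem IsSubbundle.exists_section_eq {V : M → Type*} [∀ m, AddCommGroup (V m)]
    [∀ m, Module ℝ (V m)] {Γ : Submodule ℝ (Π m, V m)} {S : Π m, Submodule ℝ (V m)}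
    (hΓ : IsLocalModule I Γ) (hS : IsSubbundle Γ S) {m : M} {v : V m} (hv : v ∈ S m) :
    ∃ s : sectionsIn Γ S, s.1 m = v := by
  obtain ⟨n, s, hs⟩ := hS m
  rw [← hs.self_of_nhds.2] at hv
  obtain ⟨c, rfl⟩ := (Submodule.mem_span_range_iff_exists_fun ℝ).1 hv
  obtain ⟨t, ht⟩ := hΓ.exists_sectionsIn (S := S) (s := fun m => ∑ i, c i • (s i).1 m) (m₀ := m)
    (by
      convert Γ.sum_mem (t := Finset.univ) (f := fun i => c i • (s i).1)
        (fun i _ => Γ.smul_mem _ (s i).2) using 1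
      funext m
      rw [Finset.sum_apply]
      rfl)
    (hs.mono fun m hm => Submodule.sum_mem _ fun i _ => Submodule.smul_mem _ _
      (hm.2 ▸ Submodule.subset_span ⟨i, rfl⟩))
  exact ⟨t, ht.self_of_nhds⟩

/-- A section of `𝓔` with values in `L`, as a section of `𝓔`. -/
abbrev toOmni {L : Π m, Submodule ℝ (OmniFiber I F E m)}
    (X : sectionsIn (omniSections I F E) L) : OmniSec I F E := ⟨X.1, X.2.1⟩

section Lift

variable {L : Π m, Submodule ℝ (OmniFiber I F E m)}

/-- Reducibility enters here. A subfamily of a frame of L projects to a basis of 𝕓(L) at m₀, and the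
constant rank of 𝕓(L) makes it project to a frame nearby; a section of 𝕓(L) is lifted by keeping its
coefficients. -/
theorem exists_local_lift_bMap (hL : IsSubbundle (omniSections I F E) L)
    (hA : IsSubbundle (tSections I F E) fun m => (L m).map (bMap I F E m)) {a : Π m, TFiber I E m}
    (ha : a ∈ tSections I F E) (haA : ∀ m, a m ∈ (L m).map (bMap I F E m)) (m₀ : M) :
    ∃ X ∈ omniSections I F E, ∀ᶠ m in 𝓝 m₀, X m ∈ L m ∧ bMap I F E m (X m) = a m := by
  classical
  obtain ⟨n, s, hs⟩ := hL m₀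
  obtain ⟨k, a', ha'⟩ := hA m₀
  obtain ⟨κ, j, hj, hspan, hli⟩ :=
    exists_linearIndependent' ℝ fun i => (bSec I F E (s i)).1 m₀
  have := Finite.of_injective j hj
  cases nonempty_fintype κ
  obtain ⟨θ, hθ, hdual⟩ := exists_dual_coframe (I := I) exists_covector
    (fun i => (bSec I F E (s (j i))).2) hli
  have hspan₀ : Submodule.span ℝ (Set.range fun i => (bSec I F E (s (j i))).1 m₀) =
      (L m₀).map (bMap I F E m₀) := by
    refine hspan.trans ?_
    rw [← hs.self_of_nhds.2, Submodule.map_span, ← Set.range_comp]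
    rfl
  have hcard : Fintype.card κ = k := by
    rw [← finrank_span_eq_card hli]
    have h2 := finrank_span_eq_card ha'.self_of_nhds.1
    rw [ha'.self_of_nhds.2, Fintype.card_fin] at h2
    refine Eq.trans ?_ h2
    show _ = Module.finrank ℝ ((L m₀).map (bMap I F E m₀))
    rw [← hspan₀]
    rfl
  let c : κ → C^∞⟮I, M; ℝ⟯ := fun i => ⟨fun m => θ i m (a m), hθ i a ha⟩
  refine ⟨∑ i, fun m => c i m • (s (j i)).1 m, Submodule.sum_mem _ fun i _ =>
    isLocalModule_omniSections.smul_mem (c i) _ (s (j i)).2, ?_⟩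
  filter_upwards [hs, ha', hdual] with m hsm ham hdm
  have hmem : ∀ i, (s i).1 m ∈ L m := fun i => hsm.2 ▸ Submodule.subset_span ⟨i, rfl⟩
  have := finiteDimensional_TFiber I (fiberEquiv F E m)
  have := FiniteDimensional.finiteDimensional_submodule ((L m).map (bMap I F E m))
  have hsum : ∀ (x : κ → ℝ) i, θ i m (∑ l, x l • (bSec I F E (s (j l))).1 m) = x i := by
    intro x i
    simp [map_sum, hdm]
  have hli' : LinearIndependent ℝ fun i => (bSec I F E (s (j i))).1 m := by
    rw [Fintype.linearIndependent_iff]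
    intro x hx i
    rw [← hsum x i, hx, map_zero]
  -- Independence persists near m₀, and the given frame of 𝕓(L) has the same number of members, so
  -- spanning follows by dimension.
  have hspan' : Submodule.span ℝ (Set.range fun i => (bSec I F E (s (j i))).1 m) =
      (L m).map (bMap I F E m) := by
    refine Submodule.eq_of_le_of_finrank_eq ?_ ?_
    · rw [Submodule.span_le]
      rintro _ ⟨i, rfl⟩
      exact ⟨_, hmem (j i), rfl⟩
    · have h2 := finrank_span_eq_card ham.1
      rw [ham.2, Fintype.card_fin] at h2
      exact (finrank_span_eq_card hli').trans (hcard.trans h2.symm)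
  rw [Finset.sum_apply]
  refine ⟨Submodule.sum_mem _ fun i _ => Submodule.smul_mem _ _ (hmem (j i)), ?_⟩
  obtain ⟨x, hx⟩ := (Submodule.mem_span_range_iff_exists_fun ℝ).1 (hspan'.symm ▸ haA m)
  rw [map_sum, ← hx]
  refine Finset.sum_congr rfl fun i _ => ?_
  rw [map_smul]
  show θ i m (a m) • _ = _
  rw [← hx, hsum]
  rfl

/-- The lifts of a vector to L form an affine subspace of the fibre, which is convex, so the local
lifts can be glued. -/
theorem exists_lift_bMap [SigmaCompactSpace M] (hL : IsSubbundle (omniSections I F E) L)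
    (hA : IsSubbundle (tSections I F E) fun m => (L m).map (bMap I F E m))
    (a : sectionsIn (tSections I F E) fun m => (L m).map (bMap I F E m)) :
    ∃ X : sectionsIn (omniSections I F E) L, ∀ m, bMap I F E m (X.1 m) = a.1 m := by
  have hconv : ∀ m, Convex ℝ {X | X ∈ L m ∧ bMap I F E m X = a.1 m} := by
    rintro m X ⟨hX, hX'⟩ Y ⟨hY, hY'⟩ p q - - hpq
    refine ⟨add_mem (Submodule.smul_mem _ _ hX) (Submodule.smul_mem _ _ hY), ?_⟩
    rw [map_add, map_smul, map_smul, hX', hY', ← add_smul, hpq, one_smul]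
  obtain ⟨X, hX, h⟩ := isLocalModule_omniSections.glue _ hconv
    (exists_local_lift_bMap hL hA a.2.1 a.2.2)
  exact ⟨⟨X, hX, fun m => (h m).1⟩, fun m => (h m).2⟩

end Lift

theorem add_dorfman (X X' Y : OmniSec I F E) :
    dorfman (X + X') Y = dorfman X Y + dorfman X' Y :=
  LinearMap.map_add₂ (dorfmanₗ I F E) X X' Y

theorem smul_dorfman (c : ℝ) (X Y : OmniSec I F E) : dorfman (c • X) Y = c • dorfman X Y :=
  LinearMap.map_smul₂ (dorfmanₗ I F E) c X Y

theorem sub_dorfman (X X' Y : OmniSec I F E) :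
    dorfman (X - X') Y = dorfman X Y - dorfman X' Y := by
  have h := add_dorfman (X - X') X' Y
  rw [show X - X' + X' = X by abel] at h
  rw [h]
  abel

theorem dorfman_add (X Y Y' : OmniSec I F E) :
    dorfman X (Y + Y') = dorfman X Y + dorfman X Y' :=
  LinearMap.map_add (dorfmanₗ I F E X) Y Y'

theorem dorfman_const_smul (c : ℝ) (X Y : OmniSec I F E) : dorfman X (c • Y) = c • dorfman X Y :=
  LinearMap.map_smul (dorfmanₗ I F E X) c Y

theorem dorfman_sub (X Y Y' : OmniSec I F E) :
    dorfman X (Y - Y') = dorfman X Y - dorfman X Y' := by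
  have h := dorfman_add X (Y - Y') Y'
  rw [show Y - Y' + Y' = Y by abel] at h
  rw [h]
  abel

section Dirac

variable {L : Π m, Submodule ℝ (OmniFiber I F E m)}

theorem IsDirac.omniForm_eq_zero (hL : IsDirac I F E L) {m : M} {X Y : OmniFiber I F E m}
    (hX : X ∈ L m) (hY : Y ∈ L m) : omniForm I F E m X Y = 0 :=
  isIsotropic_iff.1 (hL.maximal m).prop X hX Y hY

/-- The bracket of `𝓔` makes a Dirac structure a Lie algebroid. -/
def IsDirac.lieAlgebroid (hL : IsDirac I F E L) :
    LieAlgebroidStructure I (sectionsIn (omniSections I F E) L)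
      (fun m => anchor I F E m ∘ₗ LinearMap.fst ℝ (DerFiber I F E m) (JetFiber I F E m)) where
  bracket := LinearMap.mk₂ ℝ
    (fun X Y => ⟨(dorfman (toOmni X) (toOmni Y)).1, (dorfman (toOmni X) (toOmni Y)).2,
      hL.closed _ _ X.2.2 Y.2.2⟩)
    (fun X X' Y => Subtype.ext (congrArg (fun Z : OmniSec I F E => Z.1)
      (add_dorfman (toOmni X) (toOmni X') (toOmni Y))))
    (fun c X Y => Subtype.ext (congrArg (fun Z : OmniSec I F E => Z.1)
      (smul_dorfman c (toOmni X) (toOmni Y))))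
    (fun X Y Y' => Subtype.ext (congrArg (fun Z : OmniSec I F E => Z.1)
      (dorfman_add (toOmni X) (toOmni Y) (toOmni Y'))))
    (fun c X Y => Subtype.ext (congrArg (fun Z : OmniSec I F E => Z.1)
      (dorfman_const_smul c (toOmni X) (toOmni Y))))
  -- Among the axioms only this one uses isotropy; the others are identities on Γ(𝓔).
  bracket_self X := Subtype.ext (congrArg (fun Z : OmniSec I F E => Z.1)
    (dorfman_self (X := toOmni X)
      (omniFormSec_eq_zero fun m => hL.omniForm_eq_zero (X.2.2 m) (X.2.2 m))))
  jacobi X Y Z := Subtype.ext (congrArg (fun Z : OmniSec I F E => Z.1)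
    (dorfman_jacobi (toOmni X) (toOmni Y) (toOmni Z)))
  leibniz f X Y hfY m := dorfman_smul f (toOmni X) (toOmni Y) hfY.1 m
  anchor_bracket _ _ _ := rfl

/-- Replacing X by X' changes the projection by the pairing of the vertical X − X' ∈ L with Y ∈ L,
which is zero. A vertical change in the right slot never matters, so Y' may be any section of 𝓔. -/
theorem IsDirac.bMap_dorfman_congr (hL : IsDirac I F E L) {X X' Y Y' : OmniSec I F E}
    (hX : ∀ m, X.1 m ∈ L m) (hX' : ∀ m, X'.1 m ∈ L m) (hY : ∀ m, Y.1 m ∈ L m)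
    (hXX' : ∀ m, bMap I F E m (X.1 m) = bMap I F E m (X'.1 m))
    (hYY' : ∀ m, bMap I F E m (Y.1 m) = bMap I F E m (Y'.1 m)) (m : M) :
    bMap I F E m ((dorfman X Y).1 m) = bMap I F E m ((dorfman X' Y').1 m) := by
  have h1 : bMap I F E m ((dorfman (X - X') Y).1 m) = 0 := by
    rw [bMap_dorfman_of_ker]
    · rw [show (X - X').1 m = X.1 m - X'.1 m from rfl,
        hL.omniForm_eq_zero (sub_mem (hX m) (hX' m)) (hY m)]
      rfl
    · intro m
      rw [show (X - X').1 m = X.1 m - X'.1 m from rfl, map_sub, hXX', sub_self]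
  have h2 : bMap I F E m ((dorfman X' (Y - Y')).1 m) = 0 := by
    rw [bMap_dorfman_of_ker_right]
    intro m
    rw [show (Y - Y').1 m = Y.1 m - Y'.1 m from rfl, map_sub, hYY', sub_self]
  rw [sub_dorfman] at h1
  rw [dorfman_sub] at h2
  have h1' : bMap I F E m ((dorfman X Y).1 m - (dorfman X' Y).1 m) = 0 := h1
  have h2' : bMap I F E m ((dorfman X' Y).1 m - (dorfman X' Y').1 m) = 0 := h2
  rw [map_sub, sub_eq_zero] at h1' h2'
  rw [h1', h2']

/-- A Dirac structure has a given projective Lie algebroid as quotient as soon as `𝕓` maps one onto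
the other and is compatible with the brackets. -/
theorem IsDirac.isQuotientLieAlgebroid (hL : IsDirac I F E L) {A : ProjectiveLieAlgebroid I F E}
    (hA : ∀ m, (L m).map (bMap I F E m) = A.fiber m)
    (hbr : ∀ (X Y : OmniSec I F E) (a b : sectionsIn (tSections I F E) A.fiber),
      (∀ m, X.1 m ∈ L m) → (∀ m, Y.1 m ∈ L m) →
      (∀ m, a.1 m = bMap I F E m (X.1 m)) → (∀ m, b.1 m = bMap I F E m (Y.1 m)) →
      ∀ m, (A.lieAlgebroid.bracket a b).1 m = bMap I F E m ((dorfman X Y).1 m)) :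
    IsQuotientLieAlgebroid L A := by
  have hker : ∀ m, L m ⊓ LinearMap.ker (bMap I F E m) = A.ann m := fun m => by
    rw [inf_ker_bMap_of_maximal (hL.maximal m), hA]
    rfl
  refine ⟨⟨hL.lieAlgebroid, fun _ _ => rfl⟩, hA, hker, fun X h hX hh m => ?_, hbr⟩
  have hhL : ∀ m, h.1 m ∈ L m ∧ bMap I F E m (h.1 m) = 0 := fun m => by
    have := hh m
    rwa [← hker] at this
  -- With A⁰ = L ∩ ker 𝕓, the ideal property splits into closedness of L and vanishing of the
  -- projection.
  rw [← hker]
  refine ⟨⟨hL.closed _ _ hX (fun m => (hhL m).1) m,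
    bMap_dorfman_of_ker_right (fun m => (hhL m).2) X m⟩,
    hL.closed _ _ (fun m => (hhL m).1) hX m, ?_⟩
  refine (bMap_dorfman_of_ker (fun m => (hhL m).2) X m).trans ?_
  rw [hL.omniForm_eq_zero (hhL m).1 (hX m)]
  rfl

end Dirac

/-! ### The quotient Lie algebroid 𝕓(L). -/

namespace ReducibleDirac

variable [SigmaCompactSpace M] (L : ReducibleDirac I F E)

/-- The bundle `𝕓(L)`. -/
abbrev base (m : M) : Submodule ℝ (TFiber I E m) := (L.fiber m).map (bMap I F E m)

/-- A lift of a section of `𝕓(L)` to a section of `L`. -/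
def lift (a : sectionsIn (tSections I F E) L.base) : sectionsIn (omniSections I F E) L.fiber :=
  (exists_lift_bMap L.isDirac.isSubbundle L.reducible a).choose

theorem bMap_lift (a : sectionsIn (tSections I F E) L.base) (m : M) :
    bMap I F E m ((L.lift a).1 m) = a.1 m :=
  (exists_lift_bMap L.isDirac.isSubbundle L.reducible a).choose_spec m

/-- The projection of a section of `L` to `𝕓(L)`. -/
def proj : sectionsIn (omniSections I F E) L.fiber →ₗ[ℝ] sectionsIn (tSections I F E) L.base where
  toFun X := ⟨(bSec I F E (toOmni X)).1, (bSec I F E (toOmni X)).2, fun m => ⟨X.1 m, X.2.2 m, rfl⟩⟩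
  map_add' X Y := Subtype.ext (funext fun m => map_add (bMap I F E m) (X.1 m) (Y.1 m))
  map_smul' c X := Subtype.ext (funext fun m => map_smul (bMap I F E m) c (X.1 m))

/-- The bracket of two sections of `L`. -/
abbrev bracket (X Y : sectionsIn (omniSections I F E) L.fiber) :
    sectionsIn (omniSections I F E) L.fiber := L.isDirac.lieAlgebroid.bracket X Y

theorem proj_lift (a : sectionsIn (tSections I F E) L.base) : L.proj (L.lift a) = a :=
  Subtype.ext (funext fun m => L.bMap_lift a m)

theorem proj_bracket_congr {X X' Y Y' : sectionsIn (omniSections I F E) L.fiber}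
    (hX : L.proj X = L.proj X') (hY : L.proj Y = L.proj Y') :
    L.proj (L.bracket X Y) = L.proj (L.bracket X' Y') :=
  Subtype.ext (funext fun m => L.isDirac.bMap_dorfman_congr (X := toOmni X) (X' := toOmni X')
    (Y := toOmni Y) (Y' := toOmni Y') X.2.2 X'.2.2 Y.2.2
    (congrFun (congrArg Subtype.val hX)) (congrFun (congrArg Subtype.val hY)) m)

/-- The bracket of `𝕓(L)`. -/
def quotientBracket : sectionsIn (tSections I F E) L.base →ₗ[ℝ]
    sectionsIn (tSections I F E) L.base →ₗ[ℝ] sectionsIn (tSections I F E) L.base :=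
  LinearMap.mk₂ ℝ (fun a b => L.proj (L.bracket (L.lift a) (L.lift b)))
    (fun a a' b => by
      rw [← map_add, ← LinearMap.add_apply, ← map_add]
      exact L.proj_bracket_congr (by simp only [map_add, proj_lift]) rfl)
    (fun c a b => by
      rw [← map_smul, ← LinearMap.smul_apply, ← map_smul]
      exact L.proj_bracket_congr (by simp only [map_smul, proj_lift]) rfl)
    (fun a b b' => by
      rw [← map_add, ← map_add]
      exact L.proj_bracket_congr rfl (by simp only [map_add, proj_lift]))
    (fun c a b => by
      rw [← map_smul, ← map_smul]
      exact L.proj_bracket_congr rfl (by simp only [map_smul, proj_lift]))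

/-- Frees the bracket from the chosen lifts: in iterated brackets the lift of a bracket may be
replaced by the bracket of lifts, so the axioms descend from L. -/
theorem quotientBracket_proj {X Y : sectionsIn (omniSections I F E) L.fiber}
    {a b : sectionsIn (tSections I F E) L.base} (hX : L.proj X = a) (hY : L.proj Y = b) :
    L.quotientBracket a b = L.proj (L.bracket X Y) :=
  L.proj_bracket_congr ((L.proj_lift a).trans hX.symm) ((L.proj_lift b).trans hY.symm)

/-- The Lie algebroid structure of `𝕓(L)`. -/
def quotientLieAlgebroid : LieAlgebroidStructure I (sectionsIn (tSections I F E) L.base)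
    (fun m => LinearMap.fst ℝ (TangentSpace I m) (E m)) where
  bracket := L.quotientBracket
  bracket_self a := (congrArg L.proj (L.isDirac.lieAlgebroid.bracket_self (L.lift a))).trans
    (map_zero L.proj)
  jacobi a b c := by
    have h := congrArg L.proj (L.isDirac.lieAlgebroid.jacobi (L.lift a) (L.lift b) (L.lift c))
    rw [map_add] at h
    have e1 := L.quotientBracket_proj (L.proj_lift a)
      (Y := L.bracket (L.lift b) (L.lift c)) (b := L.quotientBracket b c) rfl
    have e2 := L.quotientBracket_proj (X := L.bracket (L.lift a) (L.lift b))
      (a := L.quotientBracket a b) rfl (L.proj_lift c)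
    have e3 := L.quotientBracket_proj (L.proj_lift b)
      (Y := L.bracket (L.lift a) (L.lift c)) (b := L.quotientBracket a c) rfl
    rw [e1, e2, e3]
    exact h
  leibniz f a b hfb m := by
    have hf : (fun m => f m • (L.lift b).1 m) ∈ sectionsIn (omniSections I F E) L.fiber :=
      (isLocalModule_omniSections.sectionsIn L.fiber).smul_mem f _ (L.lift b).2
    have h1 : L.proj ⟨_, hf⟩ = ⟨_, hfb⟩ := by
      refine Subtype.ext (funext fun m => ?_)
      show bMap I F E m (f m • (L.lift b).1 m) = f m • b.1 m
      rw [map_smul, bMap_lift]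
    have h2 := L.quotientBracket_proj (L.proj_lift a) h1
    have h3 : bMap I F E m ((L.bracket (L.lift a) ⟨_, hf⟩).1 m) =
        f m • bMap I F E m ((L.bracket (L.lift a) (L.lift b)).1 m) +
          mvfderiv I f m (anchor I F E m ((L.lift a).1 m).1) • bMap I F E m ((L.lift b).1 m) := by
      rw [← map_smul, ← map_smul, ← map_add]
      exact congrArg _ (L.isDirac.lieAlgebroid.leibniz f (L.lift a) (L.lift b) hf m)
    have h4 : anchor I F E m ((L.lift a).1 m).1 = (a.1 m).1 :=
      congrArg Prod.fst (L.bMap_lift a m)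
    rw [bMap_lift, h4] at h3
    exact (congrArg (fun c : sectionsIn (tSections I F E) L.base => c.1 m) h2).trans h3
  anchor_bracket a b m := by
    have h : ∀ a : sectionsIn (tSections I F E) L.base, (fun x => anchor I F E x ((L.lift a).1 x).1) =
        fun x => LinearMap.fst ℝ (TangentSpace I x) (E x) (a.1 x) := fun a =>
      funext fun x => congrArg Prod.fst (L.bMap_lift a x)
    rw [← h, ← h]
    rfl

/-- The projective Lie algebroid `𝕓(L)`. -/
def toProjective : ProjectiveLieAlgebroid I F E where
  fiber := L.base
  isSubbundle := L.reducible
  lieAlgebroid := L.quotientLieAlgebroid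

theorem isQuotientLieAlgebroid_toProjective : IsQuotientLieAlgebroid L.fiber L.toProjective :=
  L.isDirac.isQuotientLieAlgebroid (fun _ => rfl) fun X Y a b hX hY ha hb m => by
    refine L.isDirac.bMap_dorfman_congr (X := toOmni (L.lift a)) (Y := toOmni (L.lift b))
      (Y' := Y) (L.lift a).2.2 hX (L.lift b).2.2 (fun m => ?_) (fun m => ?_) m
    · exact (L.bMap_lift a m).trans (ha m)
    · exact (L.bMap_lift b m).trans (hb m)

-- Both fibres equal 𝕓(L), and both brackets are computed by the same lifts to L.
variable {L} in
theorem eq_of_isQuotientLieAlgebroid {A A' : ProjectiveLieAlgebroid I F E}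
    (h : IsQuotientLieAlgebroid L.fiber A) (h' : IsQuotientLieAlgebroid L.fiber A') : A = A' := by
  have hA : A.fiber = L.base := funext fun m => (h.map_eq m).symm
  have hA' : A'.fiber = L.base := funext fun m => (h'.map_eq m).symm
  obtain ⟨_, _, S⟩ := A
  obtain ⟨_, _, S'⟩ := A'
  subst hA hA'
  congr 1
  refine LieAlgebroidStructure.ext (LinearMap.ext₂ fun a b => Subtype.ext (funext fun m => ?_))
  have := h.map_bracket (toOmni (L.lift a)) (toOmni (L.lift b)) a b (L.lift a).2.2 (L.lift b).2.2
    (fun m => (L.bMap_lift a m).symm) (fun m => (L.bMap_lift b m).symm) m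
  refine this.trans (Eq.symm ?_)
  exact h'.map_bracket (toOmni (L.lift a)) (toOmni (L.lift b)) a b (L.lift a).2.2 (L.lift b).2.2
    (fun m => (L.bMap_lift a m).symm) (fun m => (L.bMap_lift b m).symm) m

end ReducibleDirac

end Quotient

/-! ### Connections, projections onto subbundles of 𝓣, and tensoriality. -/

section Splittings

open Filter Topology

variable {EM : Type*} [NormedAddCommGroup EM] [NormedSpace ℝ EM] [FiniteDimensional ℝ EM]
  {H : Type*} [TopologicalSpace H] {I : ModelWithCorners ℝ EM H}
  {M : Type*} [TopologicalSpace M] [ChartedSpace H M] [T2Space M] [IsManifold I ∞ M]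
  {F : Type*} [NormedAddCommGroup F] [NormedSpace ℝ F] [FiniteDimensional ℝ F]
  {E : M → Type*} [TopologicalSpace (TotalSpace F E)]
  [∀ m, AddCommGroup (E m)] [∀ m, Module ℝ (E m)] [∀ m, TopologicalSpace (E m)]
  [FiberBundle F E] [VectorBundle ℝ F E] [ContMDiffVectorBundle ∞ F E I]

/-- The canonical local connection that is given by a local frame of `E`. -/
theorem exists_local_connection (m₀ : M) :
    ∃ γ ∈ homSections (secSubmodule I EM (TangentSpace I : M → Type _)) (derSections I F E),
      ∀ᶠ m in 𝓝 m₀, ∀ x, anchor I F E m (γ m x) = x := by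
  obtain ⟨n, s, c, ψ, h1, h2, h3, h4, -, h6⟩ := exists_frame (I := I) (F := F) (V := E) m₀
  obtain ⟨g, hg⟩ := exists_smooth_inv (f := ψ) (m₀ := m₀) (by rw [h1]; exact one_ne_zero)
  have h6x : ∀ (u : Cₛ^∞⟮I; F, E⟯) x, ψ x • u x = ∑ i, c i u x • s i x := fun u x => by
    have := congrArg (fun w : Cₛ^∞⟮I; F, E⟯ => w x) (h6 u)
    simpa only [sec_sum_apply, smul_sec_apply] using this
  have e2 : ∀ i u v m, mvfderiv I (c i (u + v)) m = mvfderiv I (c i u) m + mvfderiv I (c i v) m := by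
    intro i u v m
    rw [h2]
    exact mvfderiv_add ((c i u).contMDiff.mdifferentiable (by simp) m)
      ((c i v).contMDiff.mdifferentiable (by simp) m)
  have e4 : ∀ i (f : C^∞⟮I, M; ℝ⟯) u m (x : TangentSpace I m), mvfderiv I (c i (f • u)) m x =
      f m * mvfderiv I (c i u) m x + mvfderiv I f m x * c i u m := by
    intro i f u m x
    obtain ⟨X, rfl⟩ := Vec.exists_eq x
    rw [h4]
    exact Vec.deriv_mul X f (c i u) m
  have e3 : ∀ i (r : ℝ) u m (x : TangentSpace I m), mvfderiv I (c i (r • u)) m x =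
      r * mvfderiv I (c i u) m x := by
    intro i r u m x
    obtain ⟨X, rfl⟩ := Vec.exists_eq x
    rw [h3]
    exact congrArg (fun f : C^∞⟮I, M; ℝ⟯ => f m) (Vec.deriv_const_smul X r (c i u))
  -- Differentiate the cut-off coordinates of u. Since Σ cᵢ(u) sᵢ = ψu and not u, the symbol is ψx.
  let γ : Π m, TangentSpace I m →ₗ[ℝ] DerFiber I F E m := fun m =>
    { toFun := fun x => ⟨({
          toFun := fun u => ∑ i, mvfderiv I (c i u) m x • s i m
          map_add' := fun u v => by
            simp only [e2, add_apply, add_smul, Finset.sum_add_distrib]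
          map_smul' := fun r u => by
            simp only [e3, mul_smul, Finset.smul_sum, RingHom.id_apply] }, ψ m • x), by
          intro f u
          show ∑ i, mvfderiv I (c i (f • u)) m x • s i m =
            f m • ∑ i, mvfderiv I (c i u) m x • s i m + mvfderiv I f m (ψ m • x) • u m
          simp only [e4, add_smul, mul_smul, Finset.sum_add_distrib]
          rw [Finset.smul_sum, ← Finset.smul_sum (r := mvfderiv I f m x), ← h6x, map_smul,
            smul_eq_mul, smul_smul, mul_comm]⟩
      map_add' := fun x y => by
        apply Subtype.ext
        refine Prod.ext (LinearMap.ext fun u => ?_) (smul_add _ _ _)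
        show ∑ i, mvfderiv I (c i u) m (x + y) • s i m =
          ∑ i, mvfderiv I (c i u) m x • s i m + ∑ i, mvfderiv I (c i u) m y • s i m
        simp only [map_add, add_smul, Finset.sum_add_distrib]
      map_smul' := fun r x => by
        apply Subtype.ext
        refine Prod.ext (LinearMap.ext fun u => ?_) (smul_comm _ _ _)
        show ∑ i, mvfderiv I (c i u) m (r • x) • s i m =
          r • ∑ i, mvfderiv I (c i u) m x • s i m
        simp only [map_smul, smul_eq_mul, mul_smul, Finset.smul_sum] }
  have hγ : γ ∈ homSections (secSubmodule I EM (TangentSpace I : M → Type _))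
      (derSections I F E) := by
    intro X hX
    let X' : Vec I M := ⟨X, hX⟩
    refine ⟨fun u => ?_, (ψ • X').contMDiff⟩
    exact ContMDiff.sum_section (s := Finset.univ) fun i _ =>
      (X'.deriv (c i u)).contMDiff.smul_section (s i).contMDiff
  -- Multiplying by the local inverse g of ψ restores the symbol x near m₀.
  refine ⟨_, isLocalModule_derSections.homSections.smul_mem g γ hγ, ?_⟩
  filter_upwards [hg] with m hm x
  rw [LinearMap.smul_apply, map_smul]
  show g m • ψ m • x = x
  rw [smul_smul, hm, one_smul]

-- The condition α ∘ γ = 1 is affine in γ, so local flat connections can be glued.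
variable (I F E) in
theorem nonempty_connection [SigmaCompactSpace M] : Nonempty (Connection I F E) := by
  have hconv : ∀ m, Convex ℝ {γ : TangentSpace I m →ₗ[ℝ] DerFiber I F E m |
      ∀ x, anchor I F E m (γ x) = x} := by
    rintro m γ hγ γ' hγ' p q - - hpq x
    rw [LinearMap.add_apply, LinearMap.smul_apply, LinearMap.smul_apply, map_add, map_smul,
      map_smul, hγ, hγ', ← add_smul, hpq, one_smul]
  obtain ⟨γ, hγ, h⟩ := (isLocalModule_derSections (I := I) (F := F) (E := E)).homSections.glue _
    hconv exists_local_connection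
  exact ⟨⟨γ, h, fun X => hγ X X.contMDiff⟩⟩

/-- The projection defined by a frame and a dual frame. -/
theorem exists_frame_projection {ι : Type*} [Fintype ι] {a : ι → TSec I F E}
    {θ : ι → Π m, TFiber I E m →ₗ[ℝ] ℝ}
    (hθ : ∀ i, θ i ∈ homSections (tSections I F E) (smoothFunctions I M)) :
    ∃ P ∈ homSections (tSections I F E) (tSections I F E),
      ∀ m v, P m v = ∑ i, θ i m v • (a i).1 m := by
  refine ⟨fun m => ∑ i, (θ i m).smulRight ((a i).1 m), fun s hs => ?_, fun m v => by
    simp [LinearMap.sum_apply]⟩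
  convert (tSections I F E).sum_mem (t := Finset.univ)
    (f := fun i => fun m => θ i m (s m) • (a i).1 m)
    (fun i _ => isLocalModule_tSections.smul_mem ⟨_, hθ i s hs⟩ _ (a i).2) using 1
  funext m
  rw [Finset.sum_apply, LinearMap.sum_apply]
  rfl

variable {A : Π m, Submodule ℝ (TFiber I E m)}

/-- Every subbundle of `𝓣` is the image of a smooth projection. -/
theorem IsSubbundle.exists_projection [SigmaCompactSpace M] (hA : IsSubbundle (tSections I F E) A) :
    ∃ P ∈ homSections (tSections I F E) (tSections I F E),
      ∀ m, (∀ v, P m v ∈ A m) ∧ ∀ v ∈ A m, P m v = v := by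
  have hconv : ∀ m, Convex ℝ {P : TFiber I E m →ₗ[ℝ] TFiber I E m |
      (∀ v, P v ∈ A m) ∧ ∀ v ∈ A m, P v = v} := by
    rintro m P hP P' hP' p q - - hpq
    refine ⟨fun v => ?_, fun v hv => ?_⟩
    · exact add_mem (Submodule.smul_mem _ _ (hP.1 v)) (Submodule.smul_mem _ _ (hP'.1 v))
    · rw [LinearMap.add_apply, LinearMap.smul_apply, LinearMap.smul_apply, hP.2 v hv, hP'.2 v hv,
        ← add_smul, hpq, one_smul]
  refine (isLocalModule_tSections (I := I) (F := F) (E := E)).homSections.glue _ hconv fun m₀ => ?_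
  obtain ⟨k, l, a, c, θ, hθ, h⟩ := hA.exists_adapted_frame m₀
  obtain ⟨P, hP, hPa⟩ := exists_frame_projection (a := a) (θ := fun i => θ (Sum.inl i))
    fun i => hθ _
  refine ⟨P, hP, ?_⟩
  filter_upwards [h] with m hm
  refine ⟨fun v => ?_, fun v hv => ?_⟩
  · rw [hPa, ← hm.2.2]
    exact Submodule.sum_mem _ fun i _ => Submodule.smul_mem _ _ (Submodule.subset_span ⟨i, rfl⟩)
  · rw [← hm.2.2] at hv
    obtain ⟨x, rfl⟩ := (Submodule.mem_span_range_iff_exists_fun ℝ).1 hv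
    rw [hPa]
    refine Finset.sum_congr rfl fun i _ => ?_
    congr 1
    rw [map_sum]
    have : ∀ j, θ (Sum.inl i) m ((a j).1 m) = if i = j then 1 else 0 := fun j => by
      simpa using hm.1 (Sum.inl i) (Sum.inl j)
    simp [this]

/-- The projection onto a subbundle along a complementary subbundle is smooth. -/
theorem IsSubbundle.exists_projection_of_isCompl {C : Π m, Submodule ℝ (TFiber I E m)}
    (hA : IsSubbundle (tSections I F E) A) (hC : IsSubbundle (tSections I F E) C)
    (h : ∀ m, IsCompl (A m) (C m)) :
    ∃ P ∈ homSections (tSections I F E) (tSections I F E),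
      ∀ m, (∀ v, P m v ∈ A m) ∧ (∀ v ∈ A m, P m v = v) ∧ ∀ v ∈ C m, P m v = 0 := by
  let P : Π m, TFiber I E m →ₗ[ℝ] TFiber I E m := fun m =>
    (A m).subtype ∘ₗ (A m).projectionOnto (C m) (h m)
  have hPA : ∀ m, ∀ v ∈ A m, P m v = v := fun m v hv =>
    congrArg Subtype.val (Submodule.projectionOnto_apply_left (h m) ⟨v, hv⟩)
  have hPC : ∀ m, ∀ v ∈ C m, P m v = 0 := fun m v hv =>
    congrArg Subtype.val (Submodule.projectionOnto_apply_right (h m) ⟨v, hv⟩)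
  -- No gluing is needed: the projection along C is unique, so near m₀ it coincides with the one
  -- given by a frame of A ⊕ C.
  refine ⟨P, (isLocalModule_tSections (I := I) (F := F) (E := E)).homSections.mem_of_local _
    fun m₀ => ?_, fun m => ⟨fun v => Subtype.coe_prop _, hPA m, hPC m⟩⟩
  obtain ⟨k, a, ha⟩ := hA m₀
  obtain ⟨l, c, hc⟩ := hC m₀
  obtain ⟨θ, hθ, hdual⟩ := exists_dual_frame_of_isCompl (a := a) (c := c) (m₀ := m₀)
    ha.self_of_nhds.1 hc.self_of_nhds.1 (by
      rw [ha.self_of_nhds.2, hc.self_of_nhds.2]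
      exact h m₀)
  obtain ⟨Q, hQ, hQa⟩ := exists_frame_projection (a := a) (θ := fun i => θ (Sum.inl i))
    fun i => hθ _
  refine ⟨Q, hQ, ?_⟩
  filter_upwards [ha, hc, hdual] with m ham hcm hdm
  refine LinearMap.ext fun v => ?_
  rw [hQa]
  conv_rhs => rw [hdm.2 v]
  rw [map_sum, Fintype.sum_sum_type]
  have h1 : ∀ i, P m ((a i).1 m) = (a i).1 m := fun i =>
    hPA m _ (ham.2 ▸ Submodule.subset_span ⟨i, rfl⟩)
  have h2 : ∀ i, P m ((c i).1 m) = 0 := fun i =>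
    hPC m _ (hcm.2 ▸ Submodule.subset_span ⟨i, rfl⟩)
  simp only [map_smul, Sum.elim_inl, Sum.elim_inr, h1, h2, smul_zero, Finset.sum_const_zero,
    add_zero]

/-- An operation on the sections of a subbundle of `𝓣` which is `C^∞`-linear at `m` depends only on
the value at `m`. -/
theorem IsSubbundle.tensorial (hA : IsSubbundle (tSections I F E) A) {m : M} {W : Type*}
    [AddCommGroup W] [Module ℝ W] (T : sectionsIn (tSections I F E) A →ₗ[ℝ] W)
    (hT : ∀ (f : C^∞⟮I, M; ℝ⟯) (a : sectionsIn (tSections I F E) A)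
      (h : (fun m => f m • a.1 m) ∈ sectionsIn (tSections I F E) A), T ⟨_, h⟩ = f m • T a)
    {a b : sectionsIn (tSections I F E) A} (hab : a.1 m = b.1 m) : T a = T b := by
  rw [← sub_eq_zero, ← map_sub]
  have hs : (a - b).1 m = 0 := sub_eq_zero.2 hab
  generalize a - b = s at hs ⊢
  have hmod := (isLocalModule_tSections (I := I) (F := F) (E := E)).sectionsIn A
  obtain ⟨k, l, a, c, θ, hθ, h⟩ := hA.exists_adapted_frame m
  have ha : ∀ i, ∃ t : sectionsIn (tSections I F E) A, ∀ᶠ x in 𝓝 m, t.1 x = (a i).1 x := fun i =>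
    isLocalModule_tSections.exists_sectionsIn (a i).2 (h.mono fun x hx =>
      hx.2.2 ▸ Submodule.subset_span ⟨i, rfl⟩)
  choose t ht using ha
  -- The coefficients θᵢ(s) vanish at m because s does.
  have hloc : ∀ᶠ x in 𝓝 m, s.1 x = ∑ i, θ (Sum.inl i) x (s.1 x) • (t i).1 x := by
    filter_upwards [h, eventually_all.2 ht] with x hx htx
    simp only [htx]
    have hsx := s.2.2 x
    rw [← hx.2.2] at hsx
    obtain ⟨y, hy⟩ := (Submodule.mem_span_range_iff_exists_fun ℝ).1 hsx
    rw [← hy]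
    refine Finset.sum_congr rfl fun i _ => ?_
    congr 1
    rw [map_sum]
    have : ∀ j, θ (Sum.inl i) x ((a j).1 x) = if i = j then 1 else 0 := fun j => by
      simpa using hx.1 (Sum.inl i) (Sum.inl j)
    simp [this]
  obtain ⟨ψ, h1, h2⟩ := exists_bump I hloc
  let f : Fin k → C^∞⟮I, M; ℝ⟯ := fun i => ψ * ⟨_, hθ (Sum.inl i) s.1 s.2.1⟩
  -- The bump function makes the local expansion a global identity to which T applies; ψ(m) = 1
  -- recovers T(s).
  have hdec : (⟨_, hmod.smul_mem ψ s.1 s.2⟩ : sectionsIn (tSections I F E) A) =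
      ∑ i, ⟨_, hmod.smul_mem (f i) (t i).1 (t i).2⟩ := by
    apply Subtype.ext
    rw [AddSubmonoidClass.coe_finsetSum]
    funext x
    rw [Finset.sum_apply]
    show ψ x • s.1 x = ∑ i, (ψ x * θ (Sum.inl i) x (s.1 x)) • (t i).1 x
    by_cases hx : ψ x = 0
    · simp [hx]
    · simp only [mul_smul]
      rw [← Finset.smul_sum, ← show s.1 x = _ from h2 (subset_closure hx)]
  have hfin := congrArg T hdec
  rw [map_sum, hT ψ s, h1.self_of_nhds, one_smul] at hfin
  rw [hfin]
  refine Finset.sum_eq_zero fun i _ => ?_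
  rw [hT (f i) (t i)]
  show (ψ m * θ (Sum.inl i) m (s.1 m)) • _ = _
  rw [hs, map_zero, mul_zero, zero_smul]

end Splittings

/-! ### The isotropic splitting given by a connection. -/

section Lifts

open Filter Topology

variable {EM : Type*} [NormedAddCommGroup EM] [NormedSpace ℝ EM] [FiniteDimensional ℝ EM]
  {H : Type*} [TopologicalSpace H] {I : ModelWithCorners ℝ EM H}
  {M : Type*} [TopologicalSpace M] [ChartedSpace H M] [T2Space M] [IsManifold I ∞ M]
  {F : Type*} [NormedAddCommGroup F] [NormedSpace ℝ F] [FiniteDimensional ℝ F]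
  {E : M → Type*} [TopologicalSpace (TotalSpace F E)]
  [∀ m, AddCommGroup (E m)] [∀ m, Module ℝ (E m)] [∀ m, TopologicalSpace (E m)]
  [FiberBundle F E] [VectorBundle ℝ F E] [ContMDiffVectorBundle ∞ F E I]

/-- A section of `𝓣` with values in a subbundle, as a section of `𝓣`. -/
abbrev toT {A : Π m, Submodule ℝ (TFiber I E m)} (a : sectionsIn (tSections I F E) A) :
    TSec I F E := ⟨a.1, a.2.1⟩

namespace Connection

variable (γ : Connection I F E)

theorem back_toFun (m : M) (x : TangentSpace I m) : γ.back m (γ.toFun m x) = 0 := by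
  apply glEmb_injective (I := I) (F := F) (E := E) m
  have h := γ.back_spec m (γ.toFun m x)
  rw [γ.anchor_toFun, add_eq_right] at h
  rw [h, map_zero]

theorem bMap_split (m : M) (v : TFiber I E m) : bMap I F E m (γ.split m v) = v := by
  refine Prod.ext (γ.anchor_toFun m v.1) ?_
  show γ.back m (glEmb I F E m LinearMap.id) v.2 = v.2
  rw [γ.back_glEmb]
  rfl

/-- The image of γ + γ̃ is isotropic because the back connection vanishes on horizontal derivations,
ω ∘ γ = 0. -/
theorem omniForm_split (m : M) (v w : TFiber I E m) :
    omniForm I F E m (γ.split m v) (γ.split m w) = 0 := by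
  show γ.back m (γ.toFun m v.1) w.2 + γ.back m (γ.toFun m w.1) v.2 = 0
  rw [γ.back_toFun, γ.back_toFun]
  exact add_zero 0

theorem splitSec_apply (t : TSec I F E) (m : M) : (γ.splitSec t).1 m = γ.split m (t.1 m) := rfl

theorem splitSec_add (s t : TSec I F E) : γ.splitSec (s + t) = γ.splitSec s + γ.splitSec t :=
  Subtype.ext (funext fun m => map_add (γ.split m) (s.1 m) (t.1 m))

theorem splitSec_smul (c : ℝ) (t : TSec I F E) : γ.splitSec (c • t) = c • γ.splitSec t :=
  Subtype.ext (funext fun m => map_smul (γ.split m) c (t.1 m))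

theorem anchor_splitSec (t : TSec I F E) (m : M) :
    anchor I F E m ((γ.splitSec t).1 m).1 = (t.1 m).1 :=
  γ.anchor_toFun m (t.1 m).1

end Connection

/-! ### The defect of a connection and the form Ω. -/

namespace ProjectiveLieAlgebroid

variable (A : ProjectiveLieAlgebroid I F E) (γ : Connection I F E)

theorem bracket_skew (a b : sectionsIn (tSections I F E) A.fiber) :
    A.lieAlgebroid.bracket a b = -A.lieAlgebroid.bracket b a := by
  have h := A.lieAlgebroid.bracket_self (a + b)
  rw [LinearMap.map_add₂, map_add, map_add, A.lieAlgebroid.bracket_self,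
    A.lieAlgebroid.bracket_self, zero_add, add_zero] at h
  exact eq_neg_of_add_eq_zero_left h

/-- The failure `[a, b]_A - 𝕓{γ(a), γ(b)}` of a connection to lift the bracket of `A`. -/
def defect : sectionsIn (tSections I F E) A.fiber →ₗ[ℝ]
    sectionsIn (tSections I F E) A.fiber →ₗ[ℝ] TSec I F E :=
  LinearMap.mk₂ ℝ (fun a b => toT (A.lieAlgebroid.bracket a b) -
      bSec I F E (dorfman (γ.splitSec (toT a)) (γ.splitSec (toT b))))
    (fun a a' b => by
      have h1 : toT (A.lieAlgebroid.bracket (a + a') b) = toT (A.lieAlgebroid.bracket a b) +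
          toT (A.lieAlgebroid.bracket a' b) := by
        rw [map_add]; rfl
      have h2 : γ.splitSec (toT (a + a')) = γ.splitSec (toT a) + γ.splitSec (toT a') :=
        γ.splitSec_add (toT a) (toT a')
      rw [h1, h2, add_dorfman, map_add]
      abel)
    (fun c a b => by
      have h1 : toT (A.lieAlgebroid.bracket (c • a) b) = c • toT (A.lieAlgebroid.bracket a b) := by
        rw [map_smul]; rfl
      have h2 : γ.splitSec (toT (c • a)) = c • γ.splitSec (toT a) := γ.splitSec_smul c (toT a)
      rw [h1, h2, smul_dorfman, map_smul]
      module)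
    (fun a b b' => by
      have h1 : toT (A.lieAlgebroid.bracket a (b + b')) = toT (A.lieAlgebroid.bracket a b) +
          toT (A.lieAlgebroid.bracket a b') := by
        rw [map_add]; rfl
      have h2 : γ.splitSec (toT (b + b')) = γ.splitSec (toT b) + γ.splitSec (toT b') :=
        γ.splitSec_add (toT b) (toT b')
      rw [h1, h2, dorfman_add, map_add]
      abel)
    (fun c a b => by
      have h1 : toT (A.lieAlgebroid.bracket a (c • b)) = c • toT (A.lieAlgebroid.bracket a b) := by
        rw [map_smul]; rfl
      have h2 : γ.splitSec (toT (c • b)) = c • γ.splitSec (toT b) := γ.splitSec_smul c (toT b)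
      rw [h1, h2, dorfman_const_smul, map_smul]
      module)

theorem defect_apply (a b : sectionsIn (tSections I F E) A.fiber) (m : M) :
    (A.defect γ a b).1 m = (A.lieAlgebroid.bracket a b).1 m -
      bMap I F E m ((dorfman (γ.splitSec (toT a)) (γ.splitSec (toT b))).1 m) := rfl

/-- Both brackets have the Lie bracket of the anchors as TM-component, so the defect is E-valued. -/
theorem defect_fst (a b : sectionsIn (tSections I F E) A.fiber) (m : M) :
    ((A.defect γ a b).1 m).1 = 0 := by
  rw [defect_apply, Prod.fst_sub, bMap_dorfman, sub_eq_zero]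
  have h : ∀ a : sectionsIn (tSections I F E) A.fiber,
      (fun x => LinearMap.fst ℝ (TangentSpace I x) (E x) (a.1 x)) =
      derSymbol (omniDer (γ.splitSec (toT a))) := fun a =>
    funext fun x => (γ.anchor_splitSec (toT a) x).symm
  have := A.lieAlgebroid.anchor_bracket a b m
  rw [h, h] at this
  exact this

/-- The bracket of 𝓔 is skew on horizontal sections because these are isotropic. -/
theorem defect_skew (a b : sectionsIn (tSections I F E) A.fiber) :
    A.defect γ a b = -A.defect γ b a := by
  have h1 : toT (A.lieAlgebroid.bracket a b) = -toT (A.lieAlgebroid.bracket b a) := by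
    rw [A.bracket_skew]; rfl
  have h2 := dorfman_swap (X := γ.splitSec (toT a)) (Y := γ.splitSec (toT b))
    (omniFormSec_eq_zero fun m => γ.omniForm_split m _ _)
  show toT (A.lieAlgebroid.bracket a b) - bSec I F E _ =
    -(toT (A.lieAlgebroid.bracket b a) - bSec I F E _)
  have h3 : ∀ X, bSec I F E (-X) = -bSec I F E X := fun X =>
    Subtype.ext (funext fun m => map_neg (bMap I F E m) (X.1 m))
  rw [h1, h2, h3]
  abel

/-- The two brackets satisfy the Leibniz rule with the same anchor, and 𝕓γ(b) = b, so the
derivatives of f cancel. -/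
theorem defect_smul_right (f : C^∞⟮I, M; ℝ⟯) (a b : sectionsIn (tSections I F E) A.fiber)
    (h : (fun m => f m • b.1 m) ∈ sectionsIn (tSections I F E) A.fiber) (m : M) :
    (A.defect γ a ⟨_, h⟩).1 m = f m • (A.defect γ a b).1 m := by
  have hs : (fun m => f m • (γ.splitSec (toT b)).1 m) ∈ omniSections I F E :=
    isLocalModule_omniSections.smul_mem f _ (γ.splitSec (toT b)).2
  have h1 : γ.splitSec (toT ⟨_, h⟩) = ⟨_, hs⟩ :=
    Subtype.ext (funext fun m => map_smul (γ.split m) (f m) (b.1 m))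
  rw [defect_apply, defect_apply, A.lieAlgebroid.leibniz f a b h, h1, dorfman_smul, map_add,
    map_smul, map_smul, γ.anchor_splitSec, γ.splitSec_apply, γ.bMap_split]
  show _ + mvfderiv I f m (a.1 m).1 • b.1 m - _ = _
  module

theorem defect_congr_right (a : sectionsIn (tSections I F E) A.fiber)
    {b b' : sectionsIn (tSections I F E) A.fiber} {m : M} (hb : b.1 m = b'.1 m) :
    (A.defect γ a b).1 m = (A.defect γ a b').1 m :=
  A.isSubbundle.tensorial
    (LinearMap.proj m ∘ₗ (tSections I F E).subtype ∘ₗ A.defect γ a)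
    (fun f b h => A.defect_smul_right γ f a b h m) hb

/-- Tensoriality in the left slot follows from the right slot by skewness. -/
theorem defect_congr {a a' b b' : sectionsIn (tSections I F E) A.fiber} {m : M}
    (ha : a.1 m = a'.1 m) (hb : b.1 m = b'.1 m) :
    (A.defect γ a b).1 m = (A.defect γ a' b').1 m := by
  rw [A.defect_congr_right γ a hb, A.defect_skew γ a, A.defect_skew γ a']
  exact congrArg Neg.neg (A.defect_congr_right γ b' ha)

/-- A smooth two-form restricts to the defect of a connection on the sections of `A`. -/
def IsDefectForm (Ω : TwoForm I F E) : Prop :=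
  ∀ (a b : sectionsIn (tSections I F E) A.fiber) (m : M),
    ((0, Ω.toFun m (a.1 m) (b.1 m)) : TFiber I E m) = (A.defect γ a b).1 m

/-- The form is Ω(v,w) = defect(Pv, Pw). Any smooth projection onto A will do; with the projection
along C one obtains the normalisation Ω(c, ·) = 0. -/
theorem exists_defectForm {P : Π m, TFiber I E m →ₗ[ℝ] TFiber I E m}
    (hP : P ∈ homSections (tSections I F E) (tSections I F E)) (hPA : ∀ m v, P m v ∈ A.fiber m)
    (hPv : ∀ m, ∀ v ∈ A.fiber m, P m v = v) :
    ∃ Ω : TwoForm I F E, A.IsDefectForm γ Ω ∧ ∀ m v w, P m v = 0 → Ω.toFun m v w = 0 := by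
  let p : TSec I F E →ₗ[ℝ] sectionsIn (tSections I F E) A.fiber :=
    { toFun := fun s => ⟨fun m => P m (s.1 m), hP s.1 s.2, fun m => hPA m _⟩
      map_add' := fun s t => Subtype.ext (funext fun m => map_add (P m) (s.1 m) (t.1 m))
      map_smul' := fun c s => Subtype.ext (funext fun m => map_smul (P m) c (s.1 m)) }
  -- The extensions are arbitrary, with no linearity or dependence on m assumed: by tensoriality the
  -- defect sees only their values at m.
  choose σ hσ using fun (m : M) (v : TFiber I E m) => exists_tSec_eq (F := F) v
  have hcongr : ∀ {m : M} {s s' t t' : TSec I F E}, s.1 m = s'.1 m → t.1 m = t'.1 m →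
      ((A.defect γ (p s) (p t)).1 m).2 = ((A.defect γ (p s') (p t')).1 m).2 := fun hs ht =>
    congrArg Prod.snd (A.defect_congr γ (congrArg _ hs) (congrArg _ ht))
  let Ω : Π m, TFiber I E m →ₗ[ℝ] TFiber I E m →ₗ[ℝ] E m := fun m =>
    LinearMap.mk₂ ℝ (fun v w => ((A.defect γ (p (σ m v)) (p (σ m w))).1 m).2)
      (fun v v' w => by
        rw [hcongr (s' := σ m v + σ m v') (t' := σ m w) ?_ rfl, map_add, map_add,
          LinearMap.add_apply]
        · rfl
        · exact (hσ m _).trans (congrArg₂ (· + ·) (hσ m v) (hσ m v')).symm)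
      (fun c v w => by
        rw [hcongr (s' := c • σ m v) (t' := σ m w) ?_ rfl, map_smul, map_smul,
          LinearMap.smul_apply]
        · rfl
        · exact (hσ m _).trans (congrArg (c • ·) (hσ m v)).symm)
      (fun v w w' => by
        rw [hcongr (s' := σ m v) (t' := σ m w + σ m w') rfl ?_, map_add, map_add]
        · rfl
        · exact (hσ m _).trans (congrArg₂ (· + ·) (hσ m w) (hσ m w')).symm)
      (fun c v w => by
        rw [hcongr (s' := σ m v) (t' := c • σ m w) rfl ?_, map_smul, map_smul]
        · rfl
        · exact (hσ m _).trans (congrArg (c • ·) (hσ m w)).symm)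
  have hΩ : ∀ (s t : TSec I F E) m, Ω m (s.1 m) (t.1 m) = ((A.defect γ (p s) (p t)).1 m).2 :=
    fun s t m => hcongr (hσ m _) (hσ m _)
  refine ⟨⟨Ω, fun m v => ?_, fun s t => ?_⟩, fun a b m => ?_, fun m v w hv => ?_⟩
  · have h : Ω m v v = -Ω m v v := congrArg (fun t : TSec I F E => (t.1 m).2)
      (A.defect_skew γ (p (σ m v)) (p (σ m v)))
    rw [eq_neg_iff_add_eq_zero, ← two_smul ℝ] at h
    exact (smul_eq_zero.1 h).resolve_left two_ne_zero
  · simp only [hΩ]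
    exact (A.defect γ (p s) (p t)).2.2
  · have hp : ∀ a : sectionsIn (tSections I F E) A.fiber, p (toT a) = a := fun a =>
      Subtype.ext (funext fun m => hPv m _ (a.2.2 m))
    refine Prod.ext (A.defect_fst γ a b m).symm ?_
    refine (hΩ (toT a) (toT b) m).trans ?_
    rw [hp, hp]
  · have h0 : (p (σ m v)).1 m = (0 : sectionsIn (tSections I F E) A.fiber).1 m := by
      show P m ((σ m v).1 m) = 0
      rw [hσ, hv]
    refine (congrArg Prod.snd (A.defect_congr γ (b := p (σ m w)) h0 rfl)).trans ?_
    rw [map_zero]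
    rfl

end ProjectiveLieAlgebroid

/-! ### The lift γ(A) + Ω(A) + A⁰ and its characterisation by brackets. -/

section LiftFiber

variable {A : ProjectiveLieAlgebroid I F E} {γ : Connection I F E} {Ω : TwoForm I F E}

theorem TwoForm.skew (Ω : TwoForm I F E) (m : M) (v w : TFiber I E m) :
    Ω.toFun m v w = -Ω.toFun m w v := by
  have h := Ω.alternating m (v + w)
  rw [LinearMap.map_add₂, map_add, map_add, Ω.alternating, Ω.alternating, zero_add,
    add_zero] at h
  exact eq_neg_of_add_eq_zero_left h

theorem bMap_sub_split {m : M} (X : OmniFiber I F E m) :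
    bMap I F E m (X - γ.split m (bMap I F E m X)) = 0 := by
  rw [map_sub, γ.bMap_split, sub_self]

theorem omniForm_of_ker {m : M} {Z : OmniFiber I F E m} (hZ : bMap I F E m Z = 0)
    {Y Y' : OmniFiber I F E m} (h : bMap I F E m Y = bMap I F E m Y') :
    omniForm I F E m Z Y = omniForm I F E m Z Y' := by
  obtain ⟨f, rfl⟩ := exists_aMap_eq hZ
  rw [omniForm_aMap, omniForm_aMap, h]

/-- Replaces the sum by one equation: over A, the vertical part of X must be 𝕒 of a map agreeing
with Ω(𝕓X, ·) on A; off A it is free, which is the summand A⁰. -/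
theorem mem_liftFiber {m : M} {X : OmniFiber I F E m} :
    X ∈ liftFiber A γ Ω m ↔ bMap I F E m X ∈ A.fiber m ∧ ∀ t ∈ A.fiber m,
      omniForm I F E m (X - γ.split m (bMap I F E m X)) (γ.split m t) =
        Ω.toFun m (bMap I F E m X) t := by
  constructor
  · intro h
    rw [liftFiber, Submodule.mem_sup] at h
    obtain ⟨_, ⟨a, ha, rfl⟩, _, ⟨f, hf, rfl⟩, rfl⟩ := h
    have hb : bMap I F E m ((γ.split m + aMap I F E m ∘ₗ Ω.toFun m) a + aMap I F E m f) = a := by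
      rw [LinearMap.add_apply, LinearMap.comp_apply, map_add, map_add, γ.bMap_split, bMap_aMap,
        bMap_aMap, add_zero, add_zero]
    rw [hb]
    refine ⟨ha, fun t ht => ?_⟩
    have h2 : (γ.split m + aMap I F E m ∘ₗ Ω.toFun m) a + aMap I F E m f - γ.split m a =
        aMap I F E m (Ω.toFun m a + f) := by
      rw [LinearMap.add_apply, LinearMap.comp_apply, map_add]
      abel
    rw [h2, omniForm_aMap, γ.bMap_split, LinearMap.add_apply, hf t ht, add_zero]
  · rintro ⟨h1, h2⟩
    obtain ⟨f, hf⟩ := exists_aMap_eq (bMap_sub_split (γ := γ) X)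
    have hX : X = (γ.split m + aMap I F E m ∘ₗ Ω.toFun m) (bMap I F E m X) +
        aMap I F E m (f - Ω.toFun m (bMap I F E m X)) := by
      rw [LinearMap.add_apply, LinearMap.comp_apply, map_sub, hf]
      abel
    rw [hX]
    refine Submodule.add_mem_sup ⟨_, h1, rfl⟩ ⟨_, fun t ht => ?_, rfl⟩
    rw [LinearMap.sub_apply, ← h2 t ht, ← hf, omniForm_aMap, γ.bMap_split, sub_self]

theorem map_bMap_liftFiber (m : M) : (liftFiber A γ Ω m).map (bMap I F E m) = A.fiber m := by
  apply le_antisymm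
  · rintro _ ⟨X, hX, rfl⟩
    exact (mem_liftFiber.1 hX).1
  · intro a ha
    refine ⟨(γ.split m + aMap I F E m ∘ₗ Ω.toFun m) a,
      Submodule.mem_sup_left ⟨a, ha, rfl⟩, ?_⟩
    rw [LinearMap.add_apply, LinearMap.comp_apply, map_add, γ.bMap_split, bMap_aMap, add_zero]

/-- Horizontal parts are mutually orthogonal, and the vertical parts contribute Ω(a,b) + Ω(b,a) = 0.
-/
theorem isIsotropic_liftFiber (m : M) : IsIsotropic I F E m (liftFiber A γ Ω m) := by
  rw [isIsotropic_iff]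
  intro X hX Y hY
  rw [mem_liftFiber] at hX hY
  have h1 := (omniForm_of_ker (bMap_sub_split (γ := γ) X)
    (γ.bMap_split m (bMap I F E m Y))).symm.trans (hX.2 _ hY.1)
  have h2 := hY.2 _ hX.1
  have h3 := γ.omniForm_split m (bMap I F E m X) (bMap I F E m Y)
  rw [map_sub, LinearMap.sub_apply, sub_eq_iff_eq_add] at h1
  rw [omniForm_comm, map_sub, h3, sub_zero] at h2
  rw [h1, h2, Ω.skew m (bMap I F E m X), neg_add_cancel]

theorem maximal_liftFiber [Nontrivial F] (m : M) :
    Maximal (IsIsotropic I F E m) (liftFiber A γ Ω m) := by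
  have : Nontrivial (E m) := (fiberEquiv F E m).toEquiv.nontrivial
  refine maximal_isIsotropic (isIsotropic_liftFiber m) ?_
  rw [map_bMap_liftFiber]
  exact le_sup_right

namespace ProjectiveLieAlgebroid.IsDefectForm

/-- With X = γ(a) + Z and Y = γ(b) + W, where Z and W are vertical, {X,Y} = {Z,Y} + {γa,W} +
{γa,γb}. The three terms project to 2(Z,Y)₊, to 0, and to [a,b]_A − Ω(a,b). -/
theorem bracket_sub (hΩ : A.IsDefectForm γ Ω) {X Y : OmniSec I F E}
    {a b : sectionsIn (tSections I F E) A.fiber}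
    (ha : ∀ m, a.1 m = bMap I F E m (X.1 m)) (hb : ∀ m, b.1 m = bMap I F E m (Y.1 m)) (m : M) :
    bMap I F E m ((dorfman X Y).1 m) = (A.lieAlgebroid.bracket a b).1 m +
      (0, omniForm I F E m (X.1 m - γ.split m (bMap I F E m (X.1 m))) (Y.1 m) -
        Ω.toFun m (bMap I F E m (X.1 m)) (bMap I F E m (Y.1 m))) := by
  obtain ⟨Z, hZ⟩ : ∃ Z, Z = X - γ.splitSec (toT a) := ⟨_, rfl⟩
  obtain ⟨W, hW⟩ : ∃ W, W = Y - γ.splitSec (toT b) := ⟨_, rfl⟩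
  have hZm : ∀ m, Z.1 m = X.1 m - γ.split m (bMap I F E m (X.1 m)) := fun m => by
    rw [hZ, ← ha]; rfl
  have hWm : ∀ m, W.1 m = Y.1 m - γ.split m (bMap I F E m (Y.1 m)) := fun m => by
    rw [hW, ← hb]; rfl
  have e : dorfman X Y = dorfman Z Y + dorfman (γ.splitSec (toT a)) W +
      dorfman (γ.splitSec (toT a)) (γ.splitSec (toT b)) := by
    rw [hZ, hW, sub_dorfman, dorfman_sub]
    abel
  have h1 := bMap_dorfman_of_ker (fun m => by rw [hZm]; exact bMap_sub_split _) Y (Z := Z) m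
  have h2 := bMap_dorfman_of_ker_right (fun m => by rw [hWm]; exact bMap_sub_split _)
    (γ.splitSec (toT a)) (Z := W) m
  have h3 := hΩ a b m
  rw [A.defect_apply, ha, hb] at h3
  have h4 : bMap I F E m ((dorfman X Y).1 m) = bMap I F E m ((dorfman Z Y).1 m) +
      bMap I F E m ((dorfman (γ.splitSec (toT a)) W).1 m) +
      bMap I F E m ((dorfman (γ.splitSec (toT a)) (γ.splitSec (toT b))).1 m) := by
    rw [e, ← map_add, ← map_add]
    rfl
  rw [h4, h1, h2, add_zero, ← sub_add_cancel ((A.lieAlgebroid.bracket a b).1 m), ← h3, ← hZm]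
  refine Prod.ext ?_ ?_
  · simp
  · simp only [Prod.snd_add]
    abel

theorem bracket_eq_iff (hΩ : A.IsDefectForm γ Ω) {X Y : OmniSec I F E}
    {a b : sectionsIn (tSections I F E) A.fiber}
    (ha : ∀ m, a.1 m = bMap I F E m (X.1 m)) (hb : ∀ m, b.1 m = bMap I F E m (Y.1 m)) (m : M) :
    bMap I F E m ((dorfman X Y).1 m) = (A.lieAlgebroid.bracket a b).1 m ↔
      omniForm I F E m (X.1 m - γ.split m (bMap I F E m (X.1 m)))
          (γ.split m (bMap I F E m (Y.1 m))) =
        Ω.toFun m (bMap I F E m (X.1 m)) (bMap I F E m (Y.1 m)) := by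
  rw [hΩ.bracket_sub ha hb, add_eq_left, Prod.mk_eq_zero, sub_eq_zero,
    omniForm_of_ker (bMap_sub_split (γ := γ) _) (γ.bMap_split m (bMap I F E m (Y.1 m))).symm]
  exact and_iff_right rfl

/-- The lift of `A` consists of the sections whose brackets with all sections over `A` project to
the brackets of `A`. -/
theorem forall_mem_liftFiber_iff (hΩ : A.IsDefectForm γ Ω) {X : OmniSec I F E}
    {a : sectionsIn (tSections I F E) A.fiber} (ha : ∀ m, a.1 m = bMap I F E m (X.1 m)) :
    (∀ m, X.1 m ∈ liftFiber A γ Ω m) ↔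
      ∀ (Y : OmniSec I F E) (b : sectionsIn (tSections I F E) A.fiber),
        (∀ m, b.1 m = bMap I F E m (Y.1 m)) →
        ∀ m, bMap I F E m ((dorfman X Y).1 m) = (A.lieAlgebroid.bracket a b).1 m := by
  constructor
  · intro h Y b hb m
    rw [hΩ.bracket_eq_iff ha hb]
    exact (mem_liftFiber.1 (h m)).2 _ (hb m ▸ b.2.2 m)
  · intro h m
    refine mem_liftFiber.2 ⟨ha m ▸ a.2.2 m, fun t ht => ?_⟩
    -- Testing against Y = γ(b), with b a section of A through t, recovers the fibrewise equation.
    obtain ⟨b, rfl⟩ := A.isSubbundle.exists_section_eq isLocalModule_tSections ht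
    have hb : ∀ m, b.1 m = bMap I F E m ((γ.splitSec (toT b)).1 m) := fun m =>
      (γ.bMap_split m _).symm
    have := (hΩ.bracket_eq_iff ha hb m).1 (h _ b hb m)
    rwa [← hb] at this

/-- If bracketing with X and with Y projects correctly on all sections over A, then so does
bracketing with {X,Y}, by the Jacobi identities of 𝓔 and of A. This is the only place where the
Jacobi identity of A enters. -/
theorem dorfman_mem (hΩ : A.IsDefectForm γ Ω) {X Y : OmniSec I F E}
    (hX : ∀ m, X.1 m ∈ liftFiber A γ Ω m) (hY : ∀ m, Y.1 m ∈ liftFiber A γ Ω m) (m : M) :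
    (dorfman X Y).1 m ∈ liftFiber A γ Ω m := by
  have hsec : ∀ {X : OmniSec I F E}, (∀ m, X.1 m ∈ liftFiber A γ Ω m) →
      ∃ a : sectionsIn (tSections I F E) A.fiber, ∀ m, a.1 m = bMap I F E m (X.1 m) :=
    fun {X} hX => ⟨⟨(bSec I F E X).1, (bSec I F E X).2, fun m => (mem_liftFiber.1 (hX m)).1⟩,
      fun m => rfl⟩
  obtain ⟨a, ha⟩ := hsec hX
  obtain ⟨b, hb⟩ := hsec hY
  have hX' := (hΩ.forall_mem_liftFiber_iff ha).1 hX
  have hY' := (hΩ.forall_mem_liftFiber_iff hb).1 hY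
  revert m
  rw [hΩ.forall_mem_liftFiber_iff (a := A.lieAlgebroid.bracket a b)
    fun m => (hX' Y b hb m).symm]
  intro Z c hc m
  have h1 := hX' _ _ (fun m => (hY' Z c hc m).symm) m
  have h2 := hY' _ _ (fun m => (hX' Z c hc m).symm) m
  have e : dorfman (dorfman X Y) Z = dorfman X (dorfman Y Z) - dorfman Y (dorfman X Z) := by
    rw [dorfman_jacobi X Y Z]
    abel
  have e' : A.lieAlgebroid.bracket (A.lieAlgebroid.bracket a b) c =
      A.lieAlgebroid.bracket a (A.lieAlgebroid.bracket b c) -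
        A.lieAlgebroid.bracket b (A.lieAlgebroid.bracket a c) := by
    rw [A.lieAlgebroid.jacobi a b c, add_sub_cancel_right]
  rw [e, e']
  refine (map_sub (bMap I F E m) _ _).trans ?_
  rw [h1, h2]
  rfl

/-- Compatibility of the brackets, tested on pairs of sections of L, gives L ⊆ γ(A) + Ω(A) + A⁰ by
`bracket_eq_iff`. The right side is isotropic and L is maximal, so they coincide. -/
theorem liftFiber_eq (hΩ : A.IsDefectForm γ Ω) {L : Π m, Submodule ℝ (OmniFiber I F E m)}
    (hL : IsDirac I F E L) (hq : IsQuotientLieAlgebroid L A) (m : M) :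
    L m = liftFiber A γ Ω m := by
  refine (hL.maximal m).eq_of_le (isIsotropic_liftFiber m) fun X₀ hX₀ => ?_
  obtain ⟨X, rfl⟩ := hL.isSubbundle.exists_section_eq isLocalModule_omniSections hX₀
  have hmem : ∀ X : sectionsIn (omniSections I F E) L, ∀ m, bMap I F E m (X.1 m) ∈ A.fiber m :=
    fun X m => hq.map_eq m ▸ ⟨X.1 m, X.2.2 m, rfl⟩
  refine mem_liftFiber.2 ⟨hmem X m, fun t ht => ?_⟩
  rw [← hq.map_eq] at ht
  obtain ⟨Y₀, hY₀, rfl⟩ := ht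
  obtain ⟨Y, rfl⟩ := hL.isSubbundle.exists_section_eq isLocalModule_omniSections hY₀
  refine (hΩ.bracket_eq_iff (X := toOmni X) (Y := toOmni Y)
    (a := ⟨(bSec I F E (toOmni X)).1, (bSec I F E (toOmni X)).2, hmem X⟩)
    (b := ⟨(bSec I F E (toOmni Y)).1, (bSec I F E (toOmni Y)).2, hmem Y⟩)
    (fun _ => rfl) (fun _ => rfl) m).1 ?_
  exact (hq.map_bracket (toOmni X) (toOmni Y) _ _ X.2.2 Y.2.2 (fun _ => rfl) (fun _ => rfl) m).symm

end ProjectiveLieAlgebroid.IsDefectForm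

end LiftFiber

end Lifts

/-! ### The lift as a Dirac structure, the bijection, and the uniqueness of Ω_γ. -/

section Correspondence

open Filter Topology

variable {EM : Type*} [NormedAddCommGroup EM] [NormedSpace ℝ EM] [FiniteDimensional ℝ EM]
  {H : Type*} [TopologicalSpace H] {I : ModelWithCorners ℝ EM H}
  {M : Type*} [TopologicalSpace M] [ChartedSpace H M] [T2Space M] [IsManifold I ∞ M]
  {F : Type*} [NormedAddCommGroup F] [NormedSpace ℝ F] [FiniteDimensional ℝ F]
  {E : M → Type*} [TopologicalSpace (TotalSpace F E)]
  [∀ m, AddCommGroup (E m)] [∀ m, Module ℝ (E m)] [∀ m, TopologicalSpace (E m)]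
  [FiberBundle F E] [VectorBundle ℝ F E] [ContMDiffVectorBundle ∞ F E I]

theorem exists_sec_frame (m₀ : M) : ∃ (r : ℕ) (e : Fin r → Cₛ^∞⟮I; F, E⟯)
    (η : Fin r → Π m, E m →ₗ[ℝ] ℝ), ∀ᶠ m in 𝓝 m₀,
      (∀ i j, η i m (e j m) = if i = j then 1 else 0) ∧ ∀ v, v = ∑ i, η i m v • e i m := by
  have hfin : ∀ m, FiniteDimensional ℝ (E m) := fun m =>
    (fiberEquiv F E m).symm.finiteDimensional
  have := hfin m₀
  choose e he using fun i => exists_sec_eq (I := I) (F := F) (Module.finBasis ℝ (E m₀) i)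
  obtain ⟨η, -, h⟩ := exists_dual_coframe (I := I) (Γ := secSubmodule I F E) exists_sec_covector
    (t := fun i => e i) (m₀ := m₀) (fun i => (e i).contMDiff) (by
      simp only [he]
      exact (Module.finBasis ℝ (E m₀)).linearIndependent)
  refine ⟨_, e, η, h.mono fun m hm => ⟨hm, ?_⟩⟩
  have := hfin m
  have hsum : ∀ (c : Fin (Module.finrank ℝ (E m₀)) → ℝ) i, η i m (∑ j, c j • e j m) = c i := by
    intro c i
    simp [map_sum, hm]
  have hli : LinearIndependent ℝ fun i => e i m := by
    rw [Fintype.linearIndependent_iff]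
    intro c hc i
    rw [← hsum c i, hc, map_zero]
  have hspan := hli.span_eq_top_of_card_eq_finrank' (by
    rw [Fintype.card_fin, (fiberEquiv F E m₀).finrank_eq, (fiberEquiv F E m).finrank_eq])
  intro v
  obtain ⟨c, rfl⟩ := (Submodule.mem_span_range_iff_exists_fun ℝ).1
    (hspan ▸ Submodule.mem_top (x := v))
  exact Finset.sum_congr rfl fun i _ => by rw [hsum]

theorem aMap_mem_omniSections {h : Π m, TFiber I E m →ₗ[ℝ] E m}
    (hh : h ∈ homSections (tSections I F E) (secSubmodule I F E)) :
    (fun m => aMap I F E m (h m)) ∈ omniSections I F E := by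
  refine ⟨⟨fun u => ?_, (0 : Vec I M).contMDiff⟩, fun d hd => ?_⟩
  · exact hh (fun m => (0, u m)) ⟨(0 : Vec I M).contMDiff, u.contMDiff⟩
  · exact hh (fun m => (anchor I F E m (d m), 0)) ⟨hd.2, (0 : Cₛ^∞⟮I; F, E⟯).contMDiff⟩

theorem IsSubbundle.of_fintype {V : M → Type*} [∀ m, AddCommGroup (V m)]
    [∀ m, Module ℝ (V m)] {Γ : Submodule ℝ (Π m, V m)} {S : Π m, Submodule ℝ (V m)}
    (h : ∀ m₀ : M, ∃ (ι : Type) (_ : Fintype ι) (s : ι → Γ), ∀ᶠ m in 𝓝 m₀,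
      LinearIndependent ℝ (fun i => (s i).1 m) ∧
        Submodule.span ℝ (Set.range fun i => (s i).1 m) = S m) : IsSubbundle Γ S := by
  intro m₀
  obtain ⟨ι, _, s, hs⟩ := h m₀
  refine ⟨Fintype.card ι, s ∘ (Fintype.equivFin ι).symm, hs.mono fun m hm => ⟨?_, ?_⟩⟩
  · exact (linearIndependent_equiv (Fintype.equivFin ι).symm (f := fun i => (s i).1 m)).2 hm.1
  · rw [← hm.2]
    exact congrArg _ ((Fintype.equivFin ι).symm.surjective.range_comp fun i => (s i).1 m)

section

variable {A : ProjectiveLieAlgebroid I F E} {γ : Connection I F E} {Ω : TwoForm I F E}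

theorem isSubbundle_liftFiber : IsSubbundle (omniSections I F E) (liftFiber A γ Ω) := by
  refine IsSubbundle.of_fintype fun m₀ => ?_
  obtain ⟨k, l, a, c, θ, hθ, h⟩ := A.isSubbundle.exists_adapted_frame m₀
  obtain ⟨r, e, η, hη⟩ := exists_sec_frame (I := I) (F := F) (E := E) m₀
  -- The frame of the lift: γ(aᵢ) + Ω(aᵢ, ·) over a frame of A, and the maps θⱼ ⊗ e_q, where θⱼ is
  -- dual to the complementary cⱼ, as a frame of A⁰.
  let X : Fin k → OmniSec I F E := fun i => γ.splitSec (a i) +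
    ⟨_, aMap_mem_omniSections (h := fun m => Ω.toFun m ((a i).1 m)) fun t ht =>
      Ω.smooth (a i) ⟨t, ht⟩⟩
  let N : Fin l × Fin r → OmniSec I F E := fun p =>
    ⟨_, aMap_mem_omniSections (h := fun m => (θ (Sum.inr p.1) m).smulRight (e p.2 m)) fun t ht =>
      isLocalModule_secSubmodule.smul_mem ⟨_, hθ (Sum.inr p.1) t ht⟩ _ (e p.2).contMDiff⟩
  refine ⟨Fin k ⊕ Fin l × Fin r, inferInstance, Sum.elim X N, ?_⟩
  filter_upwards [h, hη] with m hm hηm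
  have hX : ∀ i, (X i).1 m = (γ.split m + aMap I F E m ∘ₗ Ω.toFun m) ((a i).1 m) := fun i => rfl
  have hN : ∀ p, (N p).1 m = aMap I F E m ((θ (Sum.inr p.1) m).smulRight (e p.2 m)) := fun p => rfl
  have hbX : ∀ i, bMap I F E m ((X i).1 m) = (a i).1 m := fun i => by
    rw [hX, LinearMap.add_apply, LinearMap.comp_apply, map_add, γ.bMap_split, bMap_aMap, add_zero]
  have hbN : ∀ p, bMap I F E m ((N p).1 m) = 0 := fun p => bMap_aMap _
  have hθa : ∀ i j, θ (Sum.inr i) m ((a j).1 m) = 0 := fun i j => by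
    simpa using hm.1 (Sum.inr i) (Sum.inl j)
  have hθc : ∀ i j, θ (Sum.inr i) m ((c j).1 m) = if i = j then 1 else 0 := fun i j => by
    simpa using hm.1 (Sum.inr i) (Sum.inr j)
  have hθaa : ∀ i j, θ (Sum.inl i) m ((a j).1 m) = if i = j then 1 else 0 := fun i j => by
    simpa using hm.1 (Sum.inl i) (Sum.inl j)
  have haA : ∀ i, (a i).1 m ∈ A.fiber m := fun i => hm.2.2 ▸ Submodule.subset_span ⟨i, rfl⟩
  constructor
  · rw [Fintype.linearIndependent_iff]
    intro x hx
    rw [Fintype.sum_sum_type] at hx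
    simp only [Sum.elim_inl, Sum.elim_inr] at hx
    have h1 := congrArg (bMap I F E m) hx
    rw [map_add, map_sum, map_sum, map_zero] at h1
    simp only [map_smul, hbX, hbN, smul_zero, Finset.sum_const_zero, add_zero] at h1
    have hxl : ∀ i, x (Sum.inl i) = 0 := fun i => by
      have := congrArg (θ (Sum.inl i) m) h1
      rw [map_sum, map_zero] at this
      simpa [hθaa] using this
    simp only [hxl, zero_smul, Finset.sum_const_zero, zero_add] at hx
    rintro (i | ⟨j, q⟩)
    · exact hxl i
    -- Pairing with γ(cⱼ) evaluates an element of A⁰ at cⱼ, and η_q then isolates one coefficient.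
    · have h2 := congrArg (fun Y => η q m (omniForm I F E m Y (γ.split m ((c j).1 m)))) hx
      simp only [map_sum, LinearMap.sum_apply, map_smul, LinearMap.smul_apply, hN, omniForm_aMap,
        γ.bMap_split, LinearMap.smulRight_apply, hθc, map_zero, LinearMap.zero_apply, hηm.1,
        Fintype.sum_prod_type] at h2
      simpa using h2
  · apply le_antisymm
    · rw [Submodule.span_le]
      rintro _ ⟨i | p, rfl⟩
      · exact Submodule.mem_sup_left ⟨_, haA i, rfl⟩
      · refine Submodule.mem_sup_right ⟨_, fun t ht => ?_, rfl⟩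
        rw [← hm.2.2] at ht
        obtain ⟨y, rfl⟩ := (Submodule.mem_span_range_iff_exists_fun ℝ).1 ht
        rw [LinearMap.smulRight_apply, map_sum]
        simp [hθa]
    · have hXs : ∀ i, (X i).1 m ∈ Submodule.span ℝ (Set.range fun i => (Sum.elim X N i).1 m) :=
        fun i => Submodule.subset_span ⟨Sum.inl i, rfl⟩
      have hNs : ∀ p, (N p).1 m ∈ Submodule.span ℝ (Set.range fun i => (Sum.elim X N i).1 m) :=
        fun p => Submodule.subset_span ⟨Sum.inr p, rfl⟩
      refine sup_le ?_ ?_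
      · rintro _ ⟨t, ht, rfl⟩
        rw [← hm.2.2] at ht
        obtain ⟨y, rfl⟩ := (Submodule.mem_span_range_iff_exists_fun ℝ).1 ht
        rw [map_sum]
        refine Submodule.sum_mem _ fun i _ => ?_
        rw [map_smul, ← hX]
        exact Submodule.smul_mem _ _ (hXs i)
      · rintro _ ⟨f, hf, rfl⟩
        -- Since f vanishes on A, it is determined by its values on the complementary frame cⱼ.
        have hfd : f = ∑ j, ∑ q, η q m (f ((c j).1 m)) •
            (θ (Sum.inr j) m).smulRight (e q m) := by
          refine LinearMap.ext fun v => ?_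
          conv_lhs => rw [hm.2.1 v]
          rw [map_sum, Fintype.sum_sum_type]
          simp only [Sum.elim_inl, Sum.elim_inr, map_smul, hf _ (haA _), smul_zero,
            Finset.sum_const_zero, zero_add, LinearMap.sum_apply, LinearMap.smul_apply,
            LinearMap.smulRight_apply]
          refine Finset.sum_congr rfl fun j _ => ?_
          conv_lhs => rw [hηm.2 (f ((c j).1 m))]
          rw [Finset.smul_sum]
          exact Finset.sum_congr rfl fun q _ => smul_comm _ _ _
        rw [hfd, map_sum]
        refine Submodule.sum_mem _ fun j _ => ?_
        rw [map_sum]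
        refine Submodule.sum_mem _ fun q _ => ?_
        rw [map_smul]
        exact Submodule.smul_mem _ _ (hNs (j, q))

variable [Nontrivial F]

theorem ProjectiveLieAlgebroid.IsDefectForm.isDirac (hΩ : A.IsDefectForm γ Ω) :
    IsDirac I F E (liftFiber A γ Ω) :=
  ⟨isSubbundle_liftFiber, maximal_liftFiber, fun _ _ hX hY => hΩ.dorfman_mem hX hY⟩

theorem ProjectiveLieAlgebroid.IsDefectForm.isQuotientLieAlgebroid (hΩ : A.IsDefectForm γ Ω) :
    IsQuotientLieAlgebroid (liftFiber A γ Ω) A :=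
  hΩ.isDirac.isQuotientLieAlgebroid map_bMap_liftFiber fun _ Y _ b hX _ ha hb m =>
    ((hΩ.forall_mem_liftFiber_iff ha).1 hX Y b hb m).symm

end

variable [SigmaCompactSpace M]

theorem ProjectiveLieAlgebroid.exists_isDefectForm (A : ProjectiveLieAlgebroid I F E)
    (γ : Connection I F E) : ∃ Ω, A.IsDefectForm γ Ω := by
  obtain ⟨P, hP, h⟩ := A.isSubbundle.exists_projection
  obtain ⟨Ω, hΩ, -⟩ := A.exists_defectForm γ hP (fun m => (h m).1) fun m => (h m).2
  exact ⟨Ω, hΩ⟩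

variable [Nontrivial F]

theorem ProjectiveLieAlgebroid.exists_reducibleDirac (A : ProjectiveLieAlgebroid I F E) :
    ∃ L : ReducibleDirac I F E, IsQuotientLieAlgebroid L.fiber A := by
  obtain ⟨γ⟩ := nonempty_connection I F E
  obtain ⟨Ω, hΩ⟩ := A.exists_isDefectForm γ
  refine ⟨⟨liftFiber A γ Ω, hΩ.isDirac, ?_⟩, hΩ.isQuotientLieAlgebroid⟩
  simp only [map_bMap_liftFiber]
  exact A.isSubbundle

theorem ReducibleDirac.isQuotientLieAlgebroid_iff {L : ReducibleDirac I F E}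
    {A : ProjectiveLieAlgebroid I F E} :
    IsQuotientLieAlgebroid L.fiber A ↔ L.toProjective = A := by
  constructor
  · exact fun h => eq_of_isQuotientLieAlgebroid L.isQuotientLieAlgebroid_toProjective h
  · rintro rfl
    exact L.isQuotientLieAlgebroid_toProjective

-- Injectivity: two Dirac structures with quotient A both equal the lift built from one common
-- choice of γ and Ω. Surjectivity: that lift is itself reducible Dirac with quotient A.
variable (I F E) in
theorem ReducibleDirac.bijective_toProjective :
    Function.Bijective (ReducibleDirac.toProjective (I := I) (F := F) (E := E)) := by
  constructor
  · intro L L' h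
    obtain ⟨γ⟩ := nonempty_connection I F E
    obtain ⟨Ω, hΩ⟩ := L.toProjective.exists_isDefectForm γ
    ext1
    funext m
    rw [hΩ.liftFiber_eq L.isDirac L.isQuotientLieAlgebroid_toProjective m,
      hΩ.liftFiber_eq L'.isDirac (ReducibleDirac.isQuotientLieAlgebroid_iff.2 h.symm) m]
  · intro A
    obtain ⟨L, hL⟩ := A.exists_reducibleDirac
    exact ⟨L, ReducibleDirac.isQuotientLieAlgebroid_iff.1 hL⟩

end Correspondence

/-- Existence takes the projection onto A along C. For uniqueness, 𝓣 = A ⊕ C: the values on A × A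
are prescribed, and all others vanish by the condition on C together with skewness. -/
theorem existsUnique_isOmegaForm
    {EM : Type*} [NormedAddCommGroup EM] [NormedSpace ℝ EM] [FiniteDimensional ℝ EM]
    {H : Type*} [TopologicalSpace H] {I : ModelWithCorners ℝ EM H}
    {M : Type*} [TopologicalSpace M] [ChartedSpace H M] [T2Space M] [IsManifold I ∞ M]
    {F : Type*} [NormedAddCommGroup F] [NormedSpace ℝ F] [FiniteDimensional ℝ F]
    {E : M → Type*} [TopologicalSpace (TotalSpace F E)]
    [∀ m, AddCommGroup (E m)] [∀ m, Module ℝ (E m)] [∀ m, TopologicalSpace (E m)]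
    [FiberBundle F E] [VectorBundle ℝ F E] [ContMDiffVectorBundle ∞ F E I]
    (A : ProjectiveLieAlgebroid I F E) (γ : Connection I F E)
    {C : Π m, Submodule ℝ (TFiber I E m)} (hC : IsSubbundle (tSections I F E) C)
    (h : ∀ m, IsCompl (A.fiber m) (C m)) : ∃! Ω, IsOmegaForm A γ C Ω := by
  obtain ⟨P, hP, hPAC⟩ := A.isSubbundle.exists_projection_of_isCompl hC h
  obtain ⟨Ω, hΩ, hΩ0⟩ := A.exists_defectForm γ hP (fun m => (hPAC m).1) fun m => (hPAC m).2.1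
  refine ⟨Ω, ⟨hΩ, fun m c hc t => hΩ0 m c t ((hPAC m).2.2 c hc)⟩, fun Ω' hΩ' => ?_⟩
  have key : ∀ m v w, Ω'.toFun m v w = Ω.toFun m v w := by
    intro m v w
    have hAC : ∀ v : TFiber I E m, ∃ a ∈ A.fiber m, ∃ c ∈ C m, a + c = v := fun v =>
      Submodule.mem_sup.1 ((h m).sup_eq_top ▸ Submodule.mem_top)
    obtain ⟨a, ha, c, hc, rfl⟩ := hAC v
    obtain ⟨b, hb, d, hd, rfl⟩ := hAC w
    have hvan : ∀ (Ω : TwoForm I F E), (∀ c ∈ C m, ∀ t, Ω.toFun m c t = 0) →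
        Ω.toFun m (a + c) (b + d) = Ω.toFun m a b := fun Ω h0 => by
      rw [LinearMap.map_add₂, map_add, h0 c hc, Ω.skew m a d, h0 d hd, neg_zero, add_zero, add_zero]
    rw [hvan Ω' (hΩ'.2 m), hvan Ω fun c hc t => hΩ0 m c t ((hPAC m).2.2 c hc)]
    obtain ⟨a, rfl⟩ := A.isSubbundle.exists_section_eq isLocalModule_tSections ha
    obtain ⟨b, rfl⟩ := A.isSubbundle.exists_section_eq isLocalModule_tSections hb
    exact congrArg Prod.snd ((hΩ'.1 a b m).trans (hΩ a b m).symm)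
  obtain ⟨f, _, _⟩ := Ω
  obtain ⟨f', _, _⟩ := Ω'
  obtain rfl : f' = f := funext fun m => LinearMap.ext₂ (key m)
  rfl

end OmniLie

end

theorem theorem3p4
    {EM : Type*} [NormedAddCommGroup EM] [NormedSpace ℝ EM] [FiniteDimensional ℝ EM]
    {H : Type*} [TopologicalSpace H] (I : ModelWithCorners ℝ EM H) [I.Boundaryless]
    {M : Type*} [TopologicalSpace M] [ChartedSpace H M] [T2Space M] [SigmaCompactSpace M]
    [IsManifold I ∞ M]
    (F : Type*) [NormedAddCommGroup F] [NormedSpace ℝ F] [FiniteDimensional ℝ F] [Nontrivial F]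
    (E : M → Type*) [TopologicalSpace (Bundle.TotalSpace F E)]
    [∀ m, AddCommGroup (E m)] [∀ m, Module ℝ (E m)] [∀ m, TopologicalSpace (E m)]
    [FiberBundle F E] [VectorBundle ℝ F E] [ContMDiffVectorBundle ∞ F E I] :
    ∃ Φ : OmniLie.ReducibleDirac I F E ≃ OmniLie.ProjectiveLieAlgebroid I F E,
      (∀ L A, OmniLie.IsQuotientLieAlgebroid L.fiber A ↔ Φ L = A) ∧
      ∀ (A : OmniLie.ProjectiveLieAlgebroid I F E) (γ : OmniLie.Connection I F E)
        (C : Π m, Submodule ℝ (OmniLie.TFiber I E m)),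
        OmniLie.IsSubbundle (OmniLie.tSections I F E) C → (∀ m, IsCompl (A.fiber m) (C m)) →
        (∃! Ω, OmniLie.IsOmegaForm A γ C Ω) ∧
        ∀ Ω, OmniLie.IsOmegaForm A γ C Ω →
          ∀ m, (Φ.symm A).fiber m = OmniLie.liftFiber A γ Ω m := by
  let Φ := Equiv.ofBijective _ (OmniLie.ReducibleDirac.bijective_toProjective I F E)
  have hΦ : ∀ L A, OmniLie.IsQuotientLieAlgebroid L.fiber A ↔ Φ L = A := fun L A =>
    OmniLie.ReducibleDirac.isQuotientLieAlgebroid_iff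
  refine ⟨Φ, hΦ, fun A γ C hC h => ⟨OmniLie.existsUnique_isOmegaForm A γ hC h, fun Ω hΩ m => ?_⟩⟩
  -- The condition on C normalises Ω but is not needed for the formula: any smooth form restricting
  -- to the defect on A yields the same lift.
  have hdefect : A.IsDefectForm γ Ω := hΩ.1
  exact hdefect.liftFiber_eq (Φ.symm A).isDirac ((hΦ _ _).2 (Φ.apply_symm_apply A)) m
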